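/- Let $D\subseteq\mathbb R\times\mathbb R^2$ be a non-empty connected open set and consider on $D$ a system of two second-order ODEs $$y''=f_1(x,y,z,y',z'),\qquad z''=f_2(x,y,z,y',z').$$ Put $u=y+iz$. Suppose that an invertible complex point transformation $(x,u)\mapsto(\chi(x),U(x,u))$, $U=Y+iZ$, reduces the system to the linear system $$Y''=-\beta(\chi)\,Z,\qquad Z''=\beta(\chi)\,Y,$$ where primes on $Y,Z$ denote derivatives with respect to $\chi$. Here $\chi$ is a real smooth function of $x$ with $\chi'\neq 0$; $U$ is smooth and, for fixed $x$, holomorphic in $u$ with $\partial U/\partial u\neq 0$; and $\beta$ is a smooth real function on the interval $J$ of values taken by $\chi(x)$ for $(x,y,z)\in D$. Let $d$ be the dimension of the real Lie algebra of smooth infinitesimal Lie point symmetries $\xi\,\partial_x+\eta_1\,\partial_y+\eta_2\,\partial_z$ on $D$ of the original system. Then $d\in\{6,7,15\}$; in particular $d$ is never $5$ or $8$. Moreover, with $t$ the variable on $J$: 1. if $\beta\equiv 0$ on $J$, then $d=15$; 2. if $\beta$ is not identically zero on $J$, then $d=6$ or $d=7$; 3. if $\beta$ is a non-zero constant on $J$,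 then $d=7$; 4. if $\beta(t)$ is $t^{-2}$, $t^{-4}$ (with $0\notin J$) or $(t+1)^{-4}$ (with $-1\notin J$), then $d=7$; 5. if $\beta(t)$ is $t^{-1}$ (with $0\notin J$), $t^2+c$ for some real constant $c$, or $e^{t}$, then $d=6$. -/

import Mathlib

open Set TopologicalSpace
open scoped ContDiff

namespace PointSymmetry

section General

variable {E : Type*} [NormedAddCommGroup E] [NormedSpace ℝ E]

/-- The total derivative `D_x f = f_x + u' f_u` of a function `f(x, u)`,
as a function of the first-order jet `(x, u, u')`. -/
noncomputable def totalDeriv {G : Type*} [NormedAddCommGroup G] [NormedSpace ℝ G]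
    (f : ℝ × E → G) : ℝ × E × E → G :=
  fun j => fderiv ℝ f (j.1, j.2.1) (1, j.2.2)

/-- The total derivative `D_x F = F_x + u' F_u + u'' F_{u'}` of a function `F(x, u, u')`
along the second-order system `u'' = rhs(x, u, u')`. -/
noncomputable def totalDerivAlong {G : Type*} [NormedAddCommGroup G] [NormedSpace ℝ G]
    (rhs : ℝ × E × E → E) (F : ℝ × E × E → G) : ℝ × E × E → G :=
  fun j => fderiv ℝ F j (1, j.2.2, rhs j)

/-- The coefficient `η⁽¹⁾ = D_x η - u' D_x ξ` of the first prolongation of the vector field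
`V = ξ ∂_x + η ∂_u`. -/
noncomputable def firstProlongation (V : ℝ × E → ℝ × E) : ℝ × E × E → E :=
  fun j => totalDeriv (fun q => (V q).2) j - totalDeriv (fun q => (V q).1) j • j.2.2

/-- The coefficient `η⁽²⁾ = D_x η⁽¹⁾ - u'' D_x ξ` of the second prolongation of
`V = ξ ∂_x + η ∂_u`, evaluated on the system `u'' = rhs(x, u, u')`. -/
noncomputable def secondProlongation (rhs : ℝ × E × E → E) (V : ℝ × E → ℝ × E) :
    ℝ × E × E → E :=
  fun j => totalDerivAlong rhs (firstProlongation V) j - totalDeriv (fun q => (V q).1) j • rhs j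

/-- `V = ξ ∂_x + η ∂_u` is a smooth infinitesimal Lie point symmetry, on the domain `D` of the
`(x, u)`-space, of the system `u'' = rhs(x, u, u')`: its second prolongation annihilates
`u'' - rhs(x, u, u')` on the system, i.e. `η⁽²⁾ = ξ rhs_x + η rhs_u + η⁽¹⁾ rhs_{u'}`. -/
def IsLiePointSymmetry (D : Opens (ℝ × E)) (rhs : ℝ × E × E → E) (V : ℝ × E → ℝ × E) : Prop :=
  ContDiffOn ℝ ∞ V D ∧
    ∀ (x : ℝ) (u p : E), (x, u) ∈ D →
      secondProlongation rhs V (x, u, p) =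
        fderiv ℝ rhs (x, u, p) ((V (x, u)).1, (V (x, u)).2, firstProlongation V (x, u, p))

theorem totalDeriv_lin {G : Type*} [NormedAddCommGroup G] [NormedSpace ℝ G]
    (a b : ℝ) (f g : ℝ × E → G) (j : ℝ × E × E)
    (hf : DifferentiableAt ℝ f (j.1, j.2.1)) (hg : DifferentiableAt ℝ g (j.1, j.2.1)) :
    totalDeriv (fun q => a • f q + b • g q) j = a • totalDeriv f j + b • totalDeriv g j := by
  unfold totalDeriv
  have h := ((hf.hasFDerivAt.const_smul a).add (hg.hasFDerivAt.const_smul b)).fderiv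
  have e : (fun q => a • f q + b • g q) = a • f + b • g := rfl
  rw [e, h]
  simp

theorem firstProlongation_lin (a b : ℝ) (V W : ℝ × E → ℝ × E) (j : ℝ × E × E)
    (hV : DifferentiableAt ℝ V (j.1, j.2.1)) (hW : DifferentiableAt ℝ W (j.1, j.2.1)) :
    firstProlongation (a • V + b • W) j =
      a • firstProlongation V j + b • firstProlongation W j := by
  have h1 := totalDeriv_lin a b (fun q => (V q).1) (fun q => (W q).1) j hV.fst hW.fst
  have h2 := totalDeriv_lin a b (fun q => (V q).2) (fun q => (W q).2) j hV.snd hW.snd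
  simp only [firstProlongation, Pi.add_apply, Pi.smul_apply, Prod.fst_add, Prod.snd_add,
    Prod.smul_fst, Prod.smul_snd] at h1 h2 ⊢
  rw [h1, h2]
  module

theorem differentiableAt_totalDeriv {G : Type*} [NormedAddCommGroup G] [NormedSpace ℝ G]
    {f : ℝ × E → G} {j : ℝ × E × E} (hf : ContDiffAt ℝ ∞ f (j.1, j.2.1)) :
    DifferentiableAt ℝ (totalDeriv f) j := by
  have h1 : DifferentiableAt ℝ (fderiv ℝ f) (j.1, j.2.1) :=
    (hf.fderiv_right (m := 1) (by norm_cast)).differentiableAt (by norm_num)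
  have h2 : DifferentiableAt ℝ (fun k : ℝ × E × E => fderiv ℝ f (k.1, k.2.1)) j :=
    DifferentiableAt.comp (g := fderiv ℝ f) (f := fun k : ℝ × E × E => (k.1, k.2.1)) j h1
      (by fun_prop)
  exact h2.clm_apply (by fun_prop)

theorem differentiableAt_firstProlongation {V : ℝ × E → ℝ × E} {j : ℝ × E × E}
    (hV : ContDiffAt ℝ ∞ V (j.1, j.2.1)) : DifferentiableAt ℝ (firstProlongation V) j :=
  (differentiableAt_totalDeriv hV.snd).sub
    ((differentiableAt_totalDeriv hV.fst).smul (by fun_prop))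

theorem IsLiePointSymmetry.lin {D : Opens (ℝ × E)} {rhs : ℝ × E × E → E} {V W : ℝ × E → ℝ × E}
    (hV : IsLiePointSymmetry D rhs V) (hW : IsLiePointSymmetry D rhs W) (a b : ℝ) :
    IsLiePointSymmetry D rhs (a • V + b • W) := by
  refine ⟨(hV.1.const_smul a).add (hW.1.const_smul b), fun x u p hxu => ?_⟩
  have cV : ∀ q ∈ D, ContDiffAt ℝ ∞ V q := fun q hq => hV.1.contDiffAt (D.isOpen.mem_nhds hq)
  have cW : ∀ q ∈ D, ContDiffAt ℝ ∞ W q := fun q hq => hW.1.contDiffAt (D.isOpen.mem_nhds hq)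
  have dV : ∀ q ∈ D, DifferentiableAt ℝ V q := fun q hq => (cV q hq).differentiableAt (by simp)
  have dW : ∀ q ∈ D, DifferentiableAt ℝ W q := fun q hq => (cW q hq).differentiableAt (by simp)
  have hev : firstProlongation (a • V + b • W) =ᶠ[nhds (x, u, p)]
      fun j => a • firstProlongation V j + b • firstProlongation W j := by
    have hc : Continuous (fun k : ℝ × E × E => (k.1, k.2.1)) := by fun_prop
    filter_upwards [hc.continuousAt.preimage_mem_nhds (x := (x, u, p)) (D.isOpen.mem_nhds hxu)]
      with j hj
    exact firstProlongation_lin a b V W j (dV _ hj) (dW _ hj)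
  have fV : DifferentiableAt ℝ (firstProlongation V) (x, u, p) :=
    differentiableAt_firstProlongation (cV _ hxu)
  have fW : DifferentiableAt ℝ (firstProlongation W) (x, u, p) :=
    differentiableAt_firstProlongation (cW _ hxu)
  have h1 := totalDeriv_lin a b (fun q => (V q).1) (fun q => (W q).1) (x, u, p)
    (dV _ hxu).fst (dW _ hxu).fst
  have eV := hV.2 x u p hxu
  have eW := hW.2 x u p hxu
  have hL : secondProlongation rhs (a • V + b • W) (x, u, p) =
      a • secondProlongation rhs V (x, u, p) + b • secondProlongation rhs W (x, u, p) := by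
    simp only [secondProlongation, totalDerivAlong, Pi.add_apply, Pi.smul_apply, Prod.fst_add,
      Prod.smul_fst] at h1 ⊢
    have h := ((fV.hasFDerivAt.const_smul a).add (fW.hasFDerivAt.const_smul b)).fderiv
    have e : (fun j => a • firstProlongation V j + b • firstProlongation W j) =
        a • firstProlongation V + b • firstProlongation W := rfl
    rw [hev.fderiv_eq, e, h, h1]
    simp only [add_apply, smul_apply]
    module
  rw [hL, eV, eW, hev.eq_of_nhds, ← map_smul, ← map_smul, ← map_add]
  simp

theorem isLiePointSymmetry_zero (D : Opens (ℝ × E)) (rhs : ℝ × E × E → E) :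
    IsLiePointSymmetry D rhs 0 := by
  have h0 : firstProlongation (0 : ℝ × E → ℝ × E) = fun _ => 0 := by
    funext j; simp [firstProlongation, totalDeriv]
  refine ⟨contDiffOn_const (c := (0 : ℝ × E)), fun x u p _ => ?_⟩
  have hz : ((0 : ℝ), (0 : E), (0 : E)) = 0 := rfl
  simp [secondProlongation, totalDerivAlong, h0, totalDeriv, hz]

/-- The Lie point symmetry algebra of the system `u'' = rhs(x, u, u')` on the domain `D`, as a real
vector space. A vector field on `D` is represented by its extension by zero outside `D`. -/
def symmetryAlgebra (D : Opens (ℝ × E)) (rhs : ℝ × E × E → E) :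
    Submodule ℝ (ℝ × E → ℝ × E) where
  carrier := {V | (∀ q ∉ D, V q = 0) ∧ IsLiePointSymmetry D rhs V}
  zero_mem' := ⟨fun _ _ => rfl, isLiePointSymmetry_zero D rhs⟩
  add_mem' := by
    rintro V W ⟨hV, hV'⟩ ⟨hW, hW'⟩
    exact ⟨fun q hq => by simp [hV q hq, hW q hq], by simpa using hV'.lin hW' 1 1⟩
  smul_mem' := by
    rintro c V ⟨hV, hV'⟩
    exact ⟨fun q hq => by simp [hV q hq], by simpa using hV'.lin hV' c 0⟩

end General

/-!
A system `y'' = f₁(x, y, z, y', z')`, `z'' = f₂(x, y, z, y', z')` of two real equations is written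
with `u = y + i z ∈ ℂ ≅ ℝ²` and `rhs = f₁ + i f₂ : ℝ × ℂ × ℂ → ℂ`; derivatives, smoothness and
vector fields are real, holomorphy is assumed only of point transformations.
-/

/-- The right-hand side of the reduced optimal form `Y'' = -β(x) Z`, `Z'' = β(x) Y`. -/
def reducedForm (β : ℝ → ℝ) : ℝ × ℂ × ℂ → ℂ :=
  fun j => ⟨-(β j.1 * j.2.1.im), β j.1 * j.2.1.re⟩

/-- The interval over which the new independent variable `χ(x)` ranges, for `(x, u) ∈ D`. -/
def newRange (D : Opens (ℝ × ℂ)) (χ : ℝ → ℝ) : Set ℝ :=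
  χ '' (Prod.fst '' (D : Set (ℝ × ℂ)))

/-- `dU/dχ = D_x U / D_x χ`, as a function of the jet `(x, u, u')`. -/
noncomputable def newDeriv (χ : ℝ → ℝ) (U : ℝ × ℂ → ℂ) : ℝ × ℂ × ℂ → ℂ :=
  fun j => (deriv χ j.1)⁻¹ • totalDeriv U j

/-- `d²U/dχ² = D_x (dU/dχ) / D_x χ` along the system `u'' = rhs(x, u, u')`. -/
noncomputable def newSecondDeriv (rhs : ℝ × ℂ × ℂ → ℂ) (χ : ℝ → ℝ) (U : ℝ × ℂ → ℂ) :
    ℝ × ℂ × ℂ → ℂ :=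
  fun j => (deriv χ j.1)⁻¹ • totalDerivAlong rhs (newDeriv χ U) j

/-- `(x, u) ↦ (χ(x), U(x, u))` is a (locally) invertible complex point transformation on `D`:
real `χ` depending on `x` only, `U` smooth and holomorphic in `u`, with `χ' ≠ 0` and `U_u ≠ 0`. -/
structure IsComplexPointTransformation (D : Opens (ℝ × ℂ)) (χ : ℝ → ℝ) (U : ℝ × ℂ → ℂ) :
    Prop where
  smooth_χ : ContDiffOn ℝ ∞ χ (Prod.fst '' (D : Set (ℝ × ℂ)))
  deriv_χ_ne_zero : ∀ x ∈ Prod.fst '' (D : Set (ℝ × ℂ)), deriv χ x ≠ 0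
  smooth_U : ContDiffOn ℝ ∞ U D
  holomorphic_U : ∀ (x : ℝ) (u : ℂ), (x, u) ∈ D → DifferentiableAt ℂ (fun w => U (x, w)) u
  deriv_U_ne_zero : ∀ (x : ℝ) (u : ℂ), (x, u) ∈ D → deriv (fun w => U (x, w)) u ≠ 0

/-- The complex point transformation `(χ, U)` maps the system `u'' = rhs(x, u, u')` on `D` to the
system `U'' = Ω(χ, U, U')`. -/
structure Reduces (D : Opens (ℝ × ℂ)) (rhs : ℝ × ℂ × ℂ → ℂ) (χ : ℝ → ℝ) (U : ℝ × ℂ → ℂ)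
    (Ω : ℝ × ℂ × ℂ → ℂ) : Prop where
  transformation : IsComplexPointTransformation D χ U
  equation : ∀ (x : ℝ) (u p : ℂ), (x, u) ∈ D →
    newSecondDeriv rhs χ U (x, u, p) = Ω (χ x, U (x, u), newDeriv χ U (x, u, p))

end PointSymmetry

/-! Let V¹ be the prolongation of a vector field V to the jets (x, u, u'), and let A = ∂_x + u' ∂_u
+ rhs ∂_{u'} be the field whose integral curves are the solutions. The bracket of V¹ and A is a
multiple of A plus a vertical term, `symmetryDefect`, so V is a symmetry exactly when V¹ preserves
the direction of A (`bracket_jetField_prolong`). The prolonged point transformation takes V¹ to the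
prolongation of the transformed field and A to χ' times the corresponding field of the reduced
system. Comparing brackets shows that the two defects agree up to the nonvanishing factors U_u and
χ'² (`Reduces.symmetryDefect_eq`), so symmetries correspond locally to those of U'' = iβU.

For U'' = iβU the symmetry condition is a cubic polynomial in u' and splits into finitely many
determining equations. Differentiating these in the directions of u and separating real from
imaginary parts (ξ and β are real) gives βξ_u = 0, ξ_ttt = 0 and 2βξ_t + β'ξ = 0, and makes the part
of η linear in u commute with i wherever β ≠ 0. Hence every solution is a candidate with 15 real
parameters, subject to `IsAdmissible` (`exists_param_of_determiningEquations`).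

The point transformation is only locally invertible and need not be injective on D. The parameters
are therefore found near each point. They are unique there, hence locally constant, hence constant
on the connected set D, and the symmetry algebra is isomorphic to the space of admissible parameters
(`finrank_symmetryAlgebra`).

It remains to count. If β ≡ 0, all 15 parameters are free. Otherwise there remain one complex
factor, two complex constants multiplying the solutions φ and ψ, and a real polynomial p of degree
at most two with 2βp' + β'p = 0. Two such polynomials p, q satisfy p'q = pq' wherever β ≠ 0, hence
are proportional, so d is 6 or 7. As p(2βp' + β'p) = (βp²)', a nonzero p exists essentially when β
is a constant over the square of a quadratic; this tells the listed examples apart. -/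

namespace PointSymmetry

/-! ### Linear differential equations on a whole open interval -/

section LinearODE

open MeasureTheory intervalIntegral BoundedContinuousFunction

variable {E : Type*} [NormedAddCommGroup E] [NormedSpace ℝ E]

theorem hasDerivAt_integral_of_continuousOn [CompleteSpace E] {J : Set ℝ} (hJ : IsOpen J)
    (hJc : J.OrdConnected) {f : ℝ → E} (hf : ContinuousOn f J) {t₀ t : ℝ} (ht₀ : t₀ ∈ J)
    (ht : t ∈ J) : HasDerivAt (fun r => ∫ s in t₀..r, f s) (f t) t :=
  integral_hasDerivAt_right ((hf.mono (hJc.uIcc_subset ht₀ ht)).intervalIntegrable)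
    (hf.stronglyMeasurableAtFilter hJ t ht) (hf.continuousAt (hJ.mem_nhds ht))

/-- A linear first-order differential equation with coefficients continuous on an open interval has
a solution on the whole interval for every initial value. -/
theorem exists_linear_solution [CompleteSpace E] {J : Set ℝ} (hJ : IsOpen J)
    (hJc : J.OrdConnected) {A : ℝ → E →L[ℝ] E} (hA : ContinuousOn A J) {t₀ : ℝ} (ht₀ : t₀ ∈ J)
    (x₀ : E) : ∃ x : ℝ → E, x t₀ = x₀ ∧ ∀ t ∈ J, HasDerivAt x (A t (x t)) t := by
  classical
  set N : ℝ → ℝ := fun t => ∫ s in t₀..t, ‖A s‖ with hN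
  -- A weighted sup norm makes the Picard map contract on all of `J` at once. `N` changes sign at
  -- `t₀` and cosh is even, so both sides of `t₀` are treated alike. The factor 2 gives ∫ ‖A‖ w =
  -- sinh(2N)/2, which is the source of the contraction constant 1/2.
  set w : ℝ → ℝ := fun t => Real.cosh (2 * N t) with hw
  have dN : ∀ t ∈ J, HasDerivAt N ‖A t‖ t := fun t ht =>
    hasDerivAt_integral_of_continuousOn hJ hJc hA.norm ht₀ ht
  have w1 : ∀ t, 1 ≤ w t := fun t => Real.one_le_cosh _
  have w0 : ∀ t, 0 < w t := fun t => one_pos.trans_le (w1 t)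
  have cw : ContinuousOn w J := fun t ht =>
    (Real.continuous_cosh.continuousAt.comp
      ((dN t ht).continuousAt.const_mul 2)).continuousWithinAt
  have iw : ∀ t ∈ J, |∫ s in t₀..t, ‖A s‖ * w s| ≤ w t / 2 := by
    intro t ht
    have h : ∫ s in t₀..t, ‖A s‖ * w s = Real.sinh (2 * N t) / 2 - Real.sinh (2 * N t₀) / 2 := by
      refine integral_eq_sub_of_hasDerivAt (f := fun s => Real.sinh (2 * N s) / 2)
        (fun s hs => ?_) ?_
      · have := (((dN s (hJc.uIcc_subset ht₀ ht hs)).const_mul 2).sinh).div_const 2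
        refine this.congr_deriv ?_
        simp only [hw]; ring
      · exact ((hA.norm.mul cw).mono (hJc.uIcc_subset ht₀ ht)).intervalIntegrable
    have h0 : N t₀ = 0 := by simp [hN]
    rw [h, h0]
    simp only [mul_zero, Real.sinh_zero, zero_div, sub_zero, hw]
    rw [abs_div, abs_two, Real.abs_sinh]
    have := Real.sinh_lt_cosh |2 * N t|
    rw [Real.cosh_abs] at this
    linarith
  let ext : (J → E) → ℝ → E := fun g s => if h : s ∈ J then g ⟨s, h⟩ else 0
  have ext_mem : ∀ (g : J → E) (s : ℝ) (h : s ∈ J), ext g s = g ⟨s, h⟩ := fun g s h => dif_pos h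
  have cext : ∀ g : J →ᵇ E, ContinuousOn (fun s => A s (w s • ext g s)) J := by
    intro g
    have : ContinuousOn (ext g) J := by
      rw [continuousOn_iff_continuous_domRestrict]
      refine g.continuous.congr fun s => ?_
      simp [ext_mem g s s.2]
    exact hA.clm_apply (cw.smul this)
  let F : (J →ᵇ E) → ℝ → E := fun g t => x₀ + ∫ s in t₀..t, A s (w s • ext g s)
  have dF : ∀ (g : J →ᵇ E), ∀ t ∈ J, HasDerivAt (F g) (A t (w t • ext g t)) t := fun g t ht =>
    (hasDerivAt_integral_of_continuousOn hJ hJc (cext g) ht₀ ht).const_add x₀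
  have bd : ∀ (g : ℝ → E) (C : ℝ), (∀ s ∈ J, ‖g s‖ ≤ C) → ∀ t ∈ J,
      ‖∫ s in t₀..t, A s (w s • g s)‖ ≤ C * (w t / 2) := by
    intro g C hg t ht
    have hC : 0 ≤ C := (norm_nonneg _).trans (hg t₀ ht₀)
    have hsub := hJc.uIcc_subset ht₀ ht
    have hi : IntervalIntegrable (fun s => C * (‖A s‖ * w s)) volume t₀ t :=
      (((hA.norm.mul cw).const_mul C).mono hsub).intervalIntegrable
    refine (norm_integral_le_abs_of_norm_le (g := fun s => C * (‖A s‖ * w s)) ?_ hi).trans ?_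
    · refine (ae_restrict_iff' measurableSet_uIoc).2 (Filter.Eventually.of_forall fun s hs => ?_)
      have hs' := hsub (uIoc_subset_uIcc hs)
      calc ‖A s (w s • g s)‖ ≤ ‖A s‖ * ‖w s • g s‖ := (A s).le_opNorm _
        _ = ‖A s‖ * (w s * ‖g s‖) := by rw [norm_smul, Real.norm_of_nonneg (w0 s).le]
        _ ≤ ‖A s‖ * (w s * C) := by
            have := hg s hs'
            have := (w0 s).le
            gcongr
        _ = _ := by ring
    · rw [intervalIntegral.integral_const_mul, abs_mul, abs_of_nonneg hC]
      exact mul_le_mul_of_nonneg_left (iw t ht) hC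
  have ext_le : ∀ (g : J →ᵇ E), ∀ s ∈ J, ‖ext g s‖ ≤ ‖g‖ := fun g s hs => by
    rw [ext_mem g s hs]; exact g.norm_coe_le_norm _
  -- The unknown is the quotient of the solution by `w`, which is bounded on `J` even when the
  -- solution is not.
  let T : (J →ᵇ E) → (J →ᵇ E) := fun g =>
    BoundedContinuousFunction.ofNormedAddCommGroup (fun t : J => (w t)⁻¹ • F g t)
      (by
        have : ContinuousOn (fun t => (w t)⁻¹ • F g t) J :=
          (cw.inv₀ fun t _ => (w0 t).ne').smul fun t ht => (dF g t ht).continuousAt.continuousWithinAt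
        exact continuousOn_iff_continuous_domRestrict.1 this)
      (‖x₀‖ + ‖g‖)
      (by
        intro t
        rw [norm_smul, norm_inv, Real.norm_of_nonneg (w0 t).le, inv_mul_le_iff₀ (w0 t)]
        have h := bd (ext g) ‖g‖ (ext_le g) t t.2
        have h1 := w1 t
        calc ‖F g t‖ ≤ ‖x₀‖ + ‖∫ s in t₀..t, A s (w s • ext g s)‖ := norm_add_le _ _
          _ ≤ w t * (‖x₀‖ + ‖g‖) := by
            nlinarith [norm_nonneg x₀, norm_nonneg g, mul_nonneg (norm_nonneg g) (w0 t).le])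
  have hT : ContractingWith (1 / 2) T := by
    refine ⟨by rw [← NNReal.coe_lt_coe]; norm_num, LipschitzWith.of_dist_le_mul fun g h => ?_⟩
    rw [BoundedContinuousFunction.dist_le (by positivity)]
    intro t
    have ht := t.2
    have e : T g t - T h t = (w t)⁻¹ • ∫ s in t₀..t, A s (w s • (ext g s - ext h s)) := by
      change (w t)⁻¹ • F g t - (w t)⁻¹ • F h t = _
      rw [← smul_sub]
      congr 1
      simp only [F, add_sub_add_left_eq_sub]
      rw [← integral_sub ((cext g).mono (hJc.uIcc_subset ht₀ ht)).intervalIntegrable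
        ((cext h).mono (hJc.uIcc_subset ht₀ ht)).intervalIntegrable]
      simp [smul_sub]
    rw [dist_eq_norm, e, norm_smul, norm_inv, Real.norm_of_nonneg (w0 t).le,
      inv_mul_le_iff₀ (w0 t)]
    refine (bd (fun s => ext g s - ext h s) (dist g h) (fun s hs => ?_) t ht).trans (le_of_eq ?_)
    · rw [ext_mem g s hs, ext_mem h s hs, ← dist_eq_norm]
      exact g.dist_coe_le_dist _
    · push_cast; ring
  obtain ⟨g, hg⟩ : ∃ g, T g = g := ⟨hT.fixedPoint, hT.fixedPoint_isFixedPt⟩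
  refine ⟨F g, by simp [F], fun t ht => (dF g t ht).congr_deriv ?_⟩
  congr 1
  rw [ext_mem g t ht]
  have : (w t)⁻¹ • F g t = g ⟨t, ht⟩ :=
    congrArg (fun k : J →ᵇ E => k ⟨t, ht⟩) hg
  rw [← this, smul_inv_smul₀ (w0 t).ne']

/-- The equation `φ'' = i β φ` has two smooth solutions with Wronskian one on every open interval
on which `β` is smooth. -/
theorem exists_fundamental_system {J : Set ℝ} (hJ : IsOpen J) (hJc : J.OrdConnected)
    (hne : J.Nonempty) {β : ℝ → ℝ} (hβ : ContDiffOn ℝ ∞ β J) :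
    ∃ φ ψ : ℝ → ℂ, ContDiffOn ℝ ∞ φ J ∧ ContDiffOn ℝ ∞ ψ J ∧
      (∀ t ∈ J, deriv (deriv φ) t = β t • (Complex.I * φ t)) ∧
      (∀ t ∈ J, deriv (deriv ψ) t = β t • (Complex.I * ψ t)) ∧
      ∀ t ∈ J, φ t * deriv ψ t - deriv φ t * ψ t = 1 := by
  obtain ⟨t₀, ht₀⟩ := hne
  let A : ℝ → ℂ × ℂ →L[ℝ] ℂ × ℂ := fun t =>
    (ContinuousLinearMap.snd ℝ ℂ ℂ).prod (β t • (Complex.I • ContinuousLinearMap.fst ℝ ℂ ℂ))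
  have hA : ContinuousOn A J := by
    have h : ContinuousOn (fun t => β t • (Complex.I • ContinuousLinearMap.fst ℝ ℂ ℂ)) J :=
      hβ.continuousOn.smul continuousOn_const
    have e : A = fun t => (ContinuousLinearMap.inl ℝ ℂ ℂ).comp (ContinuousLinearMap.snd ℝ ℂ ℂ) +
        (ContinuousLinearMap.inr ℝ ℂ ℂ).comp
          (β t • (Complex.I • ContinuousLinearMap.fst ℝ ℂ ℂ)) := by
      funext t; ext <;> simp [A]
    rw [e]
    exact continuousOn_const.add (continuousOn_const.clm_comp h)
  have key : ∀ x₀ : ℂ × ℂ, ∃ φ : ℝ → ℂ, ContDiffOn ℝ ∞ φ J ∧ φ t₀ = x₀.1 ∧ deriv φ t₀ = x₀.2 ∧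
      (∀ t ∈ J, HasDerivAt φ (deriv φ t) t) ∧
      ∀ t ∈ J, HasDerivAt (deriv φ) (β t • (Complex.I * φ t)) t := by
    intro x₀
    obtain ⟨x, hx0, hx⟩ := exists_linear_solution hJ hJc hA ht₀ x₀
    have h1 : ∀ t ∈ J, HasDerivAt (fun t => (x t).1) (x t).2 t := fun t ht => by
      exact (((ContinuousLinearMap.fst ℝ ℂ ℂ).hasFDerivAt (x := x t)).comp_hasDerivAt t
        (hx t ht)).congr_deriv (by simp [A])
    have h2 : ∀ t ∈ J, HasDerivAt (fun t => (x t).2) (β t • (Complex.I * (x t).1)) t :=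
      fun t ht => by
      exact (((ContinuousLinearMap.snd ℝ ℂ ℂ).hasFDerivAt (x := x t)).comp_hasDerivAt t
        (hx t ht)).congr_deriv (by simp [A])
    have h3 : EqOn (deriv fun t => (x t).1) (fun t => (x t).2) J := fun t ht => (h1 t ht).deriv
    have h4 : ∀ t ∈ J, HasDerivAt (deriv fun t => (x t).1) (β t • (Complex.I * (x t).1)) t :=
      fun t ht => (h2 t ht).congr_of_eventuallyEq (h3.eventuallyEq_of_mem (hJ.mem_nhds ht))
    -- Bootstrapping: the solution and its derivative gain one order of differentiability together,
    -- because the equation expresses the derivative of each through the other.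
    have hs : ∀ n : ℕ, ContDiffOn ℝ n (fun t => (x t).1) J ∧
        ContDiffOn ℝ n (fun t => (x t).2) J := by
      intro n
      induction n with
      | zero =>
        exact ⟨contDiffOn_zero.2 fun t ht => (h1 t ht).continuousAt.continuousWithinAt,
          contDiffOn_zero.2 fun t ht => (h2 t ht).continuousAt.continuousWithinAt⟩
      | succ n ih =>
        have hβn : ContDiffOn ℝ n β J := hβ.of_le (by exact_mod_cast le_top)
        push_cast
        refine ⟨(contDiffOn_succ_iff_deriv_of_isOpen hJ).2 ⟨fun t ht =>
            (h1 t ht).differentiableAt.differentiableWithinAt, by simp, ih.2.congr h3⟩,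
          (contDiffOn_succ_iff_deriv_of_isOpen hJ).2 ⟨fun t ht =>
            (h2 t ht).differentiableAt.differentiableWithinAt, by simp, ?_⟩⟩
        exact (hβn.smul (contDiffOn_const.mul ih.1)).congr fun t ht => (h2 t ht).deriv
    exact ⟨fun t => (x t).1, contDiffOn_infty.2 fun n => (hs n).1, by simp [hx0],
      by simp [h3 ht₀, hx0], fun t ht => by rw [h3 ht]; exact h1 t ht, h4⟩
  obtain ⟨φ, cφ, φ0, φ0', dφ, ddφ⟩ := key (1, 0)
  obtain ⟨ψ, cψ, ψ0, ψ0', dψ, ddψ⟩ := key (0, 1)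
  refine ⟨φ, ψ, cφ, cψ, fun t ht => (ddφ t ht).deriv, fun t ht => (ddψ t ht).deriv,
    fun t ht => ?_⟩
  have dW : ∀ t ∈ J, HasDerivAt (fun t => φ t * deriv ψ t - deriv φ t * ψ t) 0 t := fun t ht => by
    refine (((dφ t ht).mul (ddψ t ht)).sub ((ddφ t ht).mul (dψ t ht))).congr_deriv ?_
    simp only [Complex.real_smul]; ring
  have hc := hJ.is_const_of_deriv_eq_zero hJc.isPreconnected
    (fun t ht => (dW t ht).differentiableAt.differentiableWithinAt)
    (fun t ht => (dW t ht).deriv) ht ht₀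
  simpa [φ0, ψ0, φ0', ψ0'] using hc

end LinearODE

/-! ### Brackets of related vector fields and the prolongation formula -/

section Transfer

variable {E : Type*} [NormedAddCommGroup E] [NormedSpace ℝ E]

/-- If `DΦ X = f • X̃ ∘ Φ` and `DΦ Y = Ỹ ∘ Φ`, the Lie brackets are related by the product rule. -/
theorem fderiv_bracket_of_related {F G : Type*} [NormedAddCommGroup F] [NormedSpace ℝ F]
    [NormedAddCommGroup G] [NormedSpace ℝ G] {Φ : F → G} {X Y : F → F} {X' Y' : G → G} {f : F → ℝ}
    {z : F} (hΦ : ContDiffAt ℝ ∞ Φ z) (hX : DifferentiableAt ℝ X z) (hY : DifferentiableAt ℝ Y z)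
    (hX' : DifferentiableAt ℝ X' (Φ z)) (hY' : DifferentiableAt ℝ Y' (Φ z))
    (hf : DifferentiableAt ℝ f z)
    (eX : ∀ᶠ w in nhds z, fderiv ℝ Φ w (X w) = f w • X' (Φ w))
    (eY : ∀ᶠ w in nhds z, fderiv ℝ Φ w (Y w) = Y' (Φ w)) :
    fderiv ℝ Φ z (fderiv ℝ X z (Y z) - fderiv ℝ Y z (X z)) =
      fderiv ℝ f z (Y z) • X' (Φ z) +
        f z • (fderiv ℝ X' (Φ z) (Y' (Φ z)) - fderiv ℝ Y' (Φ z) (X' (Φ z))) := by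
  have dΦ : DifferentiableAt ℝ Φ z := hΦ.differentiableAt (by simp)
  have ddΦ : DifferentiableAt ℝ (fderiv ℝ Φ) z :=
    (hΦ.fderiv_right (m := 1) (by norm_cast)).differentiableAt (by norm_num)
  -- Each relation is differentiated along the other field. Both results contain the second
  -- derivative of `Φ` at the pair `X z`, `Y z`, which cancels by symmetry.
  have sym : fderiv ℝ (fderiv ℝ Φ) z (X z) (Y z) = fderiv ℝ (fderiv ℝ Φ) z (Y z) (X z) :=
    (hΦ.isSymmSndFDerivAt (by
      rw [minSmoothness_of_isRCLikeNormedField]; exact WithTop.coe_le_coe.2 le_top)).eq _ _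
  have hX1 := congrArg (fun L => L (Y z)) (Filter.EventuallyEq.fderiv_eq (𝕜 := ℝ) eX)
  have hY1 := congrArg (fun L => L (X z)) (Filter.EventuallyEq.fderiv_eq (𝕜 := ℝ) eY)
  have cX : fderiv ℝ (fun w => X' (Φ w)) z = (fderiv ℝ X' (Φ z)).comp (fderiv ℝ Φ z) :=
    fderiv_comp z hX' dΦ
  have cY : fderiv ℝ (fun w => Y' (Φ w)) z = (fderiv ℝ Y' (Φ z)).comp (fderiv ℝ Φ z) :=
    fderiv_comp z hY' dΦ
  have dX' : DifferentiableAt ℝ (fun w => X' (Φ w)) z := hX'.comp z dΦ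
  rw [fderiv_clm_apply ddΦ hX, fderiv_fun_smul hf dX', cX] at hX1
  rw [fderiv_clm_apply ddΦ hY, cY] at hY1
  simp only [add_apply, ContinuousLinearMap.comp_apply, smul_apply,
    ContinuousLinearMap.flip_apply, ContinuousLinearMap.smulRight_apply] at hX1 hY1
  rw [eY.self_of_nhds] at hX1
  rw [eX.self_of_nhds, map_smul] at hY1
  rw [map_sub, smul_sub, ← hY1, sym]
  rw [← sub_eq_zero] at hX1 ⊢
  rw [← hX1]
  abel

/-- The vector field `∂_x + u' ∂_u + rhs ∂_{u'}` of the system `u'' = rhs(x, u, u')`. -/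
def jetField (rhs : ℝ × E × E → E) : ℝ × E × E → ℝ × E × E :=
  fun j => (1, j.2.2, rhs j)

/-- The first prolongation of `V` as a vector field on the space of first-order jets. -/
noncomputable def prolong (V : ℝ × E → ℝ × E) : ℝ × E × E → ℝ × E × E :=
  fun j => ((V (j.1, j.2.1)).1, (V (j.1, j.2.1)).2, firstProlongation V j)

/-- The failure of `V` to satisfy the symmetry condition of `u'' = rhs(x, u, u')`. -/
noncomputable def symmetryDefect (rhs : ℝ × E × E → E) (V : ℝ × E → ℝ × E) : ℝ × E × E → E :=
  fun j => fderiv ℝ rhs j (prolong V j) - secondProlongation rhs V j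

theorem isLiePointSymmetry_iff {D : Opens (ℝ × E)} {rhs : ℝ × E × E → E} {V : ℝ × E → ℝ × E} :
    IsLiePointSymmetry D rhs V ↔ ContDiffOn ℝ ∞ V D ∧
      ∀ (x : ℝ) (u p : E), (x, u) ∈ D → symmetryDefect rhs V (x, u, p) = 0 :=
  and_congr_right fun _ => forall₃_congr fun _ _ _ => imp_congr_right fun _ => by
    rw [symmetryDefect, sub_eq_zero, eq_comm]; rfl

theorem hasFDerivAt_basePoint (j : ℝ × E × E) :
    HasFDerivAt (fun k : ℝ × E × E => (k.1, k.2.1))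
      ((ContinuousLinearMap.fst ℝ ℝ (E × E)).prod
        ((ContinuousLinearMap.fst ℝ E E).comp (ContinuousLinearMap.snd ℝ ℝ (E × E)))) j :=
  ((ContinuousLinearMap.fst ℝ ℝ (E × E)).prod
    ((ContinuousLinearMap.fst ℝ E E).comp (ContinuousLinearMap.snd ℝ ℝ (E × E)))).hasFDerivAt

theorem fderiv_comp_basePoint {G : Type*} [NormedAddCommGroup G] [NormedSpace ℝ G]
    {f : ℝ × E → G} {j : ℝ × E × E} (hf : DifferentiableAt ℝ f (j.1, j.2.1)) (w : ℝ × E × E) :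
    fderiv ℝ (fun k : ℝ × E × E => f (k.1, k.2.1)) j w = fderiv ℝ f (j.1, j.2.1) (w.1, w.2.1) := by
  have h : HasFDerivAt (fun k : ℝ × E × E => f (k.1, k.2.1)) _ j :=
    HasFDerivAt.comp (g := f) (f := fun k : ℝ × E × E => (k.1, k.2.1)) j hf.hasFDerivAt
      (hasFDerivAt_basePoint j)
  rw [h.fderiv]
  simp

theorem differentiableAt_prolong {V : ℝ × E → ℝ × E} {j : ℝ × E × E}
    (hV : ContDiffAt ℝ ∞ V (j.1, j.2.1)) : DifferentiableAt ℝ (prolong V) j := by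
  have h : DifferentiableAt ℝ (fun k : ℝ × E × E => V (k.1, k.2.1)) j :=
    DifferentiableAt.comp (g := V) (f := fun k : ℝ × E × E => (k.1, k.2.1)) j
      (hV.differentiableAt (by simp)) (hasFDerivAt_basePoint j).differentiableAt
  exact h.fst.prodMk (h.snd.prodMk (differentiableAt_firstProlongation hV))

/-- The first prolongation is defined so that the u-component of the bracket is a multiple of the
one of `jetField rhs`, with the factor -D_x ξ forced by the first component. What is left over in
the u'-component is exactly the symmetry defect. This turns the symmetry condition into a
coordinate-free statement, which can be transported by a map. -/
theorem bracket_jetField_prolong {rhs : ℝ × E × E → E} {V : ℝ × E → ℝ × E} {j : ℝ × E × E}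
    (hrhs : DifferentiableAt ℝ rhs j) (hV : ContDiffAt ℝ ∞ V (j.1, j.2.1)) :
    fderiv ℝ (jetField rhs) j (prolong V j) - fderiv ℝ (prolong V) j (jetField rhs j) =
      -(totalDeriv (fun q => (V q).1) j) • jetField rhs j + (0, 0, symmetryDefect rhs V j) := by
  have dV : DifferentiableAt ℝ V (j.1, j.2.1) := hV.differentiableAt (by simp)
  have h1 : fderiv ℝ (jetField rhs) j =
      (0 : ℝ × E × E →L[ℝ] ℝ).prod (((ContinuousLinearMap.snd ℝ E E).comp
        (ContinuousLinearMap.snd ℝ ℝ (E × E))).prod (fderiv ℝ rhs j)) :=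
    HasFDerivAt.fderiv ((hasFDerivAt_const (1 : ℝ) j).prodMk
      (((ContinuousLinearMap.snd ℝ E E).comp
        (ContinuousLinearMap.snd ℝ ℝ (E × E))).hasFDerivAt.prodMk hrhs.hasFDerivAt))
  have hb := hasFDerivAt_basePoint j
  have d1 : DifferentiableAt ℝ (fun k : ℝ × E × E => (V (k.1, k.2.1)).1) j :=
    DifferentiableAt.comp (g := fun q => (V q).1) (f := fun k : ℝ × E × E => (k.1, k.2.1)) j
      dV.fst hb.differentiableAt
  have d2 : DifferentiableAt ℝ (fun k : ℝ × E × E => (V (k.1, k.2.1)).2) j :=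
    DifferentiableAt.comp (g := fun q => (V q).2) (f := fun k : ℝ × E × E => (k.1, k.2.1)) j
      dV.snd hb.differentiableAt
  have d3 := differentiableAt_firstProlongation hV
  have h2 : fderiv ℝ (prolong V) j =
      (fderiv ℝ (fun k : ℝ × E × E => (V (k.1, k.2.1)).1) j).prod
        ((fderiv ℝ (fun k : ℝ × E × E => (V (k.1, k.2.1)).2) j).prod
          (fderiv ℝ (firstProlongation V) j)) :=
    HasFDerivAt.fderiv (d1.hasFDerivAt.prodMk (d2.hasFDerivAt.prodMk d3.hasFDerivAt))
  have e1 := fderiv_comp_basePoint (f := fun q => (V q).1) dV.fst (jetField rhs j)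
  have e2 := fderiv_comp_basePoint (f := fun q => (V q).2) dV.snd (jetField rhs j)
  rw [h1, h2]
  simp only [ContinuousLinearMap.prod_apply, e1, e2]
  refine Prod.ext ?_ (Prod.ext ?_ ?_)
  · simp [jetField, totalDeriv]
  · simp [jetField, prolong, firstProlongation, totalDeriv]
  · simp [jetField, symmetryDefect, secondProlongation, totalDerivAlong]
    abel

end Transfer

/-! ### Derivatives of a point transformation and of its prolongation -/

section PointTransformation

/-- The point transformation `(x, u) ↦ (χ(x), U(x, u))`. -/
def pointMap (χ : ℝ → ℝ) (U : ℝ × ℂ → ℂ) : ℝ × ℂ → ℝ × ℂ := fun q => (χ q.1, U q)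

/-- The first prolongation of the point transformation `(x, u) ↦ (χ(x), U(x, u))`. -/
noncomputable def jetMap (χ : ℝ → ℝ) (U : ℝ × ℂ → ℂ) : ℝ × ℂ × ℂ → ℝ × ℂ × ℂ :=
  fun j => (χ j.1, U (j.1, j.2.1), newDeriv χ U j)

variable {D : Opens (ℝ × ℂ)} {χ : ℝ → ℝ} {U : ℝ × ℂ → ℂ}

theorem isOpen_fst_image (D : Opens (ℝ × ℂ)) : IsOpen (Prod.fst '' (D : Set (ℝ × ℂ))) :=
  isOpenMap_fst _ D.isOpen

namespace IsComplexPointTransformation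

variable (h : IsComplexPointTransformation D χ U)

include h

theorem mono {D' : Opens (ℝ × ℂ)} (hD : D' ≤ D) : IsComplexPointTransformation D' χ U where
  smooth_χ := h.smooth_χ.mono (image_mono hD)
  deriv_χ_ne_zero x hx := h.deriv_χ_ne_zero x (image_mono hD hx)
  smooth_U := h.smooth_U.mono hD
  holomorphic_U x u hq := h.holomorphic_U x u (hD hq)
  deriv_U_ne_zero x u hq := h.deriv_U_ne_zero x u (hD hq)

theorem contDiffAt_χ {q : ℝ × ℂ} (hq : q ∈ D) : ContDiffAt ℝ ∞ χ q.1 :=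
  h.smooth_χ.contDiffAt ((isOpen_fst_image D).mem_nhds (mem_image_of_mem _ hq))

theorem contDiffAt_U {q : ℝ × ℂ} (hq : q ∈ D) : ContDiffAt ℝ ∞ U q :=
  h.smooth_U.contDiffAt (D.isOpen.mem_nhds hq)

theorem contDiffAt_deriv_χ {q : ℝ × ℂ} (hq : q ∈ D) : ContDiffAt ℝ ∞ (deriv χ) q.1 :=
  ((h.contDiffAt_χ hq).fderiv_right (m := ∞) (by simp)).clm_apply contDiffAt_const

theorem contDiffAt_pointMap {q : ℝ × ℂ} (hq : q ∈ D) : ContDiffAt ℝ ∞ (pointMap χ U) q :=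
  ((h.contDiffAt_χ hq).comp q contDiffAt_fst).prodMk (h.contDiffAt_U hq)

theorem deriv_ne_zero {q : ℝ × ℂ} (hq : q ∈ D) : deriv χ q.1 ≠ 0 :=
  h.deriv_χ_ne_zero _ (mem_image_of_mem _ hq)

theorem fderiv_pointMap {q : ℝ × ℂ} (hq : q ∈ D) (v : ℝ × ℂ) :
    fderiv ℝ (pointMap χ U) q v = (v.1 * deriv χ q.1, fderiv ℝ U q v) := by
  have h1 : HasFDerivAt (fun q : ℝ × ℂ => χ q.1) _ q :=
    HasFDerivAt.comp (g := χ) (f := fun q : ℝ × ℂ => q.1) q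
      ((h.contDiffAt_χ hq).differentiableAt (by simp)).hasDerivAt.hasFDerivAt hasFDerivAt_fst
  have h2 := ((h.contDiffAt_U hq).differentiableAt (by simp)).hasFDerivAt
  have h3 : HasFDerivAt (pointMap χ U) _ q := h1.prodMk h2
  rw [h3.fderiv]
  simp

/-- Holomorphy in `u` enters here: it makes the real derivative complex linear in the vertical
direction, so that the transformation rule of the defect is multiplication by the single complex
number U_u. -/
theorem fderiv_U_vertical {q : ℝ × ℂ} (hq : q ∈ D) (w : ℂ) :
    fderiv ℝ U q (0, w) = fderiv ℝ U q (0, 1) * w := by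
  have hU := ((h.contDiffAt_U hq).differentiableAt (by simp)).hasFDerivAt
  have h1 : HasFDerivAt (fun z : ℂ => U (q.1, z)) _ q.2 :=
    HasFDerivAt.comp (g := U) (f := fun z : ℂ => (q.1, z)) q.2 hU
      ((hasFDerivAt_const q.1 q.2).prodMk (hasFDerivAt_id q.2))
  have h2 := (h.holomorphic_U q.1 q.2 hq).hasFDerivAt.restrictScalars ℝ
  have e := h1.unique h2
  have e1 : ∀ z : ℂ, fderiv ℝ U q (0, z) = fderiv ℂ (fun w => U (q.1, w)) q.2 z := fun z => by
    simpa using congrArg (fun L => L z) e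
  rw [e1, e1]
  have := (fderiv ℂ (fun w => U (q.1, w)) q.2).map_smul w 1
  rw [smul_eq_mul, mul_one, smul_eq_mul] at this
  rw [this, mul_comm]

theorem fderiv_U_one_ne_zero {q : ℝ × ℂ} (hq : q ∈ D) : fderiv ℝ U q (0, 1) ≠ 0 := by
  have hU := ((h.contDiffAt_U hq).differentiableAt (by simp)).hasFDerivAt
  have h1 : HasFDerivAt (fun z : ℂ => U (q.1, z)) _ q.2 :=
    HasFDerivAt.comp (g := U) (f := fun z : ℂ => (q.1, z)) q.2 hU
      ((hasFDerivAt_const q.1 q.2).prodMk (hasFDerivAt_id q.2))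
  have h2 := (h.holomorphic_U q.1 q.2 hq).hasDerivAt.hasFDerivAt.restrictScalars ℝ
  have e := congrArg (fun L => L 1) (h1.unique h2)
  simp only [ContinuousLinearMap.comp_apply, ContinuousLinearMap.prod_apply,
    zero_apply, ContinuousLinearMap.id_apply] at e
  rw [e]
  simpa using h.deriv_U_ne_zero q.1 q.2 hq

theorem fderiv_pointMap_injective {q : ℝ × ℂ} (hq : q ∈ D) :
    Function.Injective (fderiv ℝ (pointMap χ U) q) := by
  rw [injective_iff_map_eq_zero]
  rintro ⟨s, w⟩ hv
  rw [h.fderiv_pointMap hq, Prod.mk_eq_zero] at hv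
  have hs : s = 0 := (mul_eq_zero.1 hv.1).resolve_right (h.deriv_ne_zero hq)
  have h2 := hv.2
  rw [hs, h.fderiv_U_vertical hq] at h2
  rw [hs, (mul_eq_zero.1 h2).resolve_left (h.fderiv_U_one_ne_zero hq)]
  rfl

theorem contDiffAt_newDeriv {j : ℝ × ℂ × ℂ} (hj : (j.1, j.2.1) ∈ D) :
    ContDiffAt ℝ ∞ (newDeriv χ U) j := by
  have h1 : ContDiffAt ℝ ∞ (fun k : ℝ × ℂ × ℂ => fderiv ℝ U (k.1, k.2.1)) j :=
    ContDiffAt.comp (g := fderiv ℝ U) (f := fun k : ℝ × ℂ × ℂ => (k.1, k.2.1)) j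
      ((h.contDiffAt_U hj).fderiv_right (m := ∞) (by simp)) (by fun_prop)
  have h2 : ContDiffAt ℝ ∞ (fun k : ℝ × ℂ × ℂ => deriv χ k.1) j :=
    ContDiffAt.comp (g := deriv χ) (f := fun k : ℝ × ℂ × ℂ => k.1) j
      (h.contDiffAt_deriv_χ hj) (by fun_prop)
  exact (h2.inv (h.deriv_ne_zero hj)).smul (h1.clm_apply (by fun_prop))

theorem contDiffAt_jetMap {j : ℝ × ℂ × ℂ} (hj : (j.1, j.2.1) ∈ D) :
    ContDiffAt ℝ ∞ (jetMap χ U) j := by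
  have h1 : ContDiffAt ℝ ∞ (fun k : ℝ × ℂ × ℂ => U (k.1, k.2.1)) j :=
    ContDiffAt.comp (g := U) (f := fun k : ℝ × ℂ × ℂ => (k.1, k.2.1)) j
      (h.contDiffAt_U hj) (by fun_prop)
  have h2 : ContDiffAt ℝ ∞ (fun k : ℝ × ℂ × ℂ => χ k.1) j :=
    ContDiffAt.comp (g := χ) (f := fun k : ℝ × ℂ × ℂ => k.1) j
      (h.contDiffAt_χ hj) (by fun_prop)
  exact h2.prodMk (h1.prodMk (h.contDiffAt_newDeriv hj))

theorem fderiv_jetMap {j : ℝ × ℂ × ℂ} (hj : (j.1, j.2.1) ∈ D) (v : ℝ × ℂ × ℂ) :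
    fderiv ℝ (jetMap χ U) j v =
      (v.1 * deriv χ j.1, fderiv ℝ U (j.1, j.2.1) (v.1, v.2.1), fderiv ℝ (newDeriv χ U) j v) := by
  have h1 : HasFDerivAt (fun k : ℝ × ℂ × ℂ => χ k.1) _ j :=
    HasFDerivAt.comp (g := χ) (f := fun k : ℝ × ℂ × ℂ => k.1) j
      ((h.contDiffAt_χ hj).differentiableAt (by simp)).hasDerivAt.hasFDerivAt hasFDerivAt_fst
  have h2 : HasFDerivAt (fun k : ℝ × ℂ × ℂ => U (k.1, k.2.1)) _ j :=
    HasFDerivAt.comp (g := U) (f := fun k : ℝ × ℂ × ℂ => (k.1, k.2.1)) j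
      ((h.contDiffAt_U hj).differentiableAt (by simp)).hasFDerivAt (hasFDerivAt_basePoint j)
  have h3 := ((h.contDiffAt_newDeriv hj).differentiableAt (by simp)).hasFDerivAt
  have h4 : HasFDerivAt (jetMap χ U) _ j := h1.prodMk (h2.prodMk h3)
  rw [h4.fderiv]
  simp

/-- The transformed derivative (U_x + U_u u')/χ' is affine in u' with slope U_u/χ'. -/
theorem fderiv_newDeriv_vertical {j : ℝ × ℂ × ℂ} (hj : (j.1, j.2.1) ∈ D) (r : ℂ) :
    fderiv ℝ (newDeriv χ U) j (0, 0, r) =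
      (deriv χ j.1)⁻¹ • (fderiv ℝ U (j.1, j.2.1) (0, 1) * r) := by
  have h1 : HasFDerivAt (fun p : ℂ => newDeriv χ U (j.1, j.2.1, p)) _ j.2.2 :=
    HasFDerivAt.comp (g := newDeriv χ U) (f := fun p : ℂ => (j.1, j.2.1, p)) j.2.2
      ((h.contDiffAt_newDeriv hj).differentiableAt (by simp)).hasFDerivAt
      ((hasFDerivAt_const j.1 j.2.2).prodMk ((hasFDerivAt_const j.2.1 j.2.2).prodMk
        (hasFDerivAt_id j.2.2)))
  have h2 : HasFDerivAt (fun p : ℂ => newDeriv χ U (j.1, j.2.1, p)) _ j.2.2 :=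
    ((fderiv ℝ U (j.1, j.2.1)).hasFDerivAt.comp j.2.2
      ((hasFDerivAt_const (1 : ℝ) j.2.2).prodMk (hasFDerivAt_id j.2.2))).const_smul (deriv χ j.1)⁻¹
  have e := congrArg (fun L => L r) (h1.unique h2)
  rw [← h.fderiv_U_vertical hj]
  simpa using e

end IsComplexPointTransformation

end PointTransformation

/-! ### Transport of the symmetry condition -/

section PointTransformation

variable {D : Opens (ℝ × ℂ)} {χ : ℝ → ℝ} {U : ℝ × ℂ → ℂ} {rhs Ω : ℝ × ℂ × ℂ → ℂ}

theorem eventually_mem_of_basePoint_mem {j : ℝ × ℂ × ℂ} (hj : (j.1, j.2.1) ∈ D) :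
    ∀ᶠ k : ℝ × ℂ × ℂ in nhds j, (k.1, k.2.1) ∈ D :=
  (hasFDerivAt_basePoint j).continuousAt.preimage_mem_nhds (D.isOpen.mem_nhds hj)

/-- This is the geometric meaning of the first prolongation: it is the vertical remainder of the
derivative of `V` along the contact direction (1, u'). -/
theorem fderiv_eq_totalDeriv_smul_add {E : Type*} [NormedAddCommGroup E] [NormedSpace ℝ E]
    {V : ℝ × E → ℝ × E} {j : ℝ × E × E} (hV : DifferentiableAt ℝ V (j.1, j.2.1)) :
    fderiv ℝ V (j.1, j.2.1) (1, j.2.2) =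
      totalDeriv (fun q => (V q).1) j • (1, j.2.2) + (0, firstProlongation V j) := by
  have h : HasFDerivAt V _ (j.1, j.2.1) := hV.fst.hasFDerivAt.prodMk hV.snd.hasFDerivAt
  rw [h.fderiv]
  simp [firstProlongation, totalDeriv]

/-- A point transformation carries the prolongation of a vector field to the prolongation of the
transformed vector field. -/
theorem IsComplexPointTransformation.fderiv_jetMap_prolong
    (h : IsComplexPointTransformation D χ U) {V W : ℝ × ℂ → ℝ × ℂ}
    (hV : ContDiffOn ℝ ∞ V D) (hW : ∀ q ∈ D, ContDiffAt ℝ ∞ W (pointMap χ U q))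
    (hVW : ∀ q ∈ D, fderiv ℝ (pointMap χ U) q (V q) = W (pointMap χ U q))
    {j : ℝ × ℂ × ℂ} (hj : (j.1, j.2.1) ∈ D) :
    fderiv ℝ (jetMap χ U) j (prolong V j) = prolong W (jetMap χ U j) := by
  set Φ := pointMap χ U with hΦdef
  set q := (j.1, j.2.1) with hq
  set p := j.2.2 with hp
  set P := newDeriv χ U with hP
  have hΦ := h.contDiffAt_pointMap hj
  have cV : ContDiffAt ℝ ∞ V q := hV.contDiffAt (D.isOpen.mem_nhds hj)
  have dΦ : DifferentiableAt ℝ Φ q := hΦ.differentiableAt (by simp)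
  have dV : DifferentiableAt ℝ V q := cV.differentiableAt (by simp)
  have dW : DifferentiableAt ℝ W (Φ q) := (hW q hj).differentiableAt (by simp)
  have ddΦ : DifferentiableAt ℝ (fderiv ℝ Φ) q :=
    (hΦ.fderiv_right (m := 1) (by norm_cast)).differentiableAt (by norm_num)
  have sym : fderiv ℝ (fderiv ℝ Φ) q (1, p) (V q) = fderiv ℝ (fderiv ℝ Φ) q (V q) (1, p) :=
    (hΦ.isSymmSndFDerivAt (by
      rw [minSmoothness_of_isRCLikeNormedField]; exact WithTop.coe_le_coe.2 le_top)).eq _ _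
  have hΦv : ∀ k : ℝ × ℂ × ℂ, (k.1, k.2.1) ∈ D →
      fderiv ℝ Φ (k.1, k.2.1) (1, k.2.2) = deriv χ k.1 • (1, P k) := fun k hk => by
    rw [hΦdef, h.fderiv_pointMap hk]
    simp only [hP, newDeriv, totalDeriv, Prod.smul_mk, smul_eq_mul, mul_one, one_mul]
    rw [smul_inv_smul₀ (h.deriv_ne_zero hk)]
  have c1 : fderiv ℝ (fun q => W (Φ q)) q = (fderiv ℝ W (Φ q)).comp (fderiv ℝ Φ q) :=
    fderiv_comp q dW dΦ
  have ev : (fun q => fderiv ℝ Φ q (V q)) =ᶠ[nhds q] fun q => W (Φ q) := by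
    filter_upwards [D.isOpen.mem_nhds hj] with q hq using hVW q hq
  -- The relation between `V` and `W` is differentiated along (1, u'). Together with `E2` below this
  -- gives two expressions for the same mixed second derivative of `Φ`.
  have E1 := congrArg (fun L => L (1, p)) (ev.fderiv_eq (𝕜 := ℝ))
  rw [fderiv_clm_apply ddΦ dV, c1] at E1
  simp only [add_apply, ContinuousLinearMap.comp_apply,
    ContinuousLinearMap.flip_apply] at E1
  rw [hΦv j hj, map_smul] at E1
  -- the total derivative of the point transformation, differentiated along the prolongation
  have ev2 : (fun k : ℝ × ℂ × ℂ => fderiv ℝ Φ (k.1, k.2.1) (1, k.2.2)) =ᶠ[nhds j]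
      fun k => deriv χ k.1 • ((1 : ℝ), P k) := by
    filter_upwards [eventually_mem_of_basePoint_mem hj] with k hk using hΦv k hk
  have E2 := congrArg (fun L => L (prolong V j)) (ev2.fderiv_eq (𝕜 := ℝ))
  have d1 : HasFDerivAt (fun k : ℝ × ℂ × ℂ => fderiv ℝ Φ (k.1, k.2.1)) _ j :=
    HasFDerivAt.comp (g := fderiv ℝ Φ) (f := fun k : ℝ × ℂ × ℂ => (k.1, k.2.1)) j
      ddΦ.hasFDerivAt (hasFDerivAt_basePoint j)
  have d2 : HasFDerivAt (fun k : ℝ × ℂ × ℂ => ((1 : ℝ), k.2.2)) _ j :=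
    (hasFDerivAt_const (1 : ℝ) j).prodMk
      ((ContinuousLinearMap.snd ℝ ℂ ℂ).comp (ContinuousLinearMap.snd ℝ ℝ (ℂ × ℂ))).hasFDerivAt
  have dχ : HasFDerivAt (fun k : ℝ × ℂ × ℂ => deriv χ k.1) _ j :=
    HasFDerivAt.comp (g := deriv χ) (f := fun k : ℝ × ℂ × ℂ => k.1) j
      ((h.contDiffAt_deriv_χ hj).differentiableAt (by simp)).hasDerivAt.hasFDerivAt hasFDerivAt_fst
  have dP : HasFDerivAt P _ j := ((h.contDiffAt_newDeriv hj).differentiableAt (by simp)).hasFDerivAt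
  have d3 : HasFDerivAt (fun k => ((1 : ℝ), P k)) _ j := (hasFDerivAt_const (1 : ℝ) j).prodMk dP
  have d4 : HasFDerivAt (fun k : ℝ × ℂ × ℂ => fderiv ℝ Φ (k.1, k.2.1) (1, k.2.2)) _ j :=
    d1.clm_apply d2
  have d5 : HasFDerivAt (fun k : ℝ × ℂ × ℂ => deriv χ k.1 • ((1 : ℝ), P k)) _ j := dχ.smul d3
  rw [d4.fderiv, d5.fderiv] at E2
  simp only [add_apply, ContinuousLinearMap.comp_apply, ContinuousLinearMap.flip_apply,
    ContinuousLinearMap.prod_apply, smul_apply, ContinuousLinearMap.smulRight_apply,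
    zero_apply, ContinuousLinearMap.coe_fst', ContinuousLinearMap.coe_snd'] at E2
  have F1 := fderiv_eq_totalDeriv_smul_add (j := j) dV
  have F2 := fderiv_eq_totalDeriv_smul_add (V := W) (j := jetMap χ U j) dW
  change fderiv ℝ W (Φ q) (1, P j) = _ • (1, P j) + _ at F2
  have F3 := hΦv j hj
  set lam := totalDeriv (fun q => (V q).1) j
  set lam' := totalDeriv (fun q => (W q).1) (jetMap χ U j)
  change fderiv ℝ V q (1, p) = lam • (1, p) + (0, (prolong V j).2.2) at F1
  change fderiv ℝ Φ q (1, p) = deriv χ j.1 • (1, P j) at F3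
  change fderiv ℝ Φ q (0, (prolong V j).2.2) + fderiv ℝ (fderiv ℝ Φ) q (V q) (1, p) = _ at E2
  rw [F1, F2, map_add, map_smul, F3, sym] at E1
  rw [← eq_sub_iff_add_eq] at E2
  rw [E2] at E1
  have hχ := h.deriv_ne_zero hj
  change deriv χ j.1 ≠ 0 at hχ
  have G1 := congrArg Prod.fst E1
  have G2 := congrArg Prod.snd E1
  simp only [Prod.fst_add, Prod.snd_add, Prod.fst_sub, Prod.snd_sub, Prod.smul_fst, Prod.smul_snd,
    smul_eq_mul, mul_one, mul_zero, add_zero, zero_add, ContinuousLinearMap.toSpanSingleton_apply]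
    at G1 G2
  have G3 : deriv χ j.1 • (fderiv ℝ P j (prolong V j) -
      firstProlongation W (jetMap χ U j)) = 0 := by
    -- The first components relate the total derivatives of the two ∂_x-coefficients. Multiplied by
    -- `P` and subtracted from the second components, this relation removes everything except the
    -- prolongation coefficients.
    have G4 : lam * deriv χ j.1 + (prolong V j).1 * deriv (deriv χ) q.1 - lam' * deriv χ j.1 = 0 := by
      linear_combination G1
    have G5 := congrArg (fun r : ℝ => r • P j) G4
    simp only [zero_smul, sub_smul, add_smul, mul_smul] at G5
    linear_combination (norm := module) G2 - G5
  have G6 := sub_eq_zero.1 ((smul_eq_zero.1 G3).resolve_left hχ)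
  have K := hVW q hj
  rw [hΦdef, h.fderiv_pointMap hj] at K
  rw [h.fderiv_jetMap hj]
  refine Prod.ext (congrArg Prod.fst K :) (Prod.ext (congrArg Prod.snd K :) G6)

/-- Solution curves go to solution curves, with χ in place of x as parameter; the change of speed is
the factor χ'. -/
theorem Reduces.fderiv_jetMap_jetField (h : Reduces D rhs χ U Ω) {j : ℝ × ℂ × ℂ}
    (hj : (j.1, j.2.1) ∈ D) :
    fderiv ℝ (jetMap χ U) j (jetField rhs j) = deriv χ j.1 • jetField Ω (jetMap χ U j) := by
  have hχ := h.transformation.deriv_ne_zero hj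
  have e := h.equation j.1 j.2.1 j.2.2 hj
  simp only [newSecondDeriv, totalDerivAlong] at e
  rw [inv_smul_eq_iff₀ hχ] at e
  rw [h.transformation.fderiv_jetMap hj]
  simp only [jetField, Prod.smul_mk, smul_eq_mul, one_mul, mul_one, jetMap]
  refine Prod.ext rfl (Prod.ext ?_ e)
  simp only [newDeriv, totalDeriv]
  rw [smul_inv_smul₀ hχ]

/-- The defect of the symmetry condition transforms by a nonvanishing factor. -/
theorem Reduces.symmetryDefect_eq (h : Reduces D rhs χ U Ω) {V W : ℝ × ℂ → ℝ × ℂ}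
    (hV : ContDiffOn ℝ ∞ V D) (hW : ∀ q ∈ D, ContDiffAt ℝ ∞ W (pointMap χ U q))
    (hVW : ∀ q ∈ D, fderiv ℝ (pointMap χ U) q (V q) = W (pointMap χ U q))
    {j : ℝ × ℂ × ℂ} (hj : (j.1, j.2.1) ∈ D) (hrhs : DifferentiableAt ℝ rhs j)
    (hΩ : DifferentiableAt ℝ Ω (jetMap χ U j)) :
    fderiv ℝ U (j.1, j.2.1) (0, 1) * symmetryDefect rhs V j =
      (deriv χ j.1) ^ 2 • symmetryDefect Ω W (jetMap χ U j) := by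
  have hT := h.transformation
  have cV : ContDiffAt ℝ ∞ V (j.1, j.2.1) := hV.contDiffAt (D.isOpen.mem_nhds hj)
  have cW : ContDiffAt ℝ ∞ W ((jetMap χ U j).1, (jetMap χ U j).2.1) := hW _ hj
  have dχ : HasFDerivAt (fun k : ℝ × ℂ × ℂ => deriv χ k.1) _ j :=
    HasFDerivAt.comp (g := deriv χ) (f := fun k : ℝ × ℂ × ℂ => k.1) j
      ((hT.contDiffAt_deriv_χ hj).differentiableAt (by simp)).hasDerivAt.hasFDerivAt hasFDerivAt_fst
  have dX : ∀ {rhs : ℝ × ℂ × ℂ → ℂ} {j}, DifferentiableAt ℝ rhs j →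
      DifferentiableAt ℝ (jetField rhs) j := fun hr =>
    (differentiableAt_const _).prodMk
      (DifferentiableAt.prodMk (by fun_prop) hr)
  have B := fderiv_bracket_of_related (Φ := jetMap χ U) (X := jetField rhs) (Y := prolong V)
    (X' := jetField Ω) (Y' := prolong W) (f := fun k => deriv χ k.1) (z := j)
    (hT.contDiffAt_jetMap hj) (dX hrhs) (differentiableAt_prolong cV) (dX hΩ)
    (differentiableAt_prolong cW) dχ.differentiableAt
    ((eventually_mem_of_basePoint_mem hj).mono fun k hk => h.fderiv_jetMap_jetField hk)
    ((eventually_mem_of_basePoint_mem hj).mono fun k hk =>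
      hT.fderiv_jetMap_prolong hV hW hVW hk)
  rw [bracket_jetField_prolong hrhs cV, bracket_jetField_prolong hΩ cW, map_add, map_smul,
    h.fderiv_jetMap_jetField hj, hT.fderiv_jetMap hj (0, 0, _), hT.fderiv_newDeriv_vertical hj] at B
  set lam := totalDeriv (fun q => (V q).1) j
  set lam' := totalDeriv (fun q => (W q).1) (jetMap χ U j)
  have hχ : deriv χ j.1 ≠ 0 := hT.deriv_ne_zero hj
  -- The first component of the bracket identity relates `lam` and `lam'`. With it the multiples of
  -- `Ω` drop out of the last component and only the defects remain.
  have B1 := congrArg Prod.fst B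
  have B2 := congrArg (fun z => z.2.2) B
  simp only [Prod.fst_add, Prod.snd_add, Prod.smul_fst, Prod.smul_snd, jetField,
    smul_eq_mul, mul_one, zero_mul, add_zero] at B1 B2
  have B3 := congrArg (fun r : ℝ => r • Ω (jetMap χ U j)) B1
  simp only [add_smul, mul_smul] at B3
  have B4 : (deriv χ j.1)⁻¹ • (fderiv ℝ U (j.1, j.2.1) (0, 1) * symmetryDefect rhs V j) =
      deriv χ j.1 • symmetryDefect Ω W (jetMap χ U j) := by
    linear_combination (norm := module) B2 - B3
  rw [inv_smul_eq_iff₀ hχ] at B4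
  rw [B4, smul_smul, sq]

/-- The right-hand side of a system is determined by the reduced system and the transformation, and
inherits its differentiability. -/
theorem Reduces.differentiableAt_rhs (h : Reduces D rhs χ U Ω) {j : ℝ × ℂ × ℂ}
    (hj : (j.1, j.2.1) ∈ D) (hΩ : DifferentiableAt ℝ Ω (jetMap χ U j)) :
    DifferentiableAt ℝ rhs j := by
  have hT := h.transformation
  -- No regularity of `rhs` is given. The reduced equation is linear in `rhs` with the invertible
  -- coefficient U_u/χ', up to a further factor χ', so it can be solved for `rhs` in terms of
  -- differentiable quantities.
  have e : rhs =ᶠ[nhds j] fun k => (fderiv ℝ U (k.1, k.2.1) (0, 1))⁻¹ *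
      (deriv χ k.1 • (deriv χ k.1 • Ω (jetMap χ U k) -
        fderiv ℝ (newDeriv χ U) k (1, k.2.2, 0))) := by
    filter_upwards [eventually_mem_of_basePoint_mem hj] with k hk
    have e := congrArg (fun z => z.2.2) (h.fderiv_jetMap_jetField hk)
    have s : jetField rhs k = (1, k.2.2, 0) + (0, 0, rhs k) := by simp [jetField]
    rw [hT.fderiv_jetMap hk] at e
    simp only [s, map_add, hT.fderiv_newDeriv_vertical hk, Prod.smul_snd] at e
    change _ = deriv χ k.1 • Ω (jetMap χ U k) at e
    rw [← e, add_sub_cancel_left, smul_inv_smul₀ (hT.deriv_ne_zero hk),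
      inv_mul_cancel_left₀ (hT.fderiv_U_one_ne_zero hk)]
  refine DifferentiableAt.congr_of_eventuallyEq ?_ e
  have d1 : DifferentiableAt ℝ (fun k : ℝ × ℂ × ℂ => fderiv ℝ U (k.1, k.2.1)) j :=
    DifferentiableAt.comp (g := fderiv ℝ U) (f := fun k : ℝ × ℂ × ℂ => (k.1, k.2.1)) j
      (((hT.contDiffAt_U hj).fderiv_right (m := 1) (by norm_cast)).differentiableAt (by norm_num))
      (hasFDerivAt_basePoint j).differentiableAt
  have d2 : DifferentiableAt ℝ (fun k : ℝ × ℂ × ℂ => deriv χ k.1) j :=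
    DifferentiableAt.comp (g := deriv χ) (f := fun k : ℝ × ℂ × ℂ => k.1) j
      ((hT.contDiffAt_deriv_χ hj).differentiableAt (by simp)) differentiableAt_fst
  have d3 : DifferentiableAt ℝ (fun k => Ω (jetMap χ U k)) j :=
    DifferentiableAt.comp (g := Ω) (f := jetMap χ U) j hΩ
      ((hT.contDiffAt_jetMap hj).differentiableAt (by simp))
  have d4 : DifferentiableAt ℝ (fderiv ℝ (newDeriv χ U)) j :=
    ((hT.contDiffAt_newDeriv hj).fderiv_right (m := 1) (by norm_cast)).differentiableAt (by norm_num)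
  have d5 := d1.clm_apply (differentiableAt_const ((0 : ℝ), (1 : ℂ)))
  exact (d5.inv (hT.fderiv_U_one_ne_zero hj)).mul
    (d2.smul ((d2.smul d3).sub (d4.clm_apply (by fun_prop))))

/-- Related vector fields are symmetries at corresponding jets simultaneously. -/
theorem Reduces.symmetryDefect_eq_zero_iff (h : Reduces D rhs χ U Ω) {V W : ℝ × ℂ → ℝ × ℂ}
    (hV : ContDiffOn ℝ ∞ V D) (hW : ∀ q ∈ D, ContDiffAt ℝ ∞ W (pointMap χ U q))
    (hVW : ∀ q ∈ D, fderiv ℝ (pointMap χ U) q (V q) = W (pointMap χ U q))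
    {j : ℝ × ℂ × ℂ} (hj : (j.1, j.2.1) ∈ D) (hΩ : DifferentiableAt ℝ Ω (jetMap χ U j)) :
    symmetryDefect rhs V j = 0 ↔ symmetryDefect Ω W (jetMap χ U j) = 0 := by
  have e := h.symmetryDefect_eq hV hW hVW hj (h.differentiableAt_rhs hj hΩ) hΩ
  have h1 := h.transformation.fderiv_U_one_ne_zero hj
  have h2 := pow_ne_zero 2 (h.transformation.deriv_ne_zero hj)
  change deriv χ j.1 ^ 2 ≠ 0 at h2
  refine ⟨fun h0 => ?_, fun h0 => ?_⟩
  · rw [h0, mul_zero] at e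
    exact (smul_eq_zero.1 e.symm).resolve_left h2
  · rw [h0, smul_zero] at e
    exact (mul_eq_zero.1 e).resolve_left h1

end PointTransformation

/-! ### Partial derivatives in the real coordinates t, Re u, Im u -/

section PartialDerivatives

variable {G : Type*} [NormedAddCommGroup G] [NormedSpace ℝ G]

/-- The directions of the coordinates `t`, `Re u` and `Im u` on the `(t, u)`-space. -/
def eT : ℝ × ℂ := (1, 0)
/-- The direction of `Re u`. -/
def eY : ℝ × ℂ := (0, 1)
/-- The direction of `Im u`. -/
def eZ : ℝ × ℂ := (0, Complex.I)

/-- The directional derivative as an operator on functions. -/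
noncomputable def pd (v : ℝ × ℂ) (f : ℝ × ℂ → G) : ℝ × ℂ → G := fun q => fderiv ℝ f q v

theorem mk_eq_basis (s : ℝ) (w : ℂ) : ((s, w) : ℝ × ℂ) = s • eT + w.re • eY + w.im • eZ := by
  ext <;> simp [eT, eY, eZ]

theorem fderiv_apply_mk (f : ℝ × ℂ → G) (q : ℝ × ℂ) (s : ℝ) (w : ℂ) :
    fderiv ℝ f q (s, w) = s • pd eT f q + w.re • pd eY f q + w.im • pd eZ f q := by
  rw [mk_eq_basis, map_add, map_add, map_smul, map_smul, map_smul]; rfl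

theorem fderiv_eq_zero_of_pd {f : ℝ × ℂ → G} {q : ℝ × ℂ} (h0 : pd eT f q = 0)
    (h1 : pd eY f q = 0) (h2 : pd eZ f q = 0) : fderiv ℝ f q = 0 := by
  ext v
  · simp [fderiv_apply_mk, h0, h1, h2]
  · simp [fderiv_apply_mk, h0, h1, h2]

theorem contDiffAt_pd {f : ℝ × ℂ → G} {q : ℝ × ℂ} (hf : ContDiffAt ℝ ∞ f q) (v : ℝ × ℂ) :
    ContDiffAt ℝ ∞ (pd v f) q :=
  (hf.fderiv_right (m := ∞) (by simp)).clm_apply contDiffAt_const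

theorem pd_pd {f : ℝ × ℂ → G} {q : ℝ × ℂ} (hf : ContDiffAt ℝ ∞ f q) (v w : ℝ × ℂ) :
    pd v (pd w f) q = fderiv ℝ (fderiv ℝ f) q v w := by
  have h : DifferentiableAt ℝ (fderiv ℝ f) q :=
    (hf.fderiv_right (m := 1) (by norm_cast)).differentiableAt (by norm_num)
  have := (h.hasFDerivAt.clm_apply (hasFDerivAt_const w q)).fderiv
  change fderiv ℝ (fun y => fderiv ℝ f y w) q v = _
  rw [this]
  simp

theorem pd_comm {f : ℝ × ℂ → G} {q : ℝ × ℂ} (hf : ContDiffAt ℝ ∞ f q) (v w : ℝ × ℂ) :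
    pd v (pd w f) q = pd w (pd v f) q := by
  rw [pd_pd hf, pd_pd hf]
  exact (hf.isSymmSndFDerivAt (by
    rw [minSmoothness_of_isRCLikeNormedField]; exact WithTop.coe_le_coe.2 le_top)).eq _ _

theorem pd_congr {f g : ℝ × ℂ → G} {q : ℝ × ℂ} (h : f =ᶠ[nhds q] g) (v : ℝ × ℂ) :
    pd v f q = pd v g q := by
  simp only [pd, h.fderiv_eq]

theorem fderiv_fderiv_mk {f : ℝ × ℂ → G} {q : ℝ × ℂ} (hf : ContDiffAt ℝ ∞ f q) (p : ℂ) :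
    fderiv ℝ (fderiv ℝ f) q (1, p) (1, p) =
      pd eT (pd eT f) q + (2 * p.re) • pd eT (pd eY f) q + (2 * p.im) • pd eT (pd eZ f) q +
        p.re ^ 2 • pd eY (pd eY f) q + (2 * p.re * p.im) • pd eY (pd eZ f) q +
        p.im ^ 2 • pd eZ (pd eZ f) q := by
  have c1 := pd_comm hf eT eY
  have c2 := pd_comm hf eT eZ
  have c3 := pd_comm hf eY eZ
  rw [pd_pd hf, pd_pd hf] at c1 c2 c3
  simp only [pd_pd hf]
  rw [mk_eq_basis]
  simp only [map_add, map_smul, add_apply, smul_apply, ← c1, ← c2, ← c3]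
  module

/-- Along a direction, a differentiable function has the directional derivative. -/
theorem hasDerivAt_line {f : ℝ × ℂ → G} {q : ℝ × ℂ} (hf : DifferentiableAt ℝ f q) (v : ℝ × ℂ) :
    HasDerivAt (fun s : ℝ => f (q + s • v)) (pd v f q) 0 :=
  hf.hasFDerivAt.hasLineDerivAt v

end PartialDerivatives

/-! ### The symmetry condition of the reduced system and its determining equations -/

section Determining

theorem reducedForm_eq (β : ℝ → ℝ) :
    reducedForm β = fun j => β j.1 • (Complex.I * j.2.1) := by
  funext j
  apply Complex.ext <;> simp [reducedForm]

theorem hasFDerivAt_reducedForm {β : ℝ → ℝ} {j : ℝ × ℂ × ℂ} (hβ : DifferentiableAt ℝ β j.1) :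
    DifferentiableAt ℝ (reducedForm β) j ∧ ∀ w : ℝ × ℂ × ℂ,
      fderiv ℝ (reducedForm β) j w =
        (deriv β j.1 * w.1) • (Complex.I * j.2.1) + β j.1 • (Complex.I * w.2.1) := by
  have h1 : HasFDerivAt (fun k : ℝ × ℂ × ℂ => β k.1) _ j :=
    HasFDerivAt.comp (g := β) (f := fun k : ℝ × ℂ × ℂ => k.1) j
      hβ.hasDerivAt.hasFDerivAt hasFDerivAt_fst
  have h2 : HasFDerivAt (fun k : ℝ × ℂ × ℂ => Complex.I * k.2.1) _ j :=
    (((ContinuousLinearMap.fst ℝ ℂ ℂ).comp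
      (ContinuousLinearMap.snd ℝ ℝ (ℂ × ℂ))).hasFDerivAt (x := j)).const_mul Complex.I
  have h3 := h1.smul h2
  have e : (fun k : ℝ × ℂ × ℂ => β k.1) • (fun k : ℝ × ℂ × ℂ => Complex.I * k.2.1) =
    reducedForm β := by rw [reducedForm_eq]; rfl
  rw [e] at h3
  refine ⟨h3.differentiableAt, fun w => ?_⟩
  rw [h3.fderiv]
  simp
  ring

/-- The symmetry condition of the reduced system at a jet, in terms of partial derivatives. -/
theorem symmetryDefect_reducedForm_iff {β : ℝ → ℝ} {W : ℝ × ℂ → ℝ × ℂ} {q : ℝ × ℂ}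
    (hβ : DifferentiableAt ℝ β q.1) {ξ : ℝ × ℂ → ℝ} {η : ℝ × ℂ → ℂ} (hWξ : W = fun q => (ξ q, η q))
    (hξ : ContDiffAt ℝ ∞ ξ q) (hη : ContDiffAt ℝ ∞ η q) (p : ℂ) :
    symmetryDefect (reducedForm β) W (q.1, q.2, p) = 0 ↔
      fderiv ℝ (fderiv ℝ η) q (1, p) (1, p) +
          β q.1 * (-q.2.im * pd eY η q + q.2.re * pd eZ η q) -
        ((fderiv ℝ (fderiv ℝ ξ) q (1, p) (1, p) : ℝ) +
          β q.1 * (-q.2.im * pd eY ξ q + q.2.re * pd eZ ξ q)) * p -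
        2 * (pd eT ξ q + p.re * pd eY ξ q + p.im * pd eZ ξ q) * (β q.1 * (Complex.I * q.2)) =
      deriv β q.1 * ξ q * (Complex.I * q.2) + β q.1 * (Complex.I * η q) := by
  subst hWξ
  set j : ℝ × ℂ × ℂ := (q.1, q.2, p) with hj
  have h := (hasFDerivAt_reducedForm (j := j) hβ).2
  have key : ∀ {G : Type} [NormedAddCommGroup G] [NormedSpace ℝ G] {f : ℝ × ℂ → G},
      ContDiffAt ℝ ∞ f q → HasFDerivAt (totalDeriv f)
        ((fderiv ℝ f q).comp ((0 : ℝ × ℂ × ℂ →L[ℝ] ℝ).prod ((ContinuousLinearMap.snd ℝ ℂ ℂ).comp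
          (ContinuousLinearMap.snd ℝ ℝ (ℂ × ℂ)))) +
        ((fderiv ℝ (fderiv ℝ f) q).comp ((ContinuousLinearMap.fst ℝ ℝ (ℂ × ℂ)).prod
        ((ContinuousLinearMap.fst ℝ ℂ ℂ).comp (ContinuousLinearMap.snd ℝ ℝ (ℂ × ℂ))))).flip
          (1, p)) j := by
    intro G _ _ f hf
    have d : DifferentiableAt ℝ (fderiv ℝ f) q :=
      (hf.fderiv_right (m := 1) (by norm_cast)).differentiableAt (by norm_num)
    have d1 : HasFDerivAt (fun k : ℝ × ℂ × ℂ => fderiv ℝ f (k.1, k.2.1)) _ j :=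
      HasFDerivAt.comp (g := fderiv ℝ f) (f := fun k : ℝ × ℂ × ℂ => (k.1, k.2.1)) j
        d.hasFDerivAt (hasFDerivAt_basePoint j)
    have d2 : HasFDerivAt (fun k : ℝ × ℂ × ℂ => ((1 : ℝ), k.2.2)) _ j :=
      (hasFDerivAt_const (1 : ℝ) j).prodMk
        ((ContinuousLinearMap.snd ℝ ℂ ℂ).comp (ContinuousLinearMap.snd ℝ ℝ (ℂ × ℂ))).hasFDerivAt
    exact d1.clm_apply d2
  have kη := key hη
  have kξ := key hξ
  have dp : HasFDerivAt (fun k : ℝ × ℂ × ℂ => k.2.2) _ j :=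
    ((ContinuousLinearMap.snd ℝ ℂ ℂ).comp (ContinuousLinearMap.snd ℝ ℝ (ℂ × ℂ))).hasFDerivAt
  have k1 : HasFDerivAt (firstProlongation fun q => (ξ q, η q)) _ j := kη.sub (kξ.smul dp)
  rw [symmetryDefect, secondProlongation, totalDerivAlong, h, k1.fderiv, sub_eq_zero, eq_comm]
  simp only [prolong, hj, reducedForm_eq, totalDeriv, sub_apply, add_apply, smul_apply,
    ContinuousLinearMap.comp_apply, ContinuousLinearMap.prod_apply, zero_apply,
    ContinuousLinearMap.flip_apply, ContinuousLinearMap.smulRight_apply,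
    ContinuousLinearMap.coe_fst', ContinuousLinearMap.coe_snd', Prod.mk.eta]
  simp only [fderiv_apply_mk η, fderiv_apply_mk ξ, Complex.ofReal_re, Complex.ofReal_im,
    Complex.mul_re, Complex.mul_im, Complex.I_re, Complex.I_im, Complex.real_smul, smul_eq_mul]
  push_cast
  constructor <;> intro h <;> linear_combination h

end Determining

section Determining

/-- The determining equations of the symmetries `ξ ∂_t + η ∂_u` of the reduced system at the point
`q = (t, u)`. -/
structure DeterminingEquations (β : ℝ → ℝ) (ξ : ℝ × ℂ → ℝ) (η : ℝ × ℂ → ℂ) (q : ℝ × ℂ) :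
    Prop where
  ξYY : pd eY (pd eY ξ) q = 0
  ξYZ : pd eY (pd eZ ξ) q = 0
  ξZZ : pd eZ (pd eZ ξ) q = 0
  ηYY : pd eY (pd eY η) q = 2 * pd eT (pd eY ξ) q
  ηYZ : pd eY (pd eZ η) q = pd eT (pd eY ξ) q * Complex.I + pd eT (pd eZ ξ) q
  ηZZ : pd eZ (pd eZ η) q = 2 * pd eT (pd eZ ξ) q * Complex.I
  ηTY : 2 * pd eT (pd eY η) q = pd eT (pd eT ξ) q +
    β q.1 * (-q.2.im * pd eY ξ q + q.2.re * pd eZ ξ q) + 2 * pd eY ξ q * (β q.1 * (Complex.I * q.2))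
  ηTZ : 2 * pd eT (pd eZ η) q = (pd eT (pd eT ξ) q +
    β q.1 * (-q.2.im * pd eY ξ q + q.2.re * pd eZ ξ q)) * Complex.I +
      2 * pd eZ ξ q * (β q.1 * (Complex.I * q.2))
  ηTT : pd eT (pd eT η) q + β q.1 * (-q.2.im * pd eY η q + q.2.re * pd eZ η q) -
    2 * pd eT ξ q * (β q.1 * (Complex.I * q.2)) =
      deriv β q.1 * ξ q * (Complex.I * q.2) + β q.1 * (Complex.I * η q)

/-- At a fixed point the condition is a polynomial of degree three in the two real components of
`p`, and the determining equations say that all its coefficients vanish. -/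
theorem forall_symmetryDefect_reducedForm_iff {β : ℝ → ℝ} {W : ℝ × ℂ → ℝ × ℂ} {q : ℝ × ℂ}
    (hβ : DifferentiableAt ℝ β q.1) {ξ : ℝ × ℂ → ℝ} {η : ℝ × ℂ → ℂ} (hWξ : W = fun q => (ξ q, η q))
    (hξ : ContDiffAt ℝ ∞ ξ q) (hη : ContDiffAt ℝ ∞ η q) :
    (∀ p : ℂ, symmetryDefect (reducedForm β) W (q.1, q.2, p) = 0) ↔
      DeterminingEquations β ξ η q := by
  simp only [symmetryDefect_reducedForm_iff hβ hWξ hξ hη, fderiv_fderiv_mk hξ, fderiv_fderiv_mk hη,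
    Complex.real_smul, smul_eq_mul]
  push_cast
  constructor
  · intro h
    have E : ∀ s r : ℝ, _ := fun s r => h (s + r * Complex.I)
    simp only [Complex.add_re, Complex.add_im, Complex.mul_re, Complex.mul_im, Complex.I_re,
      Complex.I_im, Complex.ofReal_re, Complex.ofReal_im, mul_zero, mul_one, sub_zero, add_zero,
      zero_add] at E
    -- Four values on each of the lines through 0 in the directions 1, i and 1 + i. Three lines
    -- suffice, since the cubic part is `p` times a real quadratic form, which has three
    -- coefficients.
    have k := E 0 0
    have y1 := E 1 0
    have y2 := E (-1) 0
    have y3 := E 2 0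
    have z1 := E 0 1
    have z2 := E 0 (-1)
    have z3 := E 0 2
    have w1 := E 1 1
    have w2 := E (-1) (-1)
    have w3 := E 2 2
    clear h E
    push_cast at k y1 y2 y3 z1 z2 z3 w1 w2 w3
    have hI := Complex.I_ne_zero
    have hI1 : (1 : ℂ) + Complex.I ≠ 0 := fun h => by simpa using congrArg Complex.re h
    -- For a cubic f the combination f(2) - 3f(1) - f(-1) + 3f(0) is six times the leading
    -- coefficient. Below, f(1) + f(-1) - 2f(0) isolates the quadratic coefficient and f(1) - f(-1)
    -- the sum of the linear and the cubic one.
    have ξYY : ((pd eY (pd eY ξ) q : ℝ) : ℂ) = 0 := by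
      linear_combination (-1 / 6) * (y3 - 3 * y1 - y2 + 3 * k)
    have ξZZ : ((pd eZ (pd eZ ξ) q : ℝ) : ℂ) = 0 := by
      have : ((pd eZ (pd eZ ξ) q : ℝ) : ℂ) * Complex.I = 0 := by
        linear_combination (-1 / 6) * (z3 - 3 * z1 - z2 + 3 * k)
      exact (mul_eq_zero.1 this).resolve_right hI
    have ξYZ : ((pd eY (pd eZ ξ) q : ℝ) : ℂ) = 0 := by
      have : ((pd eY (pd eZ ξ) q : ℝ) : ℂ) * (1 + Complex.I) = 0 := by
        linear_combination (-1 / 12) * (w3 - 3 * w1 - w2 + 3 * k) -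
          (1 + Complex.I) / 2 * ξYY - (1 + Complex.I) / 2 * ξZZ
      exact (mul_eq_zero.1 this).resolve_right hI1
    have ηYY : pd eY (pd eY η) q = 2 * pd eT (pd eY ξ) q := by
      linear_combination (1 / 2) * (y1 + y2 - 2 * k)
    have ηZZ : pd eZ (pd eZ η) q = 2 * pd eT (pd eZ ξ) q * Complex.I := by
      linear_combination (1 / 2) * (z1 + z2 - 2 * k)
    have ηYZ : pd eY (pd eZ η) q = pd eT (pd eY ξ) q * Complex.I + pd eT (pd eZ ξ) q := by
      linear_combination (1 / 4) * (w1 + w2 - 2 * k) - (1 / 2) * ηYY - (1 / 2) * ηZZ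
    refine ⟨by exact_mod_cast ξYY, by exact_mod_cast ξYZ, by exact_mod_cast ξZZ, ηYY, ηYZ, ηZZ,
      ?_, ?_, ?_⟩
    · linear_combination (1 / 2) * (y1 - y2) + ξYY
    · linear_combination (1 / 2) * (z1 - z2) + Complex.I * ξZZ
    · linear_combination k
  · intro h p
    rw [h.ξYY, h.ξYZ, h.ξZZ, h.ηYY, h.ηYZ, h.ηZZ]
    have e : p = p.re + p.im * Complex.I := (Complex.re_add_im p).symm
    have k1 := h.ηTY
    have k2 := h.ηTZ
    have k3 := h.ηTT
    generalize p.re = a at *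
    generalize p.im = b at *
    subst e
    push_cast
    linear_combination (a : ℂ) * k1 + (b : ℂ) * k2 + k3

end Determining

/-! ### Affine functions and functions with constant gradient -/

section Affine

variable {G : Type*} [NormedAddCommGroup G] [NormedSpace ℝ G]

/-- A real affine function of `t`, `Re u` and `Im u`. -/
def affineFun (c A₀ A₁ A₂ : G) : ℝ × ℂ → G := fun q => c + q.1 • A₀ + q.2.re • A₁ + q.2.im • A₂

theorem hasFDerivAt_coordinates (q : ℝ × ℂ) :
    HasFDerivAt (fun q : ℝ × ℂ => q.1) (ContinuousLinearMap.fst ℝ ℝ ℂ) q ∧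
    HasFDerivAt (fun q : ℝ × ℂ => q.2.re)
      (Complex.reCLM.comp (ContinuousLinearMap.snd ℝ ℝ ℂ)) q ∧
    HasFDerivAt (fun q : ℝ × ℂ => q.2.im)
      (Complex.imCLM.comp (ContinuousLinearMap.snd ℝ ℝ ℂ)) q :=
  ⟨hasFDerivAt_fst, (Complex.reCLM.comp (ContinuousLinearMap.snd ℝ ℝ ℂ)).hasFDerivAt,
    (Complex.imCLM.comp (ContinuousLinearMap.snd ℝ ℝ ℂ)).hasFDerivAt⟩

theorem contDiff_affineFun (c A₀ A₁ A₂ : G) : ContDiff ℝ ∞ (affineFun c A₀ A₁ A₂) := by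
  have h1 : ContDiff ℝ ∞ (fun q : ℝ × ℂ => q.2.re) :=
    (Complex.reCLM.comp (ContinuousLinearMap.snd ℝ ℝ ℂ)).contDiff
  have h2 : ContDiff ℝ ∞ (fun q : ℝ × ℂ => q.2.im) :=
    (Complex.imCLM.comp (ContinuousLinearMap.snd ℝ ℝ ℂ)).contDiff
  exact ((contDiff_const.add (contDiff_fst.smul contDiff_const)).add
    (h1.smul contDiff_const)).add (h2.smul contDiff_const)

theorem fderiv_affineFun (c A₀ A₁ A₂ : G) (q v : ℝ × ℂ) :
    fderiv ℝ (affineFun c A₀ A₁ A₂) q v = v.1 • A₀ + v.2.re • A₁ + v.2.im • A₂ := by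
  obtain ⟨h0, h1, h2⟩ := hasFDerivAt_coordinates q
  have h : HasFDerivAt (affineFun c A₀ A₁ A₂) _ q :=
    (((h0.smul_const A₀).const_add c).add (h1.smul_const A₁)).add (h2.smul_const A₂)
  rw [h.fderiv]
  simp

@[simp] theorem pd_eT_affineFun (c A₀ A₁ A₂ : G) (q : ℝ × ℂ) :
    pd eT (affineFun c A₀ A₁ A₂) q = A₀ := by simp [pd, fderiv_affineFun, eT]

@[simp] theorem pd_eY_affineFun (c A₀ A₁ A₂ : G) (q : ℝ × ℂ) :
    pd eY (affineFun c A₀ A₁ A₂) q = A₁ := by simp [pd, fderiv_affineFun, eY]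

@[simp] theorem pd_eZ_affineFun (c A₀ A₁ A₂ : G) (q : ℝ × ℂ) :
    pd eZ (affineFun c A₀ A₁ A₂) q = A₂ := by simp [pd, fderiv_affineFun, eZ]

variable {D : Opens (ℝ × ℂ)}

theorem pd_sub {f g : ℝ × ℂ → G} {q : ℝ × ℂ} (hf : DifferentiableAt ℝ f q)
    (hg : DifferentiableAt ℝ g q) (v : ℝ × ℂ) :
    pd v (fun q => f q - g q) q = pd v f q - pd v g q := by
  simp only [pd, fderiv_fun_sub hf hg, sub_apply]

/-- On a connected open set, functions with the same partial derivatives differ by a constant. -/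
theorem exists_eq_add_const_of_pd (hD : IsPreconnected (D : Set (ℝ × ℂ))) {f g : ℝ × ℂ → G}
    (hf : ∀ q ∈ D, DifferentiableAt ℝ f q) (hg : ∀ q ∈ D, DifferentiableAt ℝ g q)
    (h0 : ∀ q ∈ D, pd eT f q = pd eT g q) (h1 : ∀ q ∈ D, pd eY f q = pd eY g q)
    (h2 : ∀ q ∈ D, pd eZ f q = pd eZ g q) : ∃ c : G, ∀ q ∈ D, f q = g q + c := by
  obtain ⟨c, hc⟩ := D.isOpen.exists_is_const_of_fderiv_eq_zero hD (f := fun q => f q - g q)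
    (fun q hq => ((hf q hq).sub (hg q hq)).differentiableWithinAt) (fun q hq => by
      apply fderiv_eq_zero_of_pd <;> rw [pd_sub (hf q hq) (hg q hq), sub_eq_zero]
      exacts [h0 q hq, h1 q hq, h2 q hq])
  exact ⟨c, fun q hq => by rw [← hc q hq]; abel⟩

theorem exists_eq_affineFun_of_pd (hD : IsPreconnected (D : Set (ℝ × ℂ))) {f : ℝ × ℂ → G}
    {A₀ A₁ A₂ : G} (hf : ∀ q ∈ D, DifferentiableAt ℝ f q) (h0 : ∀ q ∈ D, pd eT f q = A₀)
    (h1 : ∀ q ∈ D, pd eY f q = A₁) (h2 : ∀ q ∈ D, pd eZ f q = A₂) :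
    ∃ c : G, ∀ q ∈ D, f q = affineFun c A₀ A₁ A₂ q := by
  obtain ⟨c, hc⟩ := exists_eq_add_const_of_pd hD (g := affineFun 0 A₀ A₁ A₂) hf
    (fun q _ => (contDiff_affineFun _ _ _ _).contDiffAt.differentiableAt (by simp))
    (by simpa using h0) (by simpa using h1) (by simpa using h2)
  exact ⟨c, fun q hq => by rw [hc q hq]; simp only [affineFun]; abel⟩

end Affine

/-! ### The 15-parameter family of candidate symmetries -/

section ParametricFields

/-- The parameters `((a₀, a₁, a₂), (m, n), (C₁, C₂), (k₁, k₂))` of the candidate symmetries of the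
reduced system. -/
abbrev FieldParam := (ℝ × ℝ × ℝ) × (ℂ × ℂ) × (ℂ × ℂ) × (ℂ × ℂ)

/-- The `∂_t`-component `a₀ + a₁ t + a₂ t² + (n + m t) · u` of a candidate symmetry. -/
def paramXi (θ : FieldParam) : ℝ × ℂ → ℝ := fun q =>
  θ.1.1 + q.1 * θ.1.2.1 + q.1 ^ 2 * θ.1.2.2 + q.2.re * (θ.2.1.2.re + q.1 * θ.2.1.1.re) +
    q.2.im * (θ.2.1.2.im + q.1 * θ.2.1.1.im)

/-- The `∂_u`-component `(a₂ t + m · u) u + C₁ Re u + C₂ Im u + k₁ φ(t) + k₂ ψ(t)` of a candidate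
symmetry. -/
def paramEta (φ ψ : ℝ → ℂ) (θ : FieldParam) : ℝ × ℂ → ℂ := fun q =>
  ((q.1 * θ.1.2.2 + q.2.re * θ.2.1.1.re + q.2.im * θ.2.1.1.im : ℝ) : ℂ) * q.2 +
    (q.2.re * θ.2.2.1.1 + q.2.im * θ.2.2.1.2) + (θ.2.2.2.1 * φ q.1 + θ.2.2.2.2 * ψ q.1)

/-- The candidate symmetry with the given parameters. -/
def paramField (φ ψ : ℝ → ℂ) (θ : FieldParam) : ℝ × ℂ → ℝ × ℂ :=
  fun q => (paramXi θ q, paramEta φ ψ θ q)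

/-- The conditions on the parameters, at `t`, under which the candidate is a symmetry. -/
structure IsAdmissible (β : ℝ → ℝ) (θ : FieldParam) (t : ℝ) : Prop where
  m : (β t : ℂ) * θ.2.1.1 = 0
  n : (β t : ℂ) * θ.2.1.2 = 0
  deriv_m : ((deriv β t : ℝ) : ℂ) * θ.2.1.1 = 0
  deriv_n : ((deriv β t : ℝ) : ℂ) * θ.2.1.2 = 0
  linear : (β t : ℂ) * (θ.2.2.1.2 - Complex.I * θ.2.2.1.1) = 0
  quadratic : 2 * β t * (θ.1.2.1 + 2 * t * θ.1.2.2) +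
    deriv β t * (θ.1.1 + t * θ.1.2.1 + t ^ 2 * θ.1.2.2) = 0

theorem contDiff_paramXi (θ : FieldParam) : ContDiff ℝ ∞ (paramXi θ) := by
  have h1 : ContDiff ℝ ∞ (fun q : ℝ × ℂ => q.2.re) :=
    (Complex.reCLM.comp (ContinuousLinearMap.snd ℝ ℝ ℂ)).contDiff
  have h2 : ContDiff ℝ ∞ (fun q : ℝ × ℂ => q.2.im) :=
    (Complex.imCLM.comp (ContinuousLinearMap.snd ℝ ℝ ℂ)).contDiff
  unfold paramXi
  fun_prop

theorem contDiffAt_paramEta {φ ψ : ℝ → ℂ} (θ : FieldParam) {q : ℝ × ℂ}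
    (hφ : ContDiffAt ℝ ∞ φ q.1) (hψ : ContDiffAt ℝ ∞ ψ q.1) :
    ContDiffAt ℝ ∞ (paramEta φ ψ θ) q := by
  have h1 : ContDiff ℝ ∞ (fun q : ℝ × ℂ => q.2.re) :=
    (Complex.reCLM.comp (ContinuousLinearMap.snd ℝ ℝ ℂ)).contDiff
  have h2 : ContDiff ℝ ∞ (fun q : ℝ × ℂ => q.2.im) :=
    (Complex.imCLM.comp (ContinuousLinearMap.snd ℝ ℝ ℂ)).contDiff
  have h3 : ContDiff ℝ ∞ (fun x : ℝ => (x : ℂ)) := Complex.ofRealCLM.contDiff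
  have h4 : ContDiffAt ℝ ∞ (fun q : ℝ × ℂ => φ q.1) q :=
    ContDiffAt.comp (g := φ) (f := fun q : ℝ × ℂ => q.1) q hφ contDiffAt_fst
  have h5 : ContDiffAt ℝ ∞ (fun q : ℝ × ℂ => ψ q.1) q :=
    ContDiffAt.comp (g := ψ) (f := fun q : ℝ × ℂ => q.1) q hψ contDiffAt_fst
  refine ContDiffAt.add (ContDiffAt.add ?_ ?_) ?_
  · exact (h3.comp (g := fun x : ℝ => (x : ℂ)) (((contDiff_fst.mul contDiff_const).add
      (h1.mul contDiff_const)).add (h2.mul contDiff_const))).contDiffAt.mul contDiffAt_snd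
  · exact (((h3.comp h1).mul contDiff_const).add ((h3.comp h2).mul contDiff_const)).contDiffAt
  · exact (contDiffAt_const.mul h4).add (contDiffAt_const.mul h5)

/-- All first derivatives are affine, so the second derivatives can be read off by the simp lemmas
on `affineFun`. -/
theorem pd_paramXi (θ : FieldParam) :
    pd eT (paramXi θ) = affineFun θ.1.2.1 (2 * θ.1.2.2) θ.2.1.1.re θ.2.1.1.im ∧
    pd eY (paramXi θ) = affineFun θ.2.1.2.re θ.2.1.1.re 0 0 ∧
    pd eZ (paramXi θ) = affineFun θ.2.1.2.im θ.2.1.1.im 0 0 := by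
  have key : ∀ q v, fderiv ℝ (paramXi θ) q v = v.1 * θ.1.2.1 + 2 * q.1 * v.1 * θ.1.2.2 +
      (v.2.re * (θ.2.1.2.re + q.1 * θ.2.1.1.re) + q.2.re * (v.1 * θ.2.1.1.re)) +
      (v.2.im * (θ.2.1.2.im + q.1 * θ.2.1.1.im) + q.2.im * (v.1 * θ.2.1.1.im)) := by
    intro q v
    obtain ⟨h0, h1, h2⟩ := hasFDerivAt_coordinates q
    have h : HasFDerivAt (paramXi θ) _ q :=
      (((h0.mul_const θ.1.2.1).const_add θ.1.1).add ((h0.pow 2).mul_const θ.1.2.2)).add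
        (h1.mul ((h0.mul_const θ.2.1.1.re).const_add θ.2.1.2.re)) |>.add
        (h2.mul ((h0.mul_const θ.2.1.1.im).const_add θ.2.1.2.im))
    rw [h.fderiv]
    simp
    ring
  refine ⟨?_, ?_, ?_⟩ <;> funext q <;> simp only [pd, key, affineFun, eT, eY, eZ] <;> simp
  ring

theorem pd_paramEta {φ ψ : ℝ → ℂ} (θ : FieldParam) {q : ℝ × ℂ}
    (hφ : DifferentiableAt ℝ φ q.1) (hψ : DifferentiableAt ℝ ψ q.1) :
    pd eT (paramEta φ ψ θ) q =
      θ.1.2.2 * q.2 + (θ.2.2.2.1 * deriv φ q.1 + θ.2.2.2.2 * deriv ψ q.1) ∧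
    pd eY (paramEta φ ψ θ) q = affineFun θ.2.2.1.1 (θ.1.2.2 : ℂ) (2 * θ.2.1.1.re : ℂ)
      (θ.2.1.1.re * Complex.I + θ.2.1.1.im) q ∧
    pd eZ (paramEta φ ψ θ) q = affineFun θ.2.2.1.2 (θ.1.2.2 * Complex.I)
      (θ.2.1.1.re * Complex.I + θ.2.1.1.im) (2 * θ.2.1.1.im * Complex.I) q := by
  have key : ∀ v, fderiv ℝ (paramEta φ ψ θ) q v =
      ((v.1 * θ.1.2.2 + v.2.re * θ.2.1.1.re + v.2.im * θ.2.1.1.im : ℝ) : ℂ) * q.2 +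
      ((q.1 * θ.1.2.2 + q.2.re * θ.2.1.1.re + q.2.im * θ.2.1.1.im : ℝ) : ℂ) * v.2 +
      (v.2.re * θ.2.2.1.1 + v.2.im * θ.2.2.1.2) +
      v.1 * (θ.2.2.2.1 * deriv φ q.1 + θ.2.2.2.2 * deriv ψ q.1) := by
    intro v
    obtain ⟨h0, h1, h2⟩ := hasFDerivAt_coordinates q
    have c : ∀ {f : ℝ × ℂ → ℝ} {f'}, HasFDerivAt f f' q →
        HasFDerivAt (fun q => (f q : ℂ)) (Complex.ofRealCLM.comp f') q := fun hf =>
      HasFDerivAt.comp (g := fun x : ℝ => (x : ℂ)) q Complex.ofRealCLM.hasFDerivAt hf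
    have h3 : HasFDerivAt (fun q : ℝ × ℂ => φ q.1) _ q :=
      HasFDerivAt.comp (g := φ) (f := fun q : ℝ × ℂ => q.1) q hφ.hasDerivAt.hasFDerivAt h0
    have h4 : HasFDerivAt (fun q : ℝ × ℂ => ψ q.1) _ q :=
      HasFDerivAt.comp (g := ψ) (f := fun q : ℝ × ℂ => q.1) q hψ.hasDerivAt.hasFDerivAt h0
    have h : HasFDerivAt (paramEta φ ψ θ) _ q :=
      ((c (((h0.mul_const θ.1.2.2).add (h1.mul_const θ.2.1.1.re)).add
        (h2.mul_const θ.2.1.1.im))).mul (hasFDerivAt_snd (p := q)) |>.add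
        (((c h1).mul_const θ.2.2.1.1).add ((c h2).mul_const θ.2.2.1.2))).add
        ((h3.const_mul θ.2.2.2.1).add (h4.const_mul θ.2.2.2.2))
    rw [h.fderiv]
    simp
    ring
  have e : q.2 = q.2.re + q.2.im * Complex.I := (Complex.re_add_im q.2).symm
  refine ⟨?_, ?_, ?_⟩ <;> simp only [pd, key, affineFun, eT, eY, eZ] <;> simp
  · generalize q.2.re = a at *
    generalize q.2.im = b at *
    rw [e]; ring
  · generalize q.2.re = a at *
    generalize q.2.im = b at *
    rw [e]; ring

/-- Admissible parameters solve the determining equations. -/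
theorem IsAdmissible.determiningEquations {β : ℝ → ℝ} {φ ψ : ℝ → ℂ} {θ : FieldParam} {q : ℝ × ℂ}
    (hθ : IsAdmissible β θ q.1) (hφ : ContDiffAt ℝ ∞ φ q.1) (hψ : ContDiffAt ℝ ∞ ψ q.1)
    (eφ : deriv (deriv φ) q.1 = β q.1 • (Complex.I * φ q.1))
    (eψ : deriv (deriv ψ) q.1 = β q.1 • (Complex.I * ψ q.1)) :
    DeterminingEquations β (paramXi θ) (paramEta φ ψ θ) q := by
  have dd : ∀ {f : ℝ → ℂ}, ContDiffAt ℝ ∞ f q.1 →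
      ∀ᶠ r : ℝ × ℂ in nhds q, DifferentiableAt ℝ f r.1 := fun {f} hf => by
    have h1 : ∀ᶠ t in nhds q.1, DifferentiableAt ℝ f t :=
      ((hf.of_le (m := 1) (by exact_mod_cast le_top)).eventually (by simp)).mono
        fun t ht => ht.differentiableAt (by norm_num)
    exact continuousAt_fst.eventually h1
  have dd' : ∀ {f : ℝ → ℂ}, ContDiffAt ℝ ∞ f q.1 → DifferentiableAt ℝ (deriv f) q.1 :=
    fun hf => (((hf.fderiv_right (m := 1) (by norm_cast)).clm_apply
      contDiffAt_const).differentiableAt (by norm_num))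
  have hT : pd eT (paramEta φ ψ θ) =ᶠ[nhds q] fun r =>
      θ.1.2.2 * r.2 + (θ.2.2.2.1 * deriv φ r.1 + θ.2.2.2.2 * deriv ψ r.1) := by
    filter_upwards [dd hφ, dd hψ] with r h1 h2 using (pd_paramEta θ h1 h2).1
  have hY : pd eY (paramEta φ ψ θ) =ᶠ[nhds q] affineFun θ.2.2.1.1 (θ.1.2.2 : ℂ)
      (2 * θ.2.1.1.re : ℂ) (θ.2.1.1.re * Complex.I + θ.2.1.1.im) := by
    filter_upwards [dd hφ, dd hψ] with r h1 h2 using (pd_paramEta θ h1 h2).2.1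
  have hZ : pd eZ (paramEta φ ψ θ) =ᶠ[nhds q] affineFun θ.2.2.1.2 (θ.1.2.2 * Complex.I)
      (θ.2.1.1.re * Complex.I + θ.2.1.1.im) (2 * θ.2.1.1.im * Complex.I) := by
    filter_upwards [dd hφ, dd hψ] with r h1 h2 using (pd_paramEta θ h1 h2).2.2
  have hTT : pd eT (pd eT (paramEta φ ψ θ)) q =
      θ.2.2.2.1 * deriv (deriv φ) q.1 + θ.2.2.2.2 * deriv (deriv ψ) q.1 := by
    rw [pd_congr hT]
    have h0 := (hasFDerivAt_coordinates q).1
    have h3 : HasFDerivAt (fun q : ℝ × ℂ => deriv φ q.1) _ q :=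
      HasFDerivAt.comp (g := deriv φ) (f := fun q : ℝ × ℂ => q.1) q
        (dd' hφ).hasDerivAt.hasFDerivAt h0
    have h4 : HasFDerivAt (fun q : ℝ × ℂ => deriv ψ q.1) _ q :=
      HasFDerivAt.comp (g := deriv ψ) (f := fun q : ℝ × ℂ => q.1) q
        (dd' hψ).hasDerivAt.hasFDerivAt h0
    have h : HasFDerivAt (fun r : ℝ × ℂ =>
        θ.1.2.2 * r.2 + (θ.2.2.2.1 * deriv φ r.1 + θ.2.2.2.2 * deriv ψ r.1)) _ q :=
      ((hasFDerivAt_snd (p := q)).const_mul (θ.1.2.2 : ℂ)).add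
        ((h3.const_mul θ.2.2.2.1).add (h4.const_mul θ.2.2.2.2))
    rw [pd, h.fderiv]
    simp [eT]
  obtain ⟨x0, x1, x2⟩ := pd_paramXi θ
  have m1 : (β q.1 : ℂ) * θ.2.1.1.re = 0 := by
    have := congrArg Complex.re hθ.m; exact_mod_cast (by simpa using this)
  have m2 : (β q.1 : ℂ) * θ.2.1.1.im = 0 := by
    have := congrArg Complex.im hθ.m; exact_mod_cast (by simpa using this)
  have n1 : (β q.1 : ℂ) * θ.2.1.2.re = 0 := by
    have := congrArg Complex.re hθ.n; exact_mod_cast (by simpa using this)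
  have n2 : (β q.1 : ℂ) * θ.2.1.2.im = 0 := by
    have := congrArg Complex.im hθ.n; exact_mod_cast (by simpa using this)
  have m3 : ((deriv β q.1 : ℝ) : ℂ) * θ.2.1.1.re = 0 := by
    have := congrArg Complex.re hθ.deriv_m; exact_mod_cast (by simpa using this)
  have m4 : ((deriv β q.1 : ℝ) : ℂ) * θ.2.1.1.im = 0 := by
    have := congrArg Complex.im hθ.deriv_m; exact_mod_cast (by simpa using this)
  have n3 : ((deriv β q.1 : ℝ) : ℂ) * θ.2.1.2.re = 0 := by
    have := congrArg Complex.re hθ.deriv_n; exact_mod_cast (by simpa using this)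
  have n4 : ((deriv β q.1 : ℝ) : ℂ) * θ.2.1.2.im = 0 := by
    have := congrArg Complex.im hθ.deriv_n; exact_mod_cast (by simpa using this)
  have a := congrArg (fun r : ℝ => (r : ℂ)) hθ.quadratic
  have l := hθ.linear
  have e : q.2 = q.2.re + q.2.im * Complex.I := (Complex.re_add_im q.2).symm
  have I2 := Complex.I_sq
  constructor
  · rw [x1]; simp
  · rw [x2]; simp
  · rw [x2]; simp
  · rw [pd_congr hY, x1]; simp
  · rw [pd_congr hZ, x1, x2]; simp
  · rw [pd_congr hZ, x2]; simp
  · rw [pd_congr hY, x0, x1, x2]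
    simp [affineFun]
    linear_combination (q.2.im - 2 * Complex.I * q.2 : ℂ) * (n1 + q.1 * m1) -
      (q.2.re : ℂ) * (n2 + q.1 * m2)
  · rw [pd_congr hZ, x0, x1, x2]
    simp [affineFun]
    linear_combination Complex.I * (q.2.im * (n1 + q.1 * m1) - q.2.re * (n2 + q.1 * m2)) -
      2 * Complex.I * q.2 * (n2 + q.1 * m2)
  · rw [hTT, hY.self_of_nhds, hZ.self_of_nhds, x0, eφ, eψ]
    simp only [affineFun, paramXi, paramEta, smul_eq_mul, Complex.real_smul] at a ⊢
    push_cast at a ⊢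
    generalize q.2.re = y at *
    generalize q.2.im = z at *
    rw [e]
    linear_combination -Complex.I * (y + z * Complex.I) * a -
      Complex.I * (y + z * Complex.I) * (y * (n3 + q.1 * m3) + z * (n4 + q.1 * m4)) +
      (y - Complex.I * z) * l +
      (-2 * y * z - z ^ 2 * Complex.I + y ^ 2 * Complex.I -
        3 * y * Complex.I * (y + z * Complex.I)) * m1 +
      (-z ^ 2 + y ^ 2 + 2 * y * z * Complex.I - 3 * z * Complex.I * (y + z * Complex.I)) * m2 -
      β q.1 * z * (θ.2.2.1.1 + q.1 * θ.1.2.2) * I2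

end ParametricFields

/-! ### Differential consequences of the determining equations -/

section Integration

/-- Differentiation of an identity of the shape of the determining equations in a direction of `u`,
along which the coefficients depending on `t` are constant. -/
theorem vertical_deriv {β b : ℝ → ℝ} {A B C E N X : ℝ × ℂ → ℂ} {A' B' C' E' N' X' : ℂ} {q : ℝ × ℂ}
    {w : ℂ} (hA : HasDerivAt (fun s : ℝ => A (q + s • ((0 : ℝ), w))) A' 0)
    (hB : HasDerivAt (fun s : ℝ => B (q + s • ((0 : ℝ), w))) B' 0)
    (hC : HasDerivAt (fun s : ℝ => C (q + s • ((0 : ℝ), w))) C' 0)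
    (hE : HasDerivAt (fun s : ℝ => E (q + s • ((0 : ℝ), w))) E' 0)
    (hN : HasDerivAt (fun s : ℝ => N (q + s • ((0 : ℝ), w))) N' 0)
    (hX : HasDerivAt (fun s : ℝ => X (q + s • ((0 : ℝ), w))) X' 0)
    (h : ∀ᶠ r in nhds q, A r + β r.1 * (-r.2.im * B r + r.2.re * C r) +
      β r.1 * (E r * (Complex.I * r.2)) + β r.1 * N r + b r.1 * (X r * (Complex.I * r.2)) = 0) :
    A' + β q.1 * (-(w.im * B q + q.2.im * B') + (w.re * C q + q.2.re * C')) +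
      β q.1 * (E' * (Complex.I * q.2) + E q * (Complex.I * w)) + β q.1 * N' +
      b q.1 * (X' * (Complex.I * q.2) + X q * (Complex.I * w)) = 0 := by
  have lin : ∀ L : ℂ →L[ℝ] ℂ, HasDerivAt (fun s : ℝ => L (q + s • ((0 : ℝ), w)).2) (L w) 0 := by
    intro L
    have h1 : HasDerivAt (fun s : ℝ => q + s • ((0 : ℝ), w)) ((1 : ℝ) • ((0 : ℝ), w)) 0 :=
      ((hasDerivAt_id (0 : ℝ)).smul_const _).const_add q
    have h2 := ((L.comp (ContinuousLinearMap.snd ℝ ℝ ℂ)).hasFDerivAt).comp_hasDerivAt (0 : ℝ) h1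
    exact h2.congr_deriv (by simp)
  have hu : HasDerivAt (fun s : ℝ => (q + s • ((0 : ℝ), w)).2) w 0 :=
    lin (ContinuousLinearMap.id ℝ ℂ)
  have hy : HasDerivAt (fun s : ℝ => ((q + s • ((0 : ℝ), w)).2.re : ℂ)) w.re 0 :=
    lin (Complex.ofRealCLM.comp Complex.reCLM)
  have hz : HasDerivAt (fun s : ℝ => ((q + s • ((0 : ℝ), w)).2.im : ℂ)) w.im 0 :=
    lin (Complex.ofRealCLM.comp Complex.imCLM)
  -- The line keeps t fixed, so no differentiability of `β` or `b` is needed; this allows `b` to be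
  -- β' later.
  have ht : ∀ (c : ℝ → ℝ),
      HasDerivAt (fun s : ℝ => (c (q + s • ((0 : ℝ), w)).1 : ℂ)) 0 0 := fun c => by
    have : (fun s : ℝ => (c (q + s • ((0 : ℝ), w)).1 : ℂ)) = fun _ => (c q.1 : ℂ) := by
      funext s; simp
    rw [this]
    exact hasDerivAt_const _ _
  have tot := ((((hA.add ((ht β).mul ((hz.neg.mul hB).add (hy.mul hC)))).add
    ((ht β).mul (hE.mul (hu.const_mul Complex.I)))).add ((ht β).mul hN)).add
    ((ht b).mul (hX.mul (hu.const_mul Complex.I))))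
  have hc : Filter.Tendsto (fun s : ℝ => q + s • ((0 : ℝ), w)) (nhds 0) (nhds q) := by
    have : ContinuousAt (fun s : ℝ => q + s • ((0 : ℝ), w)) 0 := by fun_prop
    simpa [ContinuousAt] using this
  have z : HasDerivAt (fun _ : ℝ => (0 : ℂ)) 0 0 := hasDerivAt_const _ _
  have e := (z.congr_of_eventuallyEq (hc.eventually h)).unique tot
  simp only [zero_smul, add_zero, zero_mul, zero_add, Pi.neg_apply] at e
  rw [e]
  ring

variable {D : Opens (ℝ × ℂ)}

theorem pd_comm_three {G : Type*} [NormedAddCommGroup G] [NormedSpace ℝ G] {f : ℝ × ℂ → G}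
    (hf : ∀ q ∈ D, ContDiffAt ℝ ∞ f q) {q : ℝ × ℂ} (hq : q ∈ D) (v w w' : ℝ × ℂ) :
    pd v (pd w (pd w' f)) q = pd w (pd w' (pd v f)) q := by
  rw [pd_comm (contDiffAt_pd (hf q hq) w')]
  refine pd_congr ?_ w
  filter_upwards [D.isOpen.mem_nhds hq] with r hr using pd_comm (hf r hr) _ _

theorem pd_congr_of_mem {G : Type*} [NormedAddCommGroup G] [NormedSpace ℝ G] {f g : ℝ × ℂ → G}
    (h : ∀ q ∈ D, f q = g q) {q : ℝ × ℂ} (hq : q ∈ D) (v : ℝ × ℂ) : pd v f q = pd v g q :=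
  pd_congr (by filter_upwards [D.isOpen.mem_nhds hq] with r hr using h r hr) v

theorem pd_const {G : Type*} [NormedAddCommGroup G] [NormedSpace ℝ G] (c : G) (q v : ℝ × ℂ) :
    pd v (fun _ => c) q = 0 := by
  simp [pd]

variable {β : ℝ → ℝ} {ξ : ℝ × ℂ → ℝ} {η : ℝ × ℂ → ℂ}

/-- The compatibility conditions of the mixed determining equations. -/
theorem projective_part_conditions (hξ : ∀ q ∈ D, ContDiffAt ℝ ∞ ξ q)
    (hη : ∀ q ∈ D, ContDiffAt ℝ ∞ η q) (H : ∀ q ∈ D, DeterminingEquations β ξ η q)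
    {q : ℝ × ℂ} (hq : q ∈ D) :
    β q.1 * pd eY ξ q = 0 ∧ β q.1 * pd eZ ξ q = 0 ∧
      pd eT (pd eT (pd eY ξ)) q = 0 ∧ pd eT (pd eT (pd eZ ξ)) q = 0 := by
  have dξ := fun v => (contDiffAt_pd (hξ q hq) v)
  have hl : ∀ {G : Type} [NormedAddCommGroup G] [NormedSpace ℝ G] {f : ℝ × ℂ → G},
      ContDiffAt ℝ ∞ f q → ∀ v, HasDerivAt (fun s : ℝ => f (q + s • v)) (pd v f q) 0 :=
    fun hf v => hasDerivAt_line (hf.differentiableAt (by simp)) v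
  have zero : ∀ v : ℝ × ℂ, HasDerivAt (fun s : ℝ => (fun _ : ℝ × ℂ => (0 : ℂ)) (q + s • v)) 0 0 :=
    fun v => hasDerivAt_const _ _
  have hD := D.isOpen.mem_nhds hq
  have VY := vertical_deriv (β := β) (b := 0) (q := q) (w := 1)
    (A := fun r => 2 * pd eT (pd eY η) r - pd eT (pd eT ξ) r) (B := fun r => -(pd eY ξ r : ℝ))
    (C := fun r => -(pd eZ ξ r : ℝ)) (E := fun r => -2 * (pd eY ξ r : ℝ)) (N := fun _ => 0)
    (X := fun _ => 0)
    (((hl (contDiffAt_pd (contDiffAt_pd (hη q hq) eY) eT) eY).const_mul 2).sub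
      (hl (contDiffAt_pd (dξ eT) eT) eY).ofReal_comp)
    (hl (dξ eY) eY).ofReal_comp.neg (hl (dξ eZ) eY).ofReal_comp.neg
    ((hl (dξ eY) eY).ofReal_comp.const_mul (-2)) (zero eY) (zero eY)
    (by filter_upwards [hD] with r hr; linear_combination (H r hr).ηTY)
  have VZ := vertical_deriv (β := β) (b := 0) (q := q) (w := Complex.I)
    (A := fun r => 2 * pd eT (pd eZ η) r - Complex.I * (pd eT (pd eT ξ) r : ℝ))
    (B := fun r => -Complex.I * (pd eY ξ r : ℝ))
    (C := fun r => -Complex.I * (pd eZ ξ r : ℝ)) (E := fun r => -2 * (pd eZ ξ r : ℝ))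
    (N := fun _ => 0) (X := fun _ => 0)
    (((hl (contDiffAt_pd (contDiffAt_pd (hη q hq) eZ) eT) eZ).const_mul 2).sub
      ((hl (contDiffAt_pd (dξ eT) eT) eZ).ofReal_comp.const_mul Complex.I))
    ((hl (dξ eY) eZ).ofReal_comp.const_mul _) ((hl (dξ eZ) eZ).ofReal_comp.const_mul _)
    ((hl (dξ eZ) eZ).ofReal_comp.const_mul (-2)) (zero eZ) (zero eZ)
    (by filter_upwards [hD] with r hr; linear_combination (H r hr).ηTZ)
  have c1 : pd eY (pd eT (pd eY η)) q = 2 * (pd eT (pd eT (pd eY ξ)) q : ℝ) := by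
    rw [pd_comm (contDiffAt_pd (hη q hq) eY),
      pd_congr_of_mem (fun r hr => (H r hr).ηYY) hq]
    have h := ((contDiffAt_pd (dξ eY) eT).differentiableAt (by simp)).hasFDerivAt
    have h' : HasFDerivAt (fun r => 2 * ((pd eT (pd eY ξ) r : ℝ) : ℂ)) _ q :=
      (HasFDerivAt.comp (g := fun x : ℝ => (x : ℂ)) q Complex.ofRealCLM.hasFDerivAt h).const_mul 2
    rw [pd, h'.fderiv]; simp [pd]
  have c2 : pd eZ (pd eT (pd eZ η)) q = 2 * (pd eT (pd eT (pd eZ ξ)) q : ℝ) * Complex.I := by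
    rw [pd_comm (contDiffAt_pd (hη q hq) eZ),
      pd_congr_of_mem (fun r hr => (H r hr).ηZZ) hq]
    have h := ((contDiffAt_pd (dξ eZ) eT).differentiableAt (by simp)).hasFDerivAt
    have h' : HasFDerivAt (fun r => 2 * ((pd eT (pd eZ ξ) r : ℝ) : ℂ) * Complex.I) _ q :=
      ((HasFDerivAt.comp (g := fun x : ℝ => (x : ℂ)) q Complex.ofRealCLM.hasFDerivAt h).const_mul
        2).mul_const Complex.I
    rw [pd, h'.fderiv]; simp [pd]; ring
  have yz : pd eZ (pd eY ξ) q = 0 := by rw [pd_comm (hξ q hq)]; exact (H q hq).ξYZ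
  change 2 * pd eY (pd eT (pd eY η)) q - ((pd eY (pd eT (pd eT ξ)) q : ℝ) : ℂ) +
    β q.1 * (-((1 : ℂ).im * -(pd eY ξ q : ℝ) + q.2.im * -(pd eY (pd eY ξ) q : ℝ)) +
      ((1 : ℂ).re * -(pd eZ ξ q : ℝ) + q.2.re * -(pd eY (pd eZ ξ) q : ℝ))) +
    β q.1 * (-2 * (pd eY (pd eY ξ) q : ℝ) * (Complex.I * q.2) + -2 * (pd eY ξ q : ℝ) *
      (Complex.I * 1)) + β q.1 * 0 + ((0 : ℝ) : ℂ) * (0 * (Complex.I * q.2) + 0 * _) = 0 at VY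
  change 2 * pd eZ (pd eT (pd eZ η)) q - Complex.I * ((pd eZ (pd eT (pd eT ξ)) q : ℝ) : ℂ) +
    β q.1 * (-(Complex.I.im * (-Complex.I * (pd eY ξ q : ℝ)) +
        q.2.im * (-Complex.I * (pd eZ (pd eY ξ) q : ℝ))) +
      (Complex.I.re * (-Complex.I * (pd eZ ξ q : ℝ)) +
        q.2.re * (-Complex.I * (pd eZ (pd eZ ξ) q : ℝ)))) +
    β q.1 * (-2 * (pd eZ (pd eZ ξ) q : ℝ) * (Complex.I * q.2) + -2 * (pd eZ ξ q : ℝ) *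
      (Complex.I * Complex.I)) + β q.1 * 0 + ((0 : ℝ) : ℂ) * (0 * (Complex.I * q.2) + 0 * _) = 0
    at VZ
  rw [c1, pd_comm_three hξ hq eY eT eT, (H q hq).ξYY, (H q hq).ξYZ] at VY
  rw [c2, pd_comm_three hξ hq eZ eT eT, (H q hq).ξZZ, yz] at VZ
  -- With y = Re u and z = Im u, `VY` now reads 3ξ_tty - βξ_z - 2iβξ_y = 0 and `VZ` reads 3iξ_ttz +
  -- iβξ_y + 2βξ_z = 0. Since ξ and β are real, the parts of each equation separate.
  have r1 := congrArg Complex.re VY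
  have i1 := congrArg Complex.im VY
  have r2 := congrArg Complex.re VZ
  have i2 := congrArg Complex.im VZ
  simp at r1 i1 r2 i2
  rw [← mul_eq_zero] at i1 r2
  rw [r2] at r1
  rw [i1] at i2
  exact ⟨i1, r2, by linarith, by linarith⟩

theorem pd_ofReal {f : ℝ × ℂ → ℝ} {q : ℝ × ℂ} (hf : DifferentiableAt ℝ f q) (v : ℝ × ℂ) :
    pd v (fun r => (f r : ℂ)) q = pd v f q := by
  have h : HasFDerivAt (fun r => (f r : ℂ)) _ q :=
    HasFDerivAt.comp (g := fun x : ℝ => (x : ℂ)) q Complex.ofRealCLM.hasFDerivAt hf.hasFDerivAt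
  rw [pd, h.fderiv]; simp [pd]

theorem pd_const_mul {f : ℝ × ℂ → ℂ} {q : ℝ × ℂ} (hf : DifferentiableAt ℝ f q) (c : ℂ)
    (v : ℝ × ℂ) : pd v (fun r => c * f r) q = c * pd v f q := by
  rw [pd, (hf.hasFDerivAt.const_mul c).fderiv]; simp [pd]

/-- The consequences of the determining equation of order zero in the derivatives of `u`. -/
theorem linear_part_conditions (hξ : ∀ q ∈ D, ContDiffAt ℝ ∞ ξ q)
    (hη : ∀ q ∈ D, ContDiffAt ℝ ∞ η q) (H : ∀ q ∈ D, DeterminingEquations β ξ η q)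
    (hY : ∀ q ∈ D, β q.1 * pd eY ξ q = 0) (hZ : ∀ q ∈ D, β q.1 * pd eZ ξ q = 0)
    {q : ℝ × ℂ} (hq : q ∈ D) (hTY : β q.1 * pd eT (pd eY ξ) q = 0)
    (hTZ : β q.1 * pd eT (pd eZ ξ) q = 0) (hY' : deriv β q.1 * pd eY ξ q = 0)
    (hZ' : deriv β q.1 * pd eZ ξ q = 0) :
    pd eT (pd eT (pd eT ξ)) q = 0 ∧ 2 * β q.1 * pd eT ξ q + deriv β q.1 * ξ q = 0 ∧
      (β q.1 : ℂ) * (pd eZ η q - Complex.I * pd eY η q) = 0 := by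
  have dξ := fun v => (contDiffAt_pd (hξ q hq) v)
  have dη := fun v => (contDiffAt_pd (hη q hq) v)
  have hl : ∀ {G : Type} [NormedAddCommGroup G] [NormedSpace ℝ G] {f : ℝ × ℂ → G},
      ContDiffAt ℝ ∞ f q → ∀ v, HasDerivAt (fun s : ℝ => f (q + s • v)) (pd v f q) 0 :=
    fun hf v => hasDerivAt_line (hf.differentiableAt (by simp)) v
  have hD := D.isOpen.mem_nhds hq
  have cast : ∀ {a b : ℝ}, a * b = 0 → (a : ℂ) * b = 0 := fun h => by exact_mod_cast h
  have V : ∀ w : ℂ, _ := fun w => vertical_deriv (β := β) (b := deriv β) (q := q) (w := w)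
    (A := pd eT (pd eT η)) (B := pd eY η) (C := pd eZ η) (E := fun r => -2 * (pd eT ξ r : ℝ))
    (N := fun r => -Complex.I * η r) (X := fun r => -(ξ r : ℝ))
    (hl (contDiffAt_pd (dη eT) eT) (0, w)) (hl (dη eY) (0, w)) (hl (dη eZ) (0, w))
    ((hl (dξ eT) (0, w)).ofReal_comp.const_mul (-2)) ((hl (hη q hq) (0, w)).const_mul _)
    (hl (hξ q hq) (0, w)).ofReal_comp.neg
    (by filter_upwards [hD] with r hr; linear_combination (H r hr).ηTT)
  have VY := V 1
  have VZ := V Complex.I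
  change pd eY (pd eT (pd eT η)) q + β q.1 * (-((1 : ℂ).im * pd eY η q +
      q.2.im * pd eY (pd eY η) q) + ((1 : ℂ).re * pd eZ η q + q.2.re * pd eY (pd eZ η) q)) +
    β q.1 * (-2 * (pd eY (pd eT ξ) q : ℝ) * (Complex.I * q.2) +
      -2 * (pd eT ξ q : ℝ) * (Complex.I * 1)) + β q.1 * (-Complex.I * pd eY η q) +
    (deriv β q.1 : ℝ) * (-(pd eY ξ q : ℝ) * (Complex.I * q.2) + -(ξ q : ℝ) * (Complex.I * 1)) = 0
    at VY
  change pd eZ (pd eT (pd eT η)) q + β q.1 * (-(Complex.I.im * pd eY η q +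
      q.2.im * pd eZ (pd eY η) q) + (Complex.I.re * pd eZ η q + q.2.re * pd eZ (pd eZ η) q)) +
    β q.1 * (-2 * (pd eZ (pd eT ξ) q : ℝ) * (Complex.I * q.2) +
      -2 * (pd eT ξ q : ℝ) * (Complex.I * Complex.I)) + β q.1 * (-Complex.I * pd eZ η q) +
    (deriv β q.1 : ℝ) * (-(pd eZ ξ q : ℝ) * (Complex.I * q.2) +
      -(ξ q : ℝ) * (Complex.I * Complex.I)) = 0
    at VZ
  -- As βξ_y and βξ_z vanish on all of `D`, they are dropped from the mixed equations before these
  -- are differentiated in t.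
  have e1 : 2 * pd eT (pd eT (pd eY η)) q = (pd eT (pd eT (pd eT ξ)) q : ℝ) := by
    rw [← pd_const_mul ((contDiffAt_pd (dη eY) eT).differentiableAt (by simp)),
      ← pd_ofReal ((contDiffAt_pd (dξ eT) eT).differentiableAt (by simp))]
    refine pd_congr_of_mem (fun r hr => ?_) hq eT
    linear_combination (H r hr).ηTY + (-r.2.im + 2 * Complex.I * r.2) * cast (hY r hr) +
      r.2.re * cast (hZ r hr)
  have e2 : 2 * pd eT (pd eT (pd eZ η)) q = Complex.I * (pd eT (pd eT (pd eT ξ)) q : ℝ) := by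
    have hd := (contDiffAt_pd (dξ eT) eT).differentiableAt (by simp)
    have hd' : DifferentiableAt ℝ (fun r => ((pd eT (pd eT ξ) r : ℝ) : ℂ)) q :=
      Complex.ofRealCLM.differentiableAt.comp q hd
    rw [← pd_const_mul ((contDiffAt_pd (dη eZ) eT).differentiableAt (by simp)), ← pd_ofReal hd,
      ← pd_const_mul hd']
    refine pd_congr_of_mem (fun r hr => ?_) hq eT
    linear_combination (H r hr).ηTZ - r.2.im * Complex.I * cast (hY r hr) +
      (r.2.re * Complex.I + 2 * Complex.I * r.2) * cast (hZ r hr)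
  rw [pd_comm_three hη hq eY eT eT, pd_comm (hξ q hq) eY eT, (H q hq).ηYY, (H q hq).ηYZ] at VY
  rw [pd_comm_three hη hq eZ eT eT, pd_comm (hξ q hq) eZ eT, pd_comm (hη q hq) eZ eY,
    (H q hq).ηYZ, (H q hq).ηZZ] at VZ
  simp only [Complex.one_re, Complex.one_im, Complex.I_re, Complex.I_im, Complex.ofReal_one,
    Complex.ofReal_zero] at VY VZ
  have t1 := cast hTY
  have t2 := cast hTZ
  have s1 := cast hY'
  have s2 := cast hZ'
  have I2 := Complex.I_sq
  -- The term β(η_z - iη_y), the failure of η to be complex linear in u, enters `VY2` and `VZ2` with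
  -- opposite signs, while the remaining terms agree. The difference isolates it. The sum has ξ_ttt
  -- as real part and a multiple of 2βξ_t + β'ξ as imaginary part.
  have VY2 : (pd eT (pd eT (pd eT ξ)) q : ℝ) / 2 + β q.1 * (pd eZ η q - Complex.I * pd eY η q) -
      Complex.I * (2 * β q.1 * (pd eT ξ q : ℝ) + (deriv β q.1 : ℝ) * ξ q) = 0 := by
    linear_combination VY - e1 / 2 + (2 * q.2.im - q.2.re * Complex.I + 2 * Complex.I * q.2) * t1 -
      q.2.re * t2 + Complex.I * q.2 * s1
  have VZ2 : (pd eT (pd eT (pd eT ξ)) q : ℝ) / 2 - β q.1 * (pd eZ η q - Complex.I * pd eY η q) -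
      Complex.I * (2 * β q.1 * (pd eT ξ q : ℝ) + (deriv β q.1 : ℝ) * ξ q) = 0 := by
    linear_combination -Complex.I * VZ + Complex.I / 2 * e2 - Complex.I ^ 2 * q.2.im * t1 +
      (-Complex.I * q.2.im + 2 * Complex.I ^ 2 * q.2.re - 2 * Complex.I ^ 2 * q.2) * t2 -
      Complex.I ^ 2 * q.2 * s2 +
      ((pd eT (pd eT (pd eT ξ)) q : ℝ) / 2 - β q.1 * pd eZ η q -
        2 * Complex.I * β q.1 * (pd eT ξ q : ℝ) - Complex.I * (deriv β q.1 : ℝ) * ξ q) * I2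
  have sum : ((pd eT (pd eT (pd eT ξ)) q : ℝ) : ℂ) -
      2 * Complex.I * ((2 * β q.1 * pd eT ξ q + deriv β q.1 * ξ q : ℝ) : ℂ) = 0 := by
    push_cast
    linear_combination VY2 + VZ2
  have r := congrArg Complex.re sum
  have i := congrArg Complex.im sum
  refine ⟨by simpa using r, ?_, by linear_combination (VY2 - VZ2) / 2⟩
  rw [mul_assoc 2 Complex.I, Complex.sub_im, Complex.ofReal_im, zero_sub, Complex.zero_im, neg_eq_zero] at i
  have i' : 2 * (2 * β q.1 * pd eT ξ q + deriv β q.1 * ξ q) = 0 := by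
    rw [Complex.mul_im, Complex.I_mul_im, Complex.ofReal_re] at i
    simpa using i
  linarith

/-- On a connected domain, the Wronskian of two solutions of `c'' = i β c` is constant. -/
theorem exists_wronskian_eq_const (hD : IsPreconnected (D : Set (ℝ × ℂ))) {c : ℝ × ℂ → ℂ}
    {ψ : ℝ → ℂ} (hc : ∀ q ∈ D, ContDiffAt ℝ ∞ c q) (hY : ∀ q ∈ D, pd eY c q = 0)
    (hZ : ∀ q ∈ D, pd eZ c q = 0) (hTT : ∀ q ∈ D, pd eT (pd eT c) q = β q.1 * (Complex.I * c q))
    (hψ : ∀ q ∈ D, ContDiffAt ℝ ∞ ψ q.1)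
    (eψ : ∀ q ∈ D, deriv (deriv ψ) q.1 = β q.1 • (Complex.I * ψ q.1)) :
    ∃ k : ℂ, ∀ q ∈ D, c q * deriv ψ q.1 - pd eT c q * ψ q.1 = k := by
  have key : ∀ q ∈ D, ∃ L : ℝ × ℂ →L[ℝ] ℂ,
      HasFDerivAt (fun q : ℝ × ℂ => c q * deriv ψ q.1 - pd eT c q * ψ q.1) L q ∧
      ∀ v, L v = c q * (v.1 * deriv (deriv ψ) q.1) + pd v c q * deriv ψ q.1 -
        (pd eT c q * (v.1 * deriv ψ q.1) + pd v (pd eT c) q * ψ q.1) := by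
    intro q hq
    have h0 := (hasFDerivAt_coordinates q).1
    have dψ : DifferentiableAt ℝ ψ q.1 := (hψ q hq).differentiableAt (by simp)
    have dψ' : DifferentiableAt ℝ (deriv ψ) q.1 :=
      ((((hψ q hq).fderiv_right (m := 1) (by norm_cast)).clm_apply
        contDiffAt_const).differentiableAt (by norm_num))
    have h3 : HasFDerivAt (fun q : ℝ × ℂ => ψ q.1) _ q :=
      HasFDerivAt.comp (g := ψ) (f := fun q : ℝ × ℂ => q.1) q dψ.hasDerivAt.hasFDerivAt h0
    have h4 : HasFDerivAt (fun q : ℝ × ℂ => deriv ψ q.1) _ q :=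
      HasFDerivAt.comp (g := deriv ψ) (f := fun q : ℝ × ℂ => q.1) q dψ'.hasDerivAt.hasFDerivAt h0
    have h5 := ((hc q hq).differentiableAt (by simp)).hasFDerivAt
    have h6 := ((contDiffAt_pd (hc q hq) eT).differentiableAt (by simp)).hasFDerivAt
    refine ⟨_, (h5.mul h4).sub (h6.mul h3), fun v => ?_⟩
    simp [pd]
    ring
  have hYT : ∀ q ∈ D, pd eY (pd eT c) q = 0 := fun q hq => by
    rw [pd_comm (hc q hq), pd_congr_of_mem hY hq, pd_const]
  have hZT : ∀ q ∈ D, pd eZ (pd eT c) q = 0 := fun q hq => by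
    rw [pd_comm (hc q hq), pd_congr_of_mem hZ hq, pd_const]
  obtain ⟨k, hk⟩ := D.isOpen.exists_is_const_of_fderiv_eq_zero hD
    (f := fun q : ℝ × ℂ => c q * deriv ψ q.1 - pd eT c q * ψ q.1)
    (fun q hq => by
      obtain ⟨L, hL, -⟩ := key q hq
      exact hL.differentiableAt.differentiableWithinAt)
    (fun q hq => by
      obtain ⟨L, hL, hv⟩ := key q hq
      rw [hL.fderiv]
      apply hL.fderiv ▸ fderiv_eq_zero_of_pd <;> rw [pd, hL.fderiv, hv]
      · rw [hTT q hq, eψ q hq]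
        simp only [eT, Complex.real_smul, Complex.ofReal_one]; ring
      · rw [hY q hq, hYT q hq]; simp [eY]
      · rw [hZ q hq, hZT q hq]; simp [eZ])
  exact ⟨k, hk⟩

end Integration

/-! ### Solution of the determining equations on a connected domain -/

section Integration

variable {D : Opens (ℝ × ℂ)} {β : ℝ → ℝ} {ξ : ℝ × ℂ → ℝ} {η : ℝ × ℂ → ℂ}

/-- Fibres of `D` over a value of t need not be connected. Constants of integration are therefore
obtained from vanishing gradients on `D`, not by integrating one variable at a time. -/
theorem exists_eq_const_of_pd {G : Type*} [NormedAddCommGroup G] [NormedSpace ℝ G]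
    (hD : IsPreconnected (D : Set (ℝ × ℂ))) {f : ℝ × ℂ → G}
    (hf : ∀ q ∈ D, DifferentiableAt ℝ f q) (h0 : ∀ q ∈ D, pd eT f q = 0)
    (h1 : ∀ q ∈ D, pd eY f q = 0) (h2 : ∀ q ∈ D, pd eZ f q = 0) : ∃ c : G, ∀ q ∈ D, f q = c := by
  obtain ⟨c, hc⟩ := exists_eq_affineFun_of_pd hD hf h0 h1 h2
  exact ⟨c, fun q hq => by rw [hc q hq]; simp [affineFun]⟩

/-- On a connected domain the solutions of the determining equations are the candidates with
admissible parameters. -/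
theorem exists_param_of_determiningEquations (hD : IsPreconnected (D : Set (ℝ × ℂ)))
    {φ ψ : ℝ → ℂ} (hβ : ∀ q ∈ D, ContinuousAt β q.1) (hξ : ∀ q ∈ D, ContDiffAt ℝ ∞ ξ q)
    (hη : ∀ q ∈ D, ContDiffAt ℝ ∞ η q) (H : ∀ q ∈ D, DeterminingEquations β ξ η q)
    (hφ : ∀ q ∈ D, ContDiffAt ℝ ∞ φ q.1) (hψ : ∀ q ∈ D, ContDiffAt ℝ ∞ ψ q.1)
    (eφ : ∀ q ∈ D, deriv (deriv φ) q.1 = β q.1 • (Complex.I * φ q.1))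
    (eψ : ∀ q ∈ D, deriv (deriv ψ) q.1 = β q.1 • (Complex.I * ψ q.1))
    (hw : ∀ q ∈ D, φ q.1 * deriv ψ q.1 - deriv φ q.1 * ψ q.1 = 1) :
    ∃ θ : FieldParam, (∀ q ∈ D, ξ q = paramXi θ q ∧ η q = paramEta φ ψ θ q) ∧
      ∀ q ∈ D, IsAdmissible β θ q.1 := by
  have P := fun q (hq : q ∈ D) => projective_part_conditions hξ hη H hq
  have df : ∀ {G : Type} [NormedAddCommGroup G] [NormedSpace ℝ G] {f : ℝ × ℂ → G},
      (∀ q ∈ D, ContDiffAt ℝ ∞ f q) → ∀ q ∈ D, DifferentiableAt ℝ f q :=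
    fun hf q hq => (hf q hq).differentiableAt (by simp)
  have cξ : ∀ v, ∀ q ∈ D, ContDiffAt ℝ ∞ (pd v ξ) q := fun v q hq => contDiffAt_pd (hξ q hq) v
  have cη : ∀ v, ∀ q ∈ D, ContDiffAt ℝ ∞ (pd v η) q := fun v q hq => contDiffAt_pd (hη q hq) v
  have cξ2 : ∀ v w, ∀ q ∈ D, ContDiffAt ℝ ∞ (pd v (pd w ξ)) q :=
    fun v w q hq => contDiffAt_pd (cξ w q hq) v
  have ξZY : ∀ q ∈ D, pd eZ (pd eY ξ) q = 0 := fun q hq => by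
    rw [pd_comm (hξ q hq)]; exact (H q hq).ξYZ
  -- `ξ_u` is affine in `t`
  obtain ⟨m₁, hm₁⟩ := exists_eq_const_of_pd hD (df (cξ2 eT eY)) (fun q hq => (P q hq).2.2.1)
    (fun q hq => by
      rw [pd_comm (cξ eY q hq), pd_congr_of_mem (fun r hr => (H r hr).ξYY) hq, pd_const])
    (fun q hq => by
      rw [pd_comm (cξ eY q hq), pd_congr_of_mem ξZY hq, pd_const])
  obtain ⟨m₂, hm₂⟩ := exists_eq_const_of_pd hD (df (cξ2 eT eZ)) (fun q hq => (P q hq).2.2.2)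
    (fun q hq => by
      rw [pd_comm (cξ eZ q hq), pd_congr_of_mem (fun r hr => (H r hr).ξYZ) hq, pd_const])
    (fun q hq => by
      rw [pd_comm (cξ eZ q hq), pd_congr_of_mem (fun r hr => (H r hr).ξZZ) hq, pd_const])
  obtain ⟨n₁, hn₁⟩ := exists_eq_affineFun_of_pd hD (df (cξ eY)) hm₁
    (fun q hq => (H q hq).ξYY) ξZY
  obtain ⟨n₂, hn₂⟩ := exists_eq_affineFun_of_pd hD (df (cξ eZ)) hm₂
    (fun q hq => (H q hq).ξYZ) (fun q hq => (H q hq).ξZZ)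
  have hb : ∀ q ∈ D, (β q.1 * m₁ = 0 ∧ β q.1 * m₂ = 0 ∧ β q.1 * n₁ = 0 ∧ β q.1 * n₂ = 0) ∧
      deriv β q.1 * m₁ = 0 ∧ deriv β q.1 * m₂ = 0 ∧ deriv β q.1 * n₁ = 0 ∧
        deriv β q.1 * n₂ = 0 := by
    -- If β is nonzero somewhere, ξ_u vanishes on an open set, and being affine in t it has zero
    -- coefficients. Otherwise β vanishes on the open projection of `D`, and so does β'.
    by_cases h0 : ∃ q₀ ∈ D, β q₀.1 ≠ 0
    · obtain ⟨q₀, hq₀, hne⟩ := h0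
      have ev : ∀ᶠ r : ℝ × ℂ in nhds q₀, β r.1 ≠ 0 ∧ r ∈ D :=
        (continuousAt_fst.eventually ((hβ q₀ hq₀).eventually_ne hne)).and (D.isOpen.mem_nhds hq₀)
      have z : ∀ {v : ℝ × ℂ} {m n : ℝ}, (∀ q ∈ D, β q.1 * pd v ξ q = 0) →
          (∀ q ∈ D, pd eT (pd v ξ) q = m) → (∀ q ∈ D, pd v ξ q = affineFun n m 0 0 q) →
          m = 0 ∧ n = 0 := by
        intro v m n h1 h2 h3
        have e : pd v ξ =ᶠ[nhds q₀] fun _ => 0 := by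
          filter_upwards [ev] with r hr using (mul_eq_zero.1 (h1 r hr.2)).resolve_left hr.1
        have hm : m = 0 := by rw [← h2 q₀ hq₀, pd_congr e, pd_const]
        have hn := e.self_of_nhds
        rw [h3 q₀ hq₀, hm] at hn
        exact ⟨hm, by simpa [affineFun] using hn⟩
      obtain ⟨z1, z2⟩ := z (fun q hq => (P q hq).1) hm₁ hn₁
      obtain ⟨z3, z4⟩ := z (fun q hq => (P q hq).2.1) hm₂ hn₂
      simp [z1, z2, z3, z4]
    · push Not at h0
      intro q hq
      have e : β =ᶠ[nhds q.1] fun _ => 0 := by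
        filter_upwards [(isOpen_fst_image D).mem_nhds (mem_image_of_mem _ hq)] with t ht
        obtain ⟨r, hr, rfl⟩ := ht
        exact h0 r hr
      have e' : deriv β q.1 = 0 := by rw [e.deriv_eq, deriv_const]
      simp [h0 q hq, e']
  have L := fun q (hq : q ∈ D) => linear_part_conditions hξ hη H (fun q hq => (P q hq).1)
    (fun q hq => (P q hq).2.1) hq
    (by rw [hm₁ q hq]; exact (hb q hq).1.1) (by rw [hm₂ q hq]; exact (hb q hq).1.2.1)
    (by
      rw [hn₁ q hq]; simp only [affineFun, smul_eq_mul]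
      linear_combination (hb q hq).2.2.2.1 + q.1 * (hb q hq).2.1)
    (by
      rw [hn₂ q hq]; simp only [affineFun, smul_eq_mul]
      linear_combination (hb q hq).2.2.2.2 + q.1 * (hb q hq).2.2.1)
  obtain ⟨s, hs⟩ := exists_eq_const_of_pd hD (df (cξ2 eT eT)) (fun q hq => (L q hq).1)
    (fun q hq => by
      rw [pd_comm_three hξ hq eY eT eT, pd_congr_of_mem hm₁ hq, pd_const])
    (fun q hq => by
      rw [pd_comm_three hξ hq eZ eT eT, pd_congr_of_mem hm₂ hq, pd_const])
  obtain ⟨a₁, ha₁⟩ := exists_eq_affineFun_of_pd hD (df (cξ eT)) hs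
    (fun q hq => by rw [pd_comm (hξ q hq)]; exact hm₁ q hq)
    (fun q hq => by rw [pd_comm (hξ q hq)]; exact hm₂ q hq)
  obtain ⟨a₀, ha₀⟩ := exists_eq_add_const_of_pd hD (f := ξ)
    (g := paramXi ((0, a₁, s / 2), (⟨m₁, m₂⟩, ⟨n₁, n₂⟩), (0, 0), (0, 0))) (df hξ)
    (fun q _ => (contDiff_paramXi _).contDiffAt.differentiableAt (by simp))
    (fun q hq => by rw [(pd_paramXi _).1, ha₁ q hq, mul_div_cancel₀ s two_ne_zero])
    (fun q hq => by rw [(pd_paramXi _).2.1, hn₁ q hq])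
    (fun q hq => by rw [(pd_paramXi _).2.2, hn₂ q hq])
  have cast : ∀ {a b : ℝ}, a * b = 0 → (a : ℂ) * b = 0 := fun h => by exact_mod_cast h
  obtain ⟨C₁, hC₁⟩ := exists_eq_affineFun_of_pd hD (f := pd eY η) (A₀ := ((s / 2 : ℝ) : ℂ))
    (A₁ := 2 * (m₁ : ℂ)) (A₂ := m₁ * Complex.I + m₂) (df (cη eY))
    (fun q hq => by
      have h := (H q hq).ηTY
      rw [hs q hq] at h
      push_cast
      linear_combination h / 2 + (-q.2.im + 2 * Complex.I * q.2) / 2 * cast (P q hq).1 +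
        q.2.re / 2 * cast (P q hq).2.1)
    (fun q hq => by rw [(H q hq).ηYY, hm₁ q hq])
    (fun q hq => by rw [pd_comm (hη q hq), (H q hq).ηYZ, hm₁ q hq, hm₂ q hq])
  obtain ⟨C₂, hC₂⟩ := exists_eq_affineFun_of_pd hD (f := pd eZ η)
    (A₀ := ((s / 2 : ℝ) : ℂ) * Complex.I)
    (A₁ := m₁ * Complex.I + m₂) (A₂ := 2 * (m₂ : ℂ) * Complex.I) (df (cη eZ))
    (fun q hq => by
      have h := (H q hq).ηTZ
      rw [hs q hq] at h
      push_cast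
      linear_combination h / 2 - q.2.im * Complex.I / 2 * cast (P q hq).1 +
        (q.2.re * Complex.I + 2 * Complex.I * q.2) / 2 * cast (P q hq).2.1)
    (fun q hq => by rw [(H q hq).ηYZ, hm₁ q hq, hm₂ q hq])
    (fun q hq => by rw [(H q hq).ηZZ, hm₂ q hq])
  -- The coefficients of φ and ψ are set to zero for now; they come from the remainder `c` below,
  -- which depends on t only.
  let θ : FieldParam := ((a₀, a₁, s / 2), (⟨m₁, m₂⟩, ⟨n₁, n₂⟩), (C₁, C₂), (0, 0))
  have hξθ : ∀ q ∈ D, ξ q = paramXi θ q := fun q hq => by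
    rw [ha₀ q hq]; simp only [paramXi, θ]; ring
  have hθ : ∀ q ∈ D, IsAdmissible β θ q.1 := by
    intro q hq
    obtain ⟨⟨b1, b2, b3, b4⟩, b5, b6, b7, b8⟩ := hb q hq
    refine ⟨?_, ?_, ?_, ?_, ?_, ?_⟩
    · exact Complex.ext (by simpa [θ] using mul_eq_zero.1 b1) (by simpa [θ] using mul_eq_zero.1 b2)
    · exact Complex.ext (by simpa [θ] using mul_eq_zero.1 b3) (by simpa [θ] using mul_eq_zero.1 b4)
    · exact Complex.ext (by simpa [θ] using mul_eq_zero.1 b5) (by simpa [θ] using mul_eq_zero.1 b6)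
    · exact Complex.ext (by simpa [θ] using mul_eq_zero.1 b7) (by simpa [θ] using mul_eq_zero.1 b8)
    · have l := (L q hq).2.2
      rw [hC₁ q hq, hC₂ q hq] at l
      simp only [affineFun, Complex.real_smul] at l
      change (β q.1 : ℂ) * (C₂ - Complex.I * C₁) = 0
      linear_combination l + (q.2.re * Complex.I + q.2.im * Complex.I ^ 2) * cast b1 +
        (-q.2.re - q.2.im * Complex.I) * cast b2
    · have l := (L q hq).2.1
      rw [ha₁ q hq, hξθ q hq] at l
      simp only [affineFun, paramXi, smul_eq_mul] at l
      simp only [θ] at l ⊢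
      linear_combination l - 2 * q.2.re * b1 - 2 * q.2.im * b2 - q.2.re * (b7 + q.1 * b5) -
        q.2.im * (b8 + q.1 * b6)
  have cg : ∀ q ∈ D, ContDiffAt ℝ ∞ (paramEta φ ψ θ) q := fun q hq =>
    contDiffAt_paramEta θ (hφ q hq) (hψ q hq)
  set c : ℝ × ℂ → ℂ := fun q => η q - paramEta φ ψ θ q with hc
  have cc : ∀ q ∈ D, ContDiffAt ℝ ∞ c q := fun q hq => (hη q hq).sub (cg q hq)
  have pc : ∀ v, ∀ q ∈ D, pd v c q = pd v η q - pd v (paramEta φ ψ θ) q := fun v q hq =>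
    pd_sub (df hη q hq) (df cg q hq) v
  have pE := fun q (hq : q ∈ D) => pd_paramEta θ ((hφ q hq).differentiableAt (by simp))
    ((hψ q hq).differentiableAt (by simp))
  have cY : ∀ q ∈ D, pd eY c q = 0 := fun q hq => by
    rw [pc eY q hq, (pE q hq).2.1, hC₁ q hq, sub_self]
  have cZ : ∀ q ∈ D, pd eZ c q = 0 := fun q hq => by
    rw [pc eZ q hq, (pE q hq).2.2, hC₂ q hq, sub_self]
  -- Both η and its candidate solve the same inhomogeneous equation with the same ξ, so the
  -- difference solves the homogeneous one.
  have cTT : ∀ q ∈ D, pd eT (pd eT c) q = β q.1 * (Complex.I * c q) := fun q hq => by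
    have h1 := (H q hq).ηTT
    have h2 := ((hθ q hq).determiningEquations (hφ q hq) (hψ q hq) (eφ q hq) (eψ q hq)).ηTT
    have h3 : pd eT (pd eT c) q = pd eT (pd eT η) q - pd eT (pd eT (paramEta φ ψ θ)) q := by
      rw [pd_congr_of_mem (pc eT) hq, pd_sub (df (cη eT) q hq)
        ((contDiffAt_pd (cg q hq) eT).differentiableAt (by simp))]
    have h4 := cY q hq
    have h5 := cZ q hq
    rw [pc _ q hq] at h4 h5
    rw [← pd_congr_of_mem hξθ hq, ← hξθ q hq] at h2
    rw [h3]
    linear_combination h1 - h2 + β q.1 * q.2.im * h4 - β q.1 * q.2.re * h5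
  obtain ⟨k₁, hk₁⟩ := exists_wronskian_eq_const hD cc cY cZ cTT hψ eψ
  obtain ⟨k₂, hk₂⟩ := exists_wronskian_eq_const hD cc cY cZ cTT hφ eφ
  refine ⟨((a₀, a₁, s / 2), (⟨m₁, m₂⟩, ⟨n₁, n₂⟩), (C₁, C₂), (k₁, -k₂)),
    fun q hq => ⟨hξθ q hq, ?_⟩, fun q hq => ⟨(hθ q hq).m, (hθ q hq).n, (hθ q hq).deriv_m,
      (hθ q hq).deriv_n, (hθ q hq).linear, (hθ q hq).quadratic⟩⟩
  have e : η q = paramEta φ ψ θ q + c q := by simp [hc]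
  -- Because φ and ψ have Wronskian 1, c = W(c, ψ) φ - W(c, φ) ψ, and both Wronskians are constant.
  have e2 : c q = k₁ * φ q.1 - k₂ * ψ q.1 := by
    rw [← hk₁ q hq, ← hk₂ q hq]
    linear_combination -c q * hw q hq
  rw [e, e2]
  simp only [paramEta, θ]
  ring

end Integration

/-! ### The range of the new independent variable -/

section Range

variable {D : Opens (ℝ × ℂ)} {χ : ℝ → ℝ} {U : ℝ × ℂ → ℂ}

theorem mem_newRange {q : ℝ × ℂ} (hq : q ∈ D) : χ q.1 ∈ newRange D χ :=
  mem_image_of_mem _ (mem_image_of_mem _ hq)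

theorem IsComplexPointTransformation.isOpen_newRange (h : IsComplexPointTransformation D χ U) :
    IsOpen (newRange D χ) := by
  rw [isOpen_iff_mem_nhds]
  rintro _ ⟨_, ⟨q, hq, rfl⟩, rfl⟩
  rw [← ((h.contDiffAt_χ hq).hasStrictDerivAt (by simp)).map_nhds_eq (h.deriv_ne_zero hq)]
  exact Filter.image_mem_map ((isOpen_fst_image D).mem_nhds (mem_image_of_mem _ hq))

theorem IsComplexPointTransformation.ordConnected_newRange (h : IsComplexPointTransformation D χ U)
    (hD : IsPreconnected (D : Set (ℝ × ℂ))) : (newRange D χ).OrdConnected :=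
  ((hD.image _ continuous_fst.continuousOn).image _ h.smooth_χ.continuousOn).ordConnected

end Range

/-- `φ, ψ` is a smooth fundamental system, with Wronskian `1`, of `y'' = i β y` on `J`. -/
structure IsFundamentalSystem (β : ℝ → ℝ) (φ ψ : ℝ → ℂ) (J : Set ℝ) : Prop where
  smooth_fst : ∀ t ∈ J, ContDiffAt ℝ ∞ φ t
  smooth_snd : ∀ t ∈ J, ContDiffAt ℝ ∞ ψ t
  equation_fst : ∀ t ∈ J, deriv (deriv φ) t = β t • (Complex.I * φ t)
  equation_snd : ∀ t ∈ J, deriv (deriv ψ) t = β t • (Complex.I * ψ t)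
  wronskian : ∀ t ∈ J, φ t * deriv ψ t - deriv φ t * ψ t = 1

/-! ### Linear independence of the candidates near a point -/

section Independence

variable {φ ψ : ℝ → ℂ}

theorem paramField_add (θ θ' : FieldParam) (q : ℝ × ℂ) :
    paramField φ ψ (θ + θ') q = paramField φ ψ θ q + paramField φ ψ θ' q := by
  refine Prod.ext ?_ ?_
  · simp [paramField, paramXi]; ring
  · simp [paramField, paramEta]; ring

theorem paramField_smul (c : ℝ) (θ : FieldParam) (q : ℝ × ℂ) :
    paramField φ ψ (c • θ) q = c • paramField φ ψ θ q := by
  refine Prod.ext ?_ ?_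
  · simp [paramField, paramXi]; ring
  · simp [paramField, paramEta]; ring

theorem paramField_sub (θ θ' : FieldParam) (q : ℝ × ℂ) :
    paramField φ ψ (θ - θ') q = paramField φ ψ θ q - paramField φ ψ θ' q := by
  rw [eq_sub_iff_add_eq, ← paramField_add, sub_add_cancel]

theorem affineFun_eventuallyEq_zero {G : Type*} [NormedAddCommGroup G] [NormedSpace ℝ G]
    {c A₀ A₁ A₂ : G} {q : ℝ × ℂ} (h : affineFun c A₀ A₁ A₂ =ᶠ[nhds q] fun _ => 0) :
    c = 0 ∧ A₀ = 0 ∧ A₁ = 0 ∧ A₂ = 0 := by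
  have h0 : A₀ = 0 := by rw [← pd_eT_affineFun c A₀ A₁ A₂ q, pd_congr h, pd_const]
  have h1 : A₁ = 0 := by rw [← pd_eY_affineFun c A₀ A₁ A₂ q, pd_congr h, pd_const]
  have h2 : A₂ = 0 := by rw [← pd_eZ_affineFun c A₀ A₁ A₂ q, pd_congr h, pd_const]
  have h3 := h.self_of_nhds
  refine ⟨?_, h0, h1, h2⟩
  simpa [affineFun, h0, h1, h2] using h3

/-- A candidate symmetry vanishing near a point has zero parameters. -/
theorem eq_zero_of_paramField_eventually_eq_zero {β : ℝ → ℝ} {J : Set ℝ}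
    (F : IsFundamentalSystem β φ ψ J) (hJ : IsOpen J) {θ : FieldParam} {q : ℝ × ℂ} (hq : q.1 ∈ J)
    (h : ∀ᶠ r in nhds q, paramField φ ψ θ r = 0) : θ = 0 := by
  have hξ : paramXi θ =ᶠ[nhds q] fun _ => 0 := h.mono fun r hr => congrArg Prod.fst hr
  have hη : paramEta φ ψ θ =ᶠ[nhds q] fun _ => 0 := h.mono fun r hr => congrArg Prod.snd hr
  have z : ∀ {G : Type} [NormedAddCommGroup G] [NormedSpace ℝ G] {f g : ℝ × ℂ → G} {v : ℝ × ℂ},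
      f =ᶠ[nhds q] (fun _ => 0) → pd v f =ᶠ[nhds q] g → g =ᶠ[nhds q] fun _ => 0 := by
    intro G _ _ f g v h1 h2
    filter_upwards [h2, h1.eventually_nhds] with r hr hr'
    rw [← hr, pd_congr hr', pd_const]
  have hJq : ∀ᶠ r : ℝ × ℂ in nhds q, r.1 ∈ J := continuousAt_fst.eventually (hJ.mem_nhds hq)
  have pE := fun r : ℝ × ℂ => fun hr : r.1 ∈ J =>
    pd_paramEta θ ((F.smooth_fst r.1 hr).differentiableAt (by simp))
      ((F.smooth_snd r.1 hr).differentiableAt (by simp))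
  obtain ⟨x0, x1, x2⟩ := pd_paramXi θ
  obtain ⟨e1, e2, -, -⟩ := affineFun_eventuallyEq_zero (z hξ x0.eventuallyEq)
  obtain ⟨e3, e4, -, -⟩ := affineFun_eventuallyEq_zero (z hξ x1.eventuallyEq)
  obtain ⟨e5, e6, -, -⟩ := affineFun_eventuallyEq_zero (z hξ x2.eventuallyEq)
  obtain ⟨e7, -⟩ := affineFun_eventuallyEq_zero
    (z hη (v := eY) (hJq.mono fun r hr => (pE r hr).2.1))
  obtain ⟨e8, -⟩ := affineFun_eventuallyEq_zero
    (z hη (v := eZ) (hJq.mono fun r hr => (pE r hr).2.2))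
  have e2' : θ.1.2.2 = 0 := by simpa using e2
  have e9 := hξ.self_of_nhds
  have e10 := hη.self_of_nhds
  have e11 := (z hη (v := eT) (hJq.mono fun r hr => (pE r hr).1)).self_of_nhds
  simp only [paramXi, e1, e2', e3, e4, e5, e6, mul_zero, add_zero] at e9
  simp only [paramEta, e2', e4, e6, e7, e8, mul_zero, add_zero, Complex.ofReal_zero, zero_mul,
    zero_add] at e10
  simp only [e2', Complex.ofReal_zero, zero_mul, zero_add] at e11
  have w := F.wronskian q.1 hq
  -- What remains is k₁φ + k₂ψ = 0 and k₁φ' + k₂ψ' = 0 at one point, a system with determinant 1.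
  have e12 : θ.2.2.2.1 = 0 := by
    linear_combination deriv ψ q.1 * e10 - ψ q.1 * e11 - θ.2.2.2.1 * w
  have e13 : θ.2.2.2.2 = 0 := by
    linear_combination φ q.1 * e11 - deriv φ q.1 * e10 - θ.2.2.2.2 * w
  exact Prod.ext (Prod.ext e9 (Prod.ext e1 e2')) (Prod.ext (Prod.ext (Complex.ext e4 e6)
    (Complex.ext e3 e5)) (Prod.ext (Prod.ext e7 e8) (Prod.ext e12 e13)))

end Independence

/-! ### Pullback of vector fields and local inverses -/

section Pullback

variable {D : Opens (ℝ × ℂ)} {χ : ℝ → ℝ} {U : ℝ × ℂ → ℂ}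

/-- The vector field related to `W` by the point transformation `(x, u) ↦ (χ(x), U(x, u))`. -/
noncomputable def pullbackField (χ : ℝ → ℝ) (U : ℝ × ℂ → ℂ) (W : ℝ × ℂ → ℝ × ℂ) :
    ℝ × ℂ → ℝ × ℂ := fun q =>
  ((W (pointMap χ U q)).1 / deriv χ q.1,
    ((W (pointMap χ U q)).2 - fderiv ℝ U q ((W (pointMap χ U q)).1 / deriv χ q.1, 0)) /
      fderiv ℝ U q (0, 1))

namespace IsComplexPointTransformation

variable (h : IsComplexPointTransformation D χ U)

include h

theorem fderiv_pointMap_pullbackField (W : ℝ × ℂ → ℝ × ℂ) {q : ℝ × ℂ} (hq : q ∈ D) :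
    fderiv ℝ (pointMap χ U) q (pullbackField χ U W q) = W (pointMap χ U q) := by
  have h1 := h.deriv_ne_zero hq
  have h2 := h.fderiv_U_one_ne_zero hq
  rw [h.fderiv_pointMap hq]
  refine Prod.ext (div_mul_cancel₀ _ h1) ?_
  have s : ∀ (a : ℝ) (b : ℂ), fderiv ℝ U q (a, b) =
      fderiv ℝ U q (a, 0) + fderiv ℝ U q (0, 1) * b := fun a b => by
    rw [← h.fderiv_U_vertical hq, ← map_add]; simp
  simp only [pullbackField]
  rw [s, mul_div_cancel₀ _ h2, add_sub_cancel]

theorem eq_pullbackField {V W : ℝ × ℂ → ℝ × ℂ} {q : ℝ × ℂ} (hq : q ∈ D)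
    (hVW : fderiv ℝ (pointMap χ U) q (V q) = W (pointMap χ U q)) : V q = pullbackField χ U W q :=
  h.fderiv_pointMap_injective hq (by rw [hVW, h.fderiv_pointMap_pullbackField W hq])

theorem contDiffAt_pullbackField {W : ℝ × ℂ → ℝ × ℂ} {q : ℝ × ℂ} (hq : q ∈ D)
    (hW : ContDiffAt ℝ ∞ W (pointMap χ U q)) : ContDiffAt ℝ ∞ (pullbackField χ U W) q := by
  have h1 : ContDiffAt ℝ ∞ (fun q => W (pointMap χ U q)) q :=
    ContDiffAt.comp (g := W) (f := pointMap χ U) q hW (h.contDiffAt_pointMap hq)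
  have h2 : ContDiffAt ℝ ∞ (fun q : ℝ × ℂ => deriv χ q.1) q :=
    ContDiffAt.comp (g := deriv χ) (f := fun q : ℝ × ℂ => q.1) q (h.contDiffAt_deriv_χ hq)
      contDiffAt_fst
  have h3 : ContDiffAt ℝ ∞ (fderiv ℝ U) q := (h.contDiffAt_U hq).fderiv_right (m := ∞) (by simp)
  have h4 : ContDiffAt ℝ ∞ (fun q => (W (pointMap χ U q)).1 / deriv χ q.1) q :=
    h1.fst.div h2 (h.deriv_ne_zero hq)
  have h5 : ContDiffAt ℝ ∞
      (fun q => fderiv ℝ U q ((W (pointMap χ U q)).1 / deriv χ q.1, (0 : ℂ))) q :=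
    h3.clm_apply (h4.prodMk contDiffAt_const)
  have h6 : ContDiffAt ℝ ∞ (fun q => fderiv ℝ U q (0, 1)) q := h3.clm_apply contDiffAt_const
  have h7 := (h1.snd.sub h5).mul (h6.inv (h.fderiv_U_one_ne_zero hq))
  exact h4.prodMk (h7.congr_of_eventuallyEq (.of_forall fun r => div_eq_mul_inv _ _))

theorem exists_hasFDerivAt_equiv {q : ℝ × ℂ} (hq : q ∈ D) :
    ∃ A : (ℝ × ℂ) ≃L[ℝ] ℝ × ℂ, fderiv ℝ (pointMap χ U) q = A :=
  ⟨(LinearEquiv.ofInjectiveEndo (fderiv ℝ (pointMap χ U) q).toLinearMap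
    (h.fderiv_pointMap_injective hq)).toContinuousLinearEquiv, by ext1 <;> rfl⟩

theorem map_pointMap_nhds {q : ℝ × ℂ} (hq : q ∈ D) :
    Filter.map (pointMap χ U) (nhds q) = nhds (pointMap χ U q) := by
  obtain ⟨A, hA⟩ := h.exists_hasFDerivAt_equiv hq
  have s := (h.contDiffAt_pointMap hq).hasStrictFDerivAt (by simp)
  rw [hA] at s
  exact s.map_nhds_eq_of_equiv

/-- A point transformation restricts to a diffeomorphism of a neighbourhood onto a connected set. -/
theorem exists_local_inverse {q : ℝ × ℂ} (hq : q ∈ D) :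
    ∃ (N M : Opens (ℝ × ℂ)) (Ψ : ℝ × ℂ → ℝ × ℂ), N ≤ D ∧ q ∈ N ∧
      IsPreconnected (M : Set (ℝ × ℂ)) ∧ (∀ r ∈ N, pointMap χ U r ∈ M ∧ Ψ (pointMap χ U r) = r) ∧
      ∀ y ∈ M, Ψ y ∈ N ∧ pointMap χ U (Ψ y) = y ∧ ContDiffAt ℝ ∞ Ψ y := by
  have hd : ∀ r ∈ D, HasFDerivAt (pointMap χ U) (fderiv ℝ (pointMap χ U) r) r := fun r hr =>
    ((h.contDiffAt_pointMap hr).differentiableAt (by simp)).hasFDerivAt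
  obtain ⟨A, hA⟩ := h.exists_hasFDerivAt_equiv hq
  obtain ⟨e, he, hqe⟩ : ∃ e : OpenPartialHomeomorph (ℝ × ℂ) (ℝ × ℂ),
      (e : ℝ × ℂ → ℝ × ℂ) = pointMap χ U ∧ q ∈ e.source :=
    ⟨ContDiffAt.toOpenPartialHomeomorph (pointMap χ U) (h.contDiffAt_pointMap hq)
      (hA ▸ hd q hq) (by simp), rfl, ContDiffAt.mem_toOpenPartialHomeomorph_source _ _ _⟩
  have ht : pointMap χ U q ∈ e.target := he ▸ e.map_source hqe
  have hs : e.symm (pointMap χ U q) = q := he ▸ e.left_inv hqe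
  have hnh : e.target ∩ e.symm ⁻¹' D ∈ nhds (pointMap χ U q) :=
    (e.symm.isOpen_inter_preimage D.isOpen).mem_nhds ⟨ht, by rwa [mem_preimage, hs]⟩
  -- A ball in the target is taken because the determining equations are integrated on a connected
  -- set.
  obtain ⟨ε, hε, hball⟩ := Metric.mem_nhds_iff.1 hnh
  have hN : ∀ r ∈ e.source ∩ e ⁻¹' Metric.ball (pointMap χ U q) ε, r ∈ D := fun r hr => by
    have := (hball hr.2).2
    rwa [mem_preimage, e.left_inv hr.1] at this
  refine ⟨⟨_, e.isOpen_inter_preimage Metric.isOpen_ball⟩, ⟨_, Metric.isOpen_ball⟩, e.symm, hN,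
    ⟨hqe, by rw [mem_preimage, he]; exact Metric.mem_ball_self hε⟩,
    (convex_ball _ _).isPreconnected, fun r hr => ⟨he ▸ hr.2, he ▸ e.left_inv hr.1⟩,
    fun y hy => ?_⟩
  have hyt := (hball hy).1
  have hyD : e.symm y ∈ D := (hball hy).2
  have hy' : pointMap χ U (e.symm y) = y := he ▸ e.right_inv hyt
  obtain ⟨B, hB⟩ := h.exists_hasFDerivAt_equiv hyD
  refine ⟨⟨e.map_target hyt, by rw [mem_preimage, e.right_inv hyt]; exact hy⟩, hy',
    e.contDiffAt_symm hyt (f₀' := B) ?_ ?_⟩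
  · rw [he, ← hB]; exact hd _ hyD
  · rw [he]; exact h.contDiffAt_pointMap hyD

/-- Every jet over the image of a point is the image of a jet over that point. -/
theorem exists_newDeriv_eq {q : ℝ × ℂ} (hq : q ∈ D) (p : ℂ) :
    ∃ p' : ℂ, newDeriv χ U (q.1, q.2, p') = p := by
  refine ⟨(deriv χ q.1 • p - fderiv ℝ U q (1, 0)) / fderiv ℝ U q (0, 1), ?_⟩
  have s : ∀ b : ℂ, fderiv ℝ U q (1, b) = fderiv ℝ U q (1, 0) + fderiv ℝ U q (0, 1) * b := fun b => by
    rw [← h.fderiv_U_vertical hq, ← map_add]; simp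
  simp only [newDeriv, totalDeriv]
  rw [inv_smul_eq_iff₀ (h.deriv_ne_zero hq), Prod.mk.eta, s,
    mul_div_cancel₀ _ (h.fderiv_U_one_ne_zero hq), add_sub_cancel]

end IsComplexPointTransformation

theorem Reduces.mono {rhs Ω : ℝ × ℂ × ℂ → ℂ} (h : Reduces D rhs χ U Ω) {D' : Opens (ℝ × ℂ)}
    (hD : D' ≤ D) : Reduces D' rhs χ U Ω :=
  ⟨h.transformation.mono hD, fun x u p hq => h.equation x u p (hD hq)⟩

end Pullback

/-! ### From local parameters to the global symmetry algebra -/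

section Gluing

variable {D : Opens (ℝ × ℂ)} {χ : ℝ → ℝ} {U : ℝ × ℂ → ℂ} {rhs : ℝ × ℂ × ℂ → ℂ} {β : ℝ → ℝ}
  {φ ψ : ℝ → ℂ}

/-- The parameters of the symmetries of the reduced system over `J`. -/
noncomputable def admissibleParams (β : ℝ → ℝ) (J : Set ℝ) : Submodule ℝ FieldParam where
  carrier := {θ | ∀ t ∈ J, IsAdmissible β θ t}
  zero_mem' t _ := by constructor <;> simp
  add_mem' := by
    intro θ θ' hθ hθ' t ht
    have h := hθ t ht
    have h' := hθ' t ht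
    constructor <;> simp only [Prod.fst_add, Prod.snd_add]
    · linear_combination h.m + h'.m
    · linear_combination h.n + h'.n
    · linear_combination h.deriv_m + h'.deriv_m
    · linear_combination h.deriv_n + h'.deriv_n
    · linear_combination h.linear + h'.linear
    · linear_combination h.quadratic + h'.quadratic
  smul_mem' := by
    intro c θ hθ t ht
    have h := hθ t ht
    constructor <;> simp only [Prod.smul_fst, Prod.smul_snd, Complex.real_smul, smul_eq_mul]
    · linear_combination c * h.m
    · linear_combination c * h.n
    · linear_combination c * h.deriv_m
    · linear_combination c * h.deriv_n
    · linear_combination c * h.linear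
    · linear_combination c * h.quadratic

open Classical in
/-- The vector field on `D` which the point transformation relates to a candidate symmetry. -/
noncomputable def symmetryOfParam (D : Opens (ℝ × ℂ)) (χ : ℝ → ℝ) (U : ℝ × ℂ → ℂ) (φ ψ : ℝ → ℂ) :
    FieldParam →ₗ[ℝ] ℝ × ℂ → ℝ × ℂ where
  toFun θ q := if q ∈ D then pullbackField χ U (paramField φ ψ θ) q else 0
  map_add' θ θ' := by
    funext q
    by_cases hq : q ∈ D
    · have e : ∀ a b : ℝ, fderiv ℝ U q (a + b, 0) = fderiv ℝ U q (a, 0) + fderiv ℝ U q (b, 0) :=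
        fun a b => by rw [← map_add]; simp
      simp only [hq, if_true, Pi.add_apply, pullbackField, paramField_add, Prod.fst_add,
        Prod.snd_add, add_div, e, Prod.mk_add_mk]
      congr 1
      ring
    · simp [hq]
  map_smul' c θ := by
    funext q
    by_cases hq : q ∈ D
    · have e : ∀ a : ℝ, fderiv ℝ U q (c * a, 0) = c * fderiv ℝ U q (a, 0) :=
        fun a => by rw [← Complex.real_smul, ← map_smul]; simp
      simp only [hq, if_true, Pi.smul_apply, pullbackField, paramField_smul, Prod.smul_fst,
        Prod.smul_snd, smul_eq_mul, mul_div_assoc, e, Prod.smul_mk, RingHom.id_apply,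
        Complex.real_smul]
      congr 1
      ring
    · simp [hq]

theorem symmetryOfParam_apply {q : ℝ × ℂ} (hq : q ∈ D) (θ : FieldParam) :
    symmetryOfParam D χ U φ ψ θ q = pullbackField χ U (paramField φ ψ θ) q := if_pos hq

theorem contDiffAt_paramField {J : Set ℝ} (F : IsFundamentalSystem β φ ψ J) (θ : FieldParam)
    {y : ℝ × ℂ} (hy : y.1 ∈ J) : ContDiffAt ℝ ∞ (paramField φ ψ θ) y :=
  (contDiff_paramXi θ).contDiffAt.prodMk
    (contDiffAt_paramEta θ (F.smooth_fst _ hy) (F.smooth_snd _ hy))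

/-- Admissible parameters define symmetries. -/
theorem symmetryOfParam_mem (h : Reduces D rhs χ U (reducedForm β))
    (hβ : ∀ t ∈ newRange D χ, ContDiffAt ℝ ∞ β t)
    (F : IsFundamentalSystem β φ ψ (newRange D χ)) {θ : FieldParam}
    (hθ : θ ∈ admissibleParams β (newRange D χ)) :
    symmetryOfParam D χ U φ ψ θ ∈ symmetryAlgebra D rhs := by
  have hT := h.transformation
  have cW : ∀ q ∈ D, ContDiffAt ℝ ∞ (paramField φ ψ θ) (pointMap χ U q) := fun q hq =>
    contDiffAt_paramField F θ (mem_newRange hq)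
  have hVW : ∀ q ∈ D, fderiv ℝ (pointMap χ U) q (symmetryOfParam D χ U φ ψ θ q) =
      paramField φ ψ θ (pointMap χ U q) := fun q hq => by
    rw [symmetryOfParam_apply hq, hT.fderiv_pointMap_pullbackField _ hq]
  have cV : ContDiffOn ℝ ∞ (symmetryOfParam D χ U φ ψ θ) D := fun q hq =>
    ((hT.contDiffAt_pullbackField hq (cW q hq)).contDiffWithinAt).congr
      (fun r hr => symmetryOfParam_apply hr θ) (symmetryOfParam_apply hq θ)
  refine ⟨fun q hq => if_neg hq, isLiePointSymmetry_iff.2 ⟨cV, fun x u p hq => ?_⟩⟩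
  have ht : χ x ∈ newRange D χ := mem_newRange hq
  have dβ : DifferentiableAt ℝ β (χ x) := (hβ _ ht).differentiableAt (by simp)
  rw [h.symmetryDefect_eq_zero_iff cV cW hVW hq (hasFDerivAt_reducedForm dβ).1]
  exact (forall_symmetryDefect_reducedForm_iff (q := pointMap χ U (x, u)) dβ rfl
    (contDiff_paramXi θ).contDiffAt
    (contDiffAt_paramEta θ (F.smooth_fst _ ht) (F.smooth_snd _ ht))).2
    ((hθ _ ht).determiningEquations (F.smooth_fst _ ht) (F.smooth_snd _ ht)
      (F.equation_fst _ ht) (F.equation_snd _ ht)) _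

/-- Near every point a symmetry is related to a candidate with admissible parameters. -/
theorem exists_local_param (h : Reduces D rhs χ U (reducedForm β))
    (hβ : ∀ t ∈ newRange D χ, ContDiffAt ℝ ∞ β t)
    (F : IsFundamentalSystem β φ ψ (newRange D χ)) {V : ℝ × ℂ → ℝ × ℂ}
    (hV : V ∈ symmetryAlgebra D rhs) {q : ℝ × ℂ} (hq : q ∈ D) :
    ∃ θ : FieldParam, (∀ᶠ r in nhds q, V r = pullbackField χ U (paramField φ ψ θ) r) ∧
      IsAdmissible β θ (χ q.1) := by
  obtain ⟨N, M, Ψ, hND, hqN, hM, hNM, hMN⟩ := h.transformation.exists_local_inverse hq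
  obtain ⟨cV, sV⟩ := isLiePointSymmetry_iff.1 hV.2
  have h' := h.mono hND
  have hT := h'.transformation
  have hJ : ∀ y ∈ M, y.1 ∈ newRange D χ := fun y hy => by
    obtain ⟨h1, h2, -⟩ := hMN y hy
    rw [← h2]
    exact mem_newRange (hND h1)
  -- The push-forward of `V`, taken through the local inverse since the transformation need not be
  -- injective on `D`.
  set W : ℝ × ℂ → ℝ × ℂ := fun y => fderiv ℝ (pointMap χ U) (Ψ y) (V (Ψ y)) with hW
  have cW : ∀ y ∈ M, ContDiffAt ℝ ∞ W y := fun y hy => by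
    obtain ⟨h1, h2, h3⟩ := hMN y hy
    have c1 : ContDiffAt ℝ ∞ (fun y => V (Ψ y)) y :=
      ContDiffAt.comp (g := V) (f := Ψ) y (cV.contDiffAt (D.isOpen.mem_nhds (hND h1))) h3
    have c2 : ContDiffAt ℝ ∞ (fun y => fderiv ℝ (pointMap χ U) (Ψ y)) y :=
      ContDiffAt.comp (g := fderiv ℝ (pointMap χ U)) (f := Ψ) y
        ((hT.contDiffAt_pointMap h1).fderiv_right (m := ∞) (by simp)) h3
    exact c2.clm_apply c1
  have hVW : ∀ r ∈ N, fderiv ℝ (pointMap χ U) r (V r) = W (pointMap χ U r) := fun r hr => by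
    rw [hW]; simp only [(hNM r hr).2]
  have dβ : ∀ y ∈ M, DifferentiableAt ℝ β y.1 := fun y hy =>
    (hβ _ (hJ y hy)).differentiableAt (by simp)
  have det : ∀ y ∈ M, DeterminingEquations β (fun y => (W y).1) (fun y => (W y).2) y := by
    intro y hy
    refine (forall_symmetryDefect_reducedForm_iff (dβ y hy) rfl (cW y hy).fst (cW y hy).snd).1
      fun p => ?_
    obtain ⟨h1, h2, -⟩ := hMN y hy
    -- The reduced condition is needed for every `p`; each one comes from a jet of the original
    -- system over the same point.
    obtain ⟨p', hp'⟩ := hT.exists_newDeriv_eq h1 p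
    have e : jetMap χ U ((Ψ y).1, (Ψ y).2, p') = (y.1, y.2, p) :=
      Prod.ext (congrArg Prod.fst h2 :) (Prod.ext (congrArg Prod.snd h2 :) hp')
    have k := h'.symmetryDefect_eq_zero_iff (cV.mono hND) (fun r hr => cW _ (hNM r hr).1) hVW
      (j := ((Ψ y).1, (Ψ y).2, p')) h1 (by rw [e]; exact (hasFDerivAt_reducedForm (dβ y hy)).1)
    rw [e] at k
    exact k.1 (sV _ _ _ (hND h1))
  obtain ⟨θ, hθ, hadm⟩ := exists_param_of_determiningEquations hM
    (fun y hy => (dβ y hy).continuousAt) (fun y hy => (cW y hy).fst) (fun y hy => (cW y hy).snd)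
    det (fun y hy => F.smooth_fst _ (hJ y hy)) (fun y hy => F.smooth_snd _ (hJ y hy))
    (fun y hy => F.equation_fst _ (hJ y hy)) (fun y hy => F.equation_snd _ (hJ y hy))
    (fun y hy => F.wronskian _ (hJ y hy))
  refine ⟨θ, ?_, hadm _ (hNM q hqN).1⟩
  filter_upwards [N.isOpen.mem_nhds hqN] with r hr
  refine hT.eq_pullbackField hr ?_
  rw [hVW r hr]
  obtain ⟨e1, e2⟩ := hθ _ (hNM r hr).1
  exact Prod.ext e1 e2

/-- Candidates which pull back to the same field near a point have the same parameters. -/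
theorem eq_of_pullbackField_eventually_eq (h : IsComplexPointTransformation D χ U)
    (F : IsFundamentalSystem β φ ψ (newRange D χ)) {θ θ' : FieldParam} {q : ℝ × ℂ} (hq : q ∈ D)
    (e : ∀ᶠ r in nhds q, pullbackField χ U (paramField φ ψ θ) r =
      pullbackField χ U (paramField φ ψ θ') r) : θ = θ' := by
  refine sub_eq_zero.1 (eq_zero_of_paramField_eventually_eq_zero F h.isOpen_newRange
    (q := pointMap χ U q) (mem_newRange hq) ?_)
  rw [← h.map_pointMap_nhds hq, Filter.eventually_map]
  filter_upwards [e, D.isOpen.mem_nhds hq] with r hr hrD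
  rw [paramField_sub, ← h.fderiv_pointMap_pullbackField (paramField φ ψ θ) hrD,
    ← h.fderiv_pointMap_pullbackField (paramField φ ψ θ') hrD, hr, sub_self]

/-- The symmetry algebra is isomorphic to the space of admissible parameters. -/
theorem finrank_symmetryAlgebra (hD : IsConnected (D : Set (ℝ × ℂ)))
    (h : Reduces D rhs χ U (reducedForm β)) (hβ : ContDiffOn ℝ ∞ β (newRange D χ)) :
    Module.finrank ℝ (symmetryAlgebra D rhs) =
      Module.finrank ℝ (admissibleParams β (newRange D χ)) := by
  have hT := h.transformation
  have hJ := hT.isOpen_newRange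
  have hβ' : ∀ t ∈ newRange D χ, ContDiffAt ℝ ∞ β t := fun t ht => hβ.contDiffAt (hJ.mem_nhds ht)
  obtain ⟨q₀, hq₀⟩ := hD.nonempty
  obtain ⟨φ, ψ, f1, f2, f3, f4, f5⟩ := exists_fundamental_system hJ
    (hT.ordConnected_newRange hD.isPreconnected) ⟨_, mem_newRange hq₀⟩ hβ
  have F : IsFundamentalSystem β φ ψ (newRange D χ) :=
    ⟨fun t ht => f1.contDiffAt (hJ.mem_nhds ht), fun t ht => f2.contDiffAt (hJ.mem_nhds ht), f3,
      f4, f5⟩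
  have inj : Function.Injective (symmetryOfParam D χ U φ ψ) := by
    intro θ θ' e
    refine eq_of_pullbackField_eventually_eq hT F hq₀ ?_
    filter_upwards [D.isOpen.mem_nhds hq₀] with r hr
    rw [← symmetryOfParam_apply hr, e, symmetryOfParam_apply hr]
  have key : symmetryAlgebra D rhs =
      (admissibleParams β (newRange D χ)).map (symmetryOfParam D χ U φ ψ) := by
    refine le_antisymm (fun V hV => ?_) ?_
    · choose! θ hθ hadm using fun q (hq : q ∈ D) => exists_local_param h hβ' F hV hq
      have : PreconnectedSpace D := Subtype.preconnectedSpace hD.isPreconnected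
      -- At a nearby point both the old and the new parameters describe `V` near that point, so they
      -- coincide by uniqueness of germs.
      have lc : IsLocallyConstant fun q : D => θ q := by
        rw [IsLocallyConstant.iff_eventually_eq]
        intro q
        have ev : ∀ᶠ r in nhds (q : ℝ × ℂ), r ∈ D → θ r = θ q := by
          filter_upwards [(hθ q q.2).eventually_nhds] with r hr hrD
          refine eq_of_pullbackField_eventually_eq hT F hrD ?_
          filter_upwards [hr, hθ r hrD] with s h1 h2
          rw [← h1, ← h2]
        exact (continuousAt_subtype_val.eventually ev).mono fun r hr => hr r.2
      have hc : ∀ q ∈ D, θ q = θ q₀ := fun q hq =>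
        lc.apply_eq_of_preconnectedSpace ⟨q, hq⟩ ⟨q₀, hq₀⟩
      refine ⟨θ q₀, ?_, ?_⟩
      · rintro _ ⟨_, ⟨q, hq, rfl⟩, rfl⟩
        exact hc q hq ▸ hadm q hq
      · funext q
        by_cases hq : q ∈ D
        · rw [symmetryOfParam_apply hq, ← hc q hq, ← (hθ q hq).self_of_nhds]
        · rw [hV.1 q hq]; exact if_neg hq
    · rintro _ ⟨θ, hθ, rfl⟩
      exact symmetryOfParam_mem h hβ' F hθ
  rw [key]
  exact (Submodule.equivMapOfInjective _ inj _).finrank_eq.symm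

end Gluing

/-! ### Dimension of the space of admissible parameters -/

section Dimension

theorem coeff_eq_zero_of_cubic_eq_zero {S : Set ℝ} (hS : S.Infinite) {c₀ c₁ c₂ c₃ : ℝ}
    (h : ∀ t ∈ S, c₀ + c₁ * t + c₂ * t ^ 2 + c₃ * t ^ 3 = 0) :
    c₀ = 0 ∧ c₁ = 0 ∧ c₂ = 0 ∧ c₃ = 0 := by
  open Polynomial in
  let p : ℝ[X] := C c₀ + C c₁ * X + C c₂ * X ^ 2 + C c₃ * X ^ 3
  have hp : p = 0 := Polynomial.eq_zero_of_infinite_isRoot p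
    (hS.mono fun t ht => by simpa [p, Polynomial.IsRoot] using h t ht)
  have k : ∀ n, p.coeff n = 0 := fun n => by rw [hp, Polynomial.coeff_zero]
  have k0 := k 0
  have k1 := k 1
  have k2 := k 2
  have k3 := k 3
  simp [p, Polynomial.coeff_X, Polynomial.coeff_C, Polynomial.coeff_X_pow] at k0 k1 k2 k3
  exact ⟨k0, k1, k2, k3⟩

variable {β : ℝ → ℝ} {J : Set ℝ}

/-- The coefficients of the quadratic polynomials `p` with `2 β p' + β' p = 0` on `J`. -/
noncomputable def quadraticParams (β : ℝ → ℝ) (J : Set ℝ) : Submodule ℝ (ℝ × ℝ × ℝ) where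
  carrier := {a | ∀ t ∈ J, 2 * β t * (a.2.1 + 2 * t * a.2.2) +
    deriv β t * (a.1 + t * a.2.1 + t ^ 2 * a.2.2) = 0}
  zero_mem' t _ := by simp
  add_mem' := by
    intro a b ha hb t ht
    simp only [Prod.fst_add, Prod.snd_add]
    linear_combination ha t ht + hb t ht
  smul_mem' := by
    intro c a ha t ht
    simp only [Prod.smul_fst, Prod.smul_snd, smul_eq_mul]
    linear_combination c * ha t ht

theorem deriv_eq_of_eqOn (hJ : IsOpen J) {g : ℝ → ℝ} (h : ∀ t ∈ J, β t = g t) {t : ℝ} (ht : t ∈ J) :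
    deriv β t = deriv g t :=
  Filter.EventuallyEq.deriv_eq (by filter_upwards [hJ.mem_nhds ht] with s hs using h s hs)

theorem finrank_admissibleParams_of_eq_zero (hJ : IsOpen J) (h : ∀ t ∈ J, β t = 0) :
    Module.finrank ℝ (admissibleParams β J) = 15 := by
  have e : admissibleParams β J = ⊤ := by
    refine eq_top_iff.2 fun θ _ t ht => ?_
    have h' : deriv β t = 0 := by rw [deriv_eq_of_eqOn hJ h ht, deriv_const]
    constructor <;> simp [h t ht, h']
  rw [e, finrank_top]
  -- The real dimensions are 3 + 4 + 4 + 4.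
  simp [Module.finrank_prod, Complex.finrank_real_complex]

/-- For a coefficient which does not vanish identically, the admissible parameters are a quadratic
polynomial, a complex factor and a pair of complex constants. -/
noncomputable def admissibleParamsEquiv (h : ∃ t ∈ J, β t ≠ 0) :
    admissibleParams β J ≃ₗ[ℝ] quadraticParams β J × ℂ × ℂ × ℂ where
  toFun θ := (⟨θ.1.1, fun t ht => (θ.2 t ht).quadratic⟩, θ.1.2.2.1.1, θ.1.2.2.2)
  map_add' _ _ := rfl
  map_smul' _ _ := rfl
  invFun a := ⟨(a.1.1, (0, 0), (a.2.1, Complex.I * a.2.1), a.2.2), fun t ht => by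
    have := a.1.2 t ht
    constructor <;> simp
    exact this⟩
  left_inv := by
    rintro ⟨⟨a, ⟨m, n⟩, ⟨C₁, C₂⟩, k⟩, hθ⟩
    obtain ⟨t, ht, hβ⟩ := h
    have hβ' : (β t : ℂ) ≠ 0 := Complex.ofReal_ne_zero.2 hβ
    have hm : m = 0 := (mul_eq_zero.1 (hθ t ht).m).resolve_left hβ'
    have hn : n = 0 := (mul_eq_zero.1 (hθ t ht).n).resolve_left hβ'
    have hC : C₂ = Complex.I * C₁ :=
      sub_eq_zero.1 ((mul_eq_zero.1 (hθ t ht).linear).resolve_left hβ')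
    subst hm hn hC
    rfl
  right_inv _ := rfl

theorem finrank_admissibleParams_of_ne_zero (h : ∃ t ∈ J, β t ≠ 0) :
    Module.finrank ℝ (admissibleParams β J) = Module.finrank ℝ (quadraticParams β J) + 6 := by
  rw [(admissibleParamsEquiv h).finrank_eq]
  simp [Module.finrank_prod, Complex.finrank_real_complex]

theorem infinite_setOf_ne_zero (hJ : IsOpen J) (hβ : ContinuousOn β J) (h : ∃ t ∈ J, β t ≠ 0) :
    {t | t ∈ J ∧ β t ≠ 0}.Infinite := by
  obtain ⟨t, ht, hne⟩ := h
  exact infinite_of_mem_nhds t ((hJ.eventually_mem ht).and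
    ((hβ.continuousAt (hJ.mem_nhds ht)).eventually_ne hne))

/-- For two solutions p and q, eliminating β' gives β(p'q - pq') = 0. On the infinite set where β ≠
0 the polynomial p'q - pq' vanishes, so its coefficients are zero. Up to factors these are the 2 × 2
minors of the coefficient vectors, so p and q are proportional. -/
theorem finrank_quadraticParams_le_one (hJ : IsOpen J) (hβ : ContinuousOn β J)
    (h : ∃ t ∈ J, β t ≠ 0) : Module.finrank ℝ (quadraticParams β J) ≤ 1 := by
  have minors : ∀ a ∈ quadraticParams β J, ∀ b ∈ quadraticParams β J,
      a.2.1 * b.1 - a.1 * b.2.1 = 0 ∧ 2 * a.2.2 * b.1 - 2 * a.1 * b.2.2 = 0 ∧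
        a.2.2 * b.2.1 - a.2.1 * b.2.2 = 0 := by
    intro a ha b hb
    obtain ⟨h0, h1, h2, -⟩ := coeff_eq_zero_of_cubic_eq_zero (c₀ := a.2.1 * b.1 - a.1 * b.2.1)
      (c₁ := 2 * a.2.2 * b.1 - 2 * a.1 * b.2.2) (c₂ := a.2.2 * b.2.1 - a.2.1 * b.2.2) (c₃ := 0)
      (infinite_setOf_ne_zero hJ hβ h) fun t ht => by
        refine (mul_eq_zero.1 ?_).resolve_left ht.2
        linear_combination (b.1 + t * b.2.1 + t ^ 2 * b.2.2) / 2 * ha t ht.1 -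
          (a.1 + t * a.2.1 + t ^ 2 * a.2.2) / 2 * hb t ht.1
    exact ⟨h0, h1, h2⟩
  by_cases h0 : ∃ a ∈ quadraticParams β J, a ≠ 0
  · obtain ⟨⟨a₀, a₁, a₂⟩, ha, hne⟩ := h0
    refine finrank_le_one ⟨(a₀, a₁, a₂), ha⟩ ?_
    rintro ⟨⟨b₀, b₁, b₂⟩, hb⟩
    obtain ⟨e0, e1, e2⟩ := minors _ ha _ hb
    simp only at e0 e1 e2
    have hn : a₀ ≠ 0 ∨ a₁ ≠ 0 ∨ a₂ ≠ 0 := by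
      by_contra! hc
      exact hne (by rw [hc.1, hc.2.1, hc.2.2]; rfl)
    rcases hn with hn | hn | hn
    · refine ⟨b₀ / a₀, Subtype.ext (Prod.ext ?_ (Prod.ext ?_ ?_))⟩ <;> simp <;> field_simp <;> linarith
    · refine ⟨b₁ / a₁, Subtype.ext (Prod.ext ?_ (Prod.ext ?_ ?_))⟩ <;> simp <;> field_simp <;> linarith
    · refine ⟨b₂ / a₂, Subtype.ext (Prod.ext ?_ (Prod.ext ?_ ?_))⟩ <;> simp <;> field_simp <;> linarith
  · push Not at h0
    rw [(Submodule.eq_bot_iff _).2 h0, finrank_bot]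
    exact zero_le_one

/-- Since p(2βp' + β'p) = (βp²)', a suitable witness is a polynomial p proportional to β^(-1/2). In
the applications it is 1, t, and (t + r)². -/
theorem finrank_admissibleParams_eq_seven (hJ : IsOpen J) (hβ : ContinuousOn β J)
    (h : ∃ t ∈ J, β t ≠ 0) {a : ℝ × ℝ × ℝ} (ha : a ∈ quadraticParams β J) (ha0 : a ≠ 0) :
    Module.finrank ℝ (admissibleParams β J) = 7 := by
  have h1 := finrank_quadraticParams_le_one hJ hβ h
  have h2 : 0 < Module.finrank ℝ (quadraticParams β J) :=
    Module.finrank_pos_iff_exists_ne_zero.2 ⟨⟨a, ha⟩, fun e => ha0 (congrArg Subtype.val e)⟩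
  rw [finrank_admissibleParams_of_ne_zero h]
  omega

theorem finrank_admissibleParams_eq_six (h : ∃ t ∈ J, β t ≠ 0)
    (h0 : ∀ a ∈ quadraticParams β J, a = 0) :
    Module.finrank ℝ (admissibleParams β J) = 6 := by
  rw [finrank_admissibleParams_of_ne_zero h, (Submodule.eq_bot_iff _).2 h0, finrank_bot]

theorem finrank_admissibleParams_const (hJ : IsOpen J) (hne : J.Nonempty) {c : ℝ} (hc : c ≠ 0)
    (h : ∀ t ∈ J, β t = c) : Module.finrank ℝ (admissibleParams β J) = 7 := by
  obtain ⟨t₀, ht₀⟩ := hne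
  refine finrank_admissibleParams_eq_seven hJ (continuousOn_const.congr h)
    ⟨t₀, ht₀, by rwa [h t₀ ht₀]⟩ (a := (1, 0, 0)) (fun t ht => ?_) (by simp)
  rw [deriv_eq_of_eqOn hJ h ht]
  simp

theorem finrank_admissibleParams_inv_sq (hJ : IsOpen J) (hne : J.Nonempty) (h0 : (0 : ℝ) ∉ J)
    (hβ : ContinuousOn β J) (h : ∀ t ∈ J, β t = 1 / t ^ 2) :
    Module.finrank ℝ (admissibleParams β J) = 7 := by
  obtain ⟨t₀, ht₀⟩ := hne
  have n0 : ∀ t ∈ J, t ≠ 0 := fun t ht e => h0 (e ▸ ht)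
  refine finrank_admissibleParams_eq_seven hJ hβ
    ⟨t₀, ht₀, by rw [h t₀ ht₀]; exact one_div_ne_zero (pow_ne_zero _ (n0 t₀ ht₀))⟩
    (a := (0, 1, 0)) (fun t ht => ?_) (by simp)
  have ht0 := n0 t ht
  have hd : HasDerivAt (fun s : ℝ => 1 / s ^ 2) _ t :=
    (hasDerivAt_const t (1 : ℝ)).div (hasDerivAt_pow 2 t) (pow_ne_zero _ ht0)
  rw [deriv_eq_of_eqOn hJ h ht, hd.deriv, h t ht]
  field_simp
  norm_num
  ring

theorem finrank_admissibleParams_inv_pow_four (hJ : IsOpen J) (hne : J.Nonempty) {r : ℝ}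
    (h0 : -r ∉ J) (hβ : ContinuousOn β J) (h : ∀ t ∈ J, β t = 1 / (t + r) ^ 4) :
    Module.finrank ℝ (admissibleParams β J) = 7 := by
  obtain ⟨t₀, ht₀⟩ := hne
  have n0 : ∀ t ∈ J, t + r ≠ 0 := fun t ht e => h0 (eq_neg_of_add_eq_zero_left e ▸ ht)
  refine finrank_admissibleParams_eq_seven hJ hβ
    ⟨t₀, ht₀, by rw [h t₀ ht₀]; exact one_div_ne_zero (pow_ne_zero _ (n0 t₀ ht₀))⟩
    -- The coefficients of (t + r)².
    (a := (r ^ 2, 2 * r, 1)) (fun t ht => ?_) (by simp)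
  have ht0 := n0 t ht
  have hd : HasDerivAt (fun s : ℝ => 1 / (s + r) ^ 4) _ t :=
    (hasDerivAt_const t (1 : ℝ)).div (((hasDerivAt_id t).add_const r).pow 4) (pow_ne_zero _ ht0)
  rw [deriv_eq_of_eqOn hJ h ht, hd.deriv, h t ht]
  simp
  field_simp
  ring

theorem finrank_admissibleParams_inv (hJ : IsOpen J) (hne : J.Nonempty) (h0 : (0 : ℝ) ∉ J)
    (h : ∀ t ∈ J, β t = 1 / t) : Module.finrank ℝ (admissibleParams β J) = 6 := by
  obtain ⟨t₀, ht₀⟩ := hne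
  have n0 : ∀ t ∈ J, t ≠ 0 := fun t ht e => h0 (e ▸ ht)
  refine finrank_admissibleParams_eq_six
    ⟨t₀, ht₀, by rw [h t₀ ht₀]; exact one_div_ne_zero (n0 t₀ ht₀)⟩ fun a ha => ?_
  obtain ⟨e0, e1, e2, -⟩ := coeff_eq_zero_of_cubic_eq_zero (c₀ := -a.1) (c₁ := a.2.1)
    -- Multiplying 2βp' + β'p by t² clears the denominators and leaves -a₀ + a₁t + 3a₂t².
    (c₂ := 3 * a.2.2) (c₃ := 0) (infinite_of_mem_nhds t₀ (hJ.mem_nhds ht₀)) fun t ht => by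
      have ht0 := n0 t ht
      have hd : HasDerivAt (fun s : ℝ => 1 / s) _ t :=
        (hasDerivAt_const t (1 : ℝ)).div (hasDerivAt_id t) ht0
      have k := ha t ht
      rw [deriv_eq_of_eqOn hJ h ht, hd.deriv, h t ht] at k
      field_simp at k
      linear_combination k
  exact Prod.ext (neg_eq_zero.1 e0) (Prod.ext e1 (by simpa using e2))

theorem finrank_admissibleParams_sq_add (hJ : IsOpen J) (hne : J.Nonempty) {c : ℝ}
    (h : ∀ t ∈ J, β t = t ^ 2 + c) : Module.finrank ℝ (admissibleParams β J) = 6 := by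
  obtain ⟨t₀, ht₀⟩ := hne
  have inf : J.Infinite := infinite_of_mem_nhds t₀ (hJ.mem_nhds ht₀)
  refine finrank_admissibleParams_eq_six ?_ fun a ha => ?_
  -- The polynomial t² + c cannot vanish on an infinite set, its leading coefficient being 1.
  · by_contra! hc
    have := (coeff_eq_zero_of_cubic_eq_zero (c₀ := c) (c₁ := 0) (c₂ := 1) (c₃ := 0) inf
      fun t ht => by linear_combination hc t ht - h t ht).2.2.1
    exact one_ne_zero this
  obtain ⟨-, e1, e2, e3⟩ := coeff_eq_zero_of_cubic_eq_zero (c₀ := 2 * c * a.2.1)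
    (c₁ := 4 * c * a.2.2 + 2 * a.1) (c₂ := 4 * a.2.1) (c₃ := 6 * a.2.2) inf fun t ht => by
      have hd : HasDerivAt (fun s : ℝ => s ^ 2 + c) _ t := (hasDerivAt_pow 2 t).add_const c
      have k := ha t ht
      rw [deriv_eq_of_eqOn hJ h ht, hd.deriv, h t ht] at k
      norm_num at k
      linear_combination k
  have e4 : a.2.2 = 0 := by simpa using e3
  exact Prod.ext (by simpa [e4] using e1) (Prod.ext (by simpa using e2) e4)

theorem finrank_admissibleParams_exp (hJ : IsOpen J) (hne : J.Nonempty)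
    (h : ∀ t ∈ J, β t = Real.exp t) : Module.finrank ℝ (admissibleParams β J) = 6 := by
  obtain ⟨t₀, ht₀⟩ := hne
  refine finrank_admissibleParams_eq_six
    ⟨t₀, ht₀, by rw [h t₀ ht₀]; exact Real.exp_ne_zero _⟩ fun a ha => ?_
  -- With β' = β the equation is the exponential times the polynomial 2p' + p, which must vanish
  -- identically.
  obtain ⟨e0, e1, e2, -⟩ := coeff_eq_zero_of_cubic_eq_zero (c₀ := 2 * a.2.1 + a.1)
    (c₁ := 4 * a.2.2 + a.2.1) (c₂ := a.2.2) (c₃ := 0)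
    (infinite_of_mem_nhds t₀ (hJ.mem_nhds ht₀)) fun t ht => by
      have k := ha t ht
      rw [deriv_eq_of_eqOn hJ h ht, Real.deriv_exp, h t ht] at k
      refine (mul_eq_zero.1 ?_).resolve_left (Real.exp_ne_zero t)
      linear_combination k
  have e4 : a.2.1 = 0 := by simpa [e2] using e1
  exact Prod.ext (by simpa [e4] using e0) (Prod.ext e4 e2)

end Dimension

end PointSymmetry

theorem theorem6 (D : TopologicalSpace.Opens (ℝ × ℂ))
    (hD : IsConnected (D : Set (ℝ × ℂ)))
    (rhs : ℝ × ℂ × ℂ → ℂ) (χ : ℝ → ℝ) (U : ℝ × ℂ → ℂ) (β : ℝ → ℝ)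
    (hβ : ContDiffOn ℝ ∞ β (PointSymmetry.newRange D χ))
    (hred : PointSymmetry.Reduces D rhs χ U (PointSymmetry.reducedForm β))
    (J : Set ℝ) (hJ : J = PointSymmetry.newRange D χ)
    (d : ℕ) (hd : d = Module.finrank ℝ (PointSymmetry.symmetryAlgebra D rhs)) :
    -- only dimensions 6, 7 and 15; in particular never 5 or 8
    (d = 6 ∨ d = 7 ∨ d = 15) ∧ d ≠ 5 ∧ d ≠ 8 ∧
    -- zero coefficient; coefficient not identically zero; non-zero constant coefficient
    ((∀ t ∈ J, β t = 0) → d = 15) ∧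
    ((∃ t ∈ J, β t ≠ 0) → d = 6 ∨ d = 7) ∧
    ((∃ c : ℝ, c ≠ 0 ∧ ∀ t ∈ J, β t = c) → d = 7) ∧
    -- variable coefficients with a 7-dimensional algebra
    (((0 : ℝ) ∉ J ∧ ∀ t ∈ J, β t = 1 / t ^ 2) → d = 7) ∧
    (((0 : ℝ) ∉ J ∧ ∀ t ∈ J, β t = 1 / t ^ 4) → d = 7) ∧
    (((-1 : ℝ) ∉ J ∧ ∀ t ∈ J, β t = 1 / (t + 1) ^ 4) → d = 7) ∧
    -- variable coefficients with a 6-dimensional algebra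
    (((0 : ℝ) ∉ J ∧ ∀ t ∈ J, β t = 1 / t) → d = 6) ∧
    ((∃ c : ℝ, ∀ t ∈ J, β t = t ^ 2 + c) → d = 6) ∧
    ((∀ t ∈ J, β t = Real.exp t) → d = 6) := by
  subst hJ hd
  have hO := hred.transformation.isOpen_newRange
  have hne : (PointSymmetry.newRange D χ).Nonempty := (hD.nonempty.image _).image _
  have hc := hβ.continuousOn
  rw [PointSymmetry.finrank_symmetryAlgebra hD hred hβ]
  have zero := PointSymmetry.finrank_admissibleParams_of_eq_zero (β := β) hO
  have nonzero : (∃ t ∈ PointSymmetry.newRange D χ, β t ≠ 0) → _ := fun h =>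
    And.intro (PointSymmetry.finrank_admissibleParams_of_ne_zero h)
      (PointSymmetry.finrank_quadraticParams_le_one hO hc h)
  -- Either β vanishes on the range and the dimension is 15, or it is 6 plus the dimension, 0 or 1,
  -- of the space of quadratic polynomials.
  have all : Module.finrank ℝ (PointSymmetry.admissibleParams β (PointSymmetry.newRange D χ)) = 15 ∨
      Module.finrank ℝ (PointSymmetry.admissibleParams β (PointSymmetry.newRange D χ)) = 6 ∨
      Module.finrank ℝ (PointSymmetry.admissibleParams β (PointSymmetry.newRange D χ)) = 7 := by
    by_cases h : ∃ t ∈ PointSymmetry.newRange D χ, β t ≠ 0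
    · have := nonzero h
      omega
    · push Not at h
      exact Or.inl (zero h)
  refine ⟨by omega, by omega, by omega, zero, fun h => ?_, ?_, ?_, ?_, ?_, ?_, ?_, ?_⟩
  · have := nonzero h
    omega
  · rintro ⟨c, h0, h⟩
    exact PointSymmetry.finrank_admissibleParams_const hO hne h0 h
  · rintro ⟨h0, h⟩
    exact PointSymmetry.finrank_admissibleParams_inv_sq hO hne h0 hc h
  · rintro ⟨h0, h⟩
    exact PointSymmetry.finrank_admissibleParams_inv_pow_four (r := 0) hO hne (by simpa using h0) hc
      (by simpa using h)
  · rintro ⟨h0, h⟩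
    exact PointSymmetry.finrank_admissibleParams_inv_pow_four (r := 1) hO hne h0 hc h
  · rintro ⟨h0, h⟩
    exact PointSymmetry.finrank_admissibleParams_inv hO hne h0 h
  · rintro ⟨c, h⟩
    exact PointSymmetry.finrank_admissibleParams_sq_add hO hne h
  · exact PointSymmetry.finrank_admissibleParams_exp hO hne
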